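/- Let $m>0$ (bare mass), $Z>0$ (atomic number), $\mathsf e\in\mathbb R$ (charge), and $0<\kappa<\Lambda<\infty$. Let $\mathcal F$ be the symmetric Fock space over $L^2(\mathbb R^3)$ with creation and annihilation operators $a^*(k),a(k)$, let $\mathcal H=L^2(\mathbb R^3)\otimes\mathcal F$, $p=-i\nabla_x$, $H_{\rm f}=\int_{\mathbb R^3}|k|\,a^*(k)a(k)\,d^3k$, and $$A_{\kappa\Lambda}=\int_{\mathbb R^3}\frac{\widehat\varphi(mk)}{\sqrt{2|k|}}\,\frac{k}{|k|+|k|^2/2}\,e^{ik\cdot x}a(k)\,d^3k ,\qquad \widehat\varphi(k)=\begin{cases}(2\pi)^{-3/2},&\kappa\le|k|\le\Lambda,\\ 0,&\text{otherwise.}\end{cases}$$ Consider on $\mathcal H$, with domain $D(p^2)\cap D(H_{\rm f})$, the cutoff Hamiltonian $$H_{\kappa\Lambda}=\tfrac12p^2-\frac{\mathsf e^2Z}{4\pi|x|}+H_{\rm f}+\mathsf e\,(p\cdot A_{\kappa\Lambda}+A_{\kappa\Lambda}^*\cdot p)+\frac{\mathsf e^2}{2}\left(A_{\kappa\Lambda}^2+2A_{\kappa\Lambda}^*\cdot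 A_{\kappa\Lambda}+A_{\kappa\Lambda}^{*2}\right),$$ and let $H^{V=0}_{\kappa\Lambda}$ be the same operator with the Coulomb potential $-\mathsf e^2Z/(4\pi|x|)$ omitted. Put $$E_{\kappa\Lambda}=\inf\sigma(H_{\kappa\Lambda}),\qquad E^{V=0}_{\kappa\Lambda}=\inf\sigma(H^{V=0}_{\kappa\Lambda}),\qquad E_{\rm at}=\inf\sigma\left(\tfrac12p^2-\frac{\mathsf e^2Z}{4\pi|x|}\ \text{on}\ L^2(\mathbb R^3)\right).$$ Let $\mathsf e_{\rm UV}$ be the unique positive solution of $C_{\rm UV}(\mathsf e_{\rm UV})=1$, where $$C_{\rm UV}(t)=\frac{2t}{\pi}\sqrt{1+\frac12\left(\frac{t^2Z}{4\pi}\right)^2}+\frac{1}{4\pi^2}\left(14+\sqrt6\,\pi\right)t^2 .$$ If $0<|\mathsf e|<\mathsf e_{\rm UV}$, then for all $0<\kappa<\Lambda<\infty$ the three infima are finite, $E_{\rm at}=-\frac12\left(\frac{\mathsf e^2Z}{4\pi}\right)^2$, and the binding energy satisfies $$E^{V=0}_{\kappa\Lambda}-E_{\kappa\Lambda}\ \ge\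 -E_{\rm at}\ >\ 0 .$$ -/

import Mathlib

/-! A non-relativistic particle coupled to a massless scalar Bose field and to an infinitely heavy
nucleus at the origin (Nelson's model with ultraviolet and infrared cutoff, after the Gross
transformation). The Hilbert space `L²(ℝ³) ⊗ 𝓕` is realised as `L²(ℝ³; 𝓕)`, with `𝓕` the symmetric
Fock space over `L²(ℝ³)`. Unbounded operators are Mathlib's `LinearPMap`s; sums, multiples and
products of them carry their natural domains. -/

open MeasureTheory
open scoped ENNReal InnerProductSpace SchwartzMap LineDeriv LinearPMap

noncomputable section

namespace NelsonAtom

/-! ### Unbounded operators -/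

section Operators

variable {E F G : Type*} [AddCommGroup E] [Module ℂ E] [AddCommGroup F] [Module ℂ F]
  [AddCommGroup G] [Module ℂ G]

/-- The graph of the product `S T` on its natural domain `{x ∈ D(T) | T x ∈ D(S)}`. -/
def compGraph (S : F →ₗ.[ℂ] G) (T : E →ₗ.[ℂ] F) : Submodule ℂ (E × G) where
  carrier := {q | ∃ y : F, (q.1, y) ∈ T.graph ∧ (y, q.2) ∈ S.graph}
  add_mem' := by
    rintro a b ⟨y, h1, h2⟩ ⟨y', h1', h2'⟩
    exact ⟨y + y', T.graph.add_mem h1 h1', S.graph.add_mem h2 h2'⟩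
  zero_mem' := ⟨0, T.graph.zero_mem, S.graph.zero_mem⟩
  smul_mem' := by
    rintro c a ⟨y, h1, h2⟩
    exact ⟨c • y, T.graph.smul_mem c h1, S.graph.smul_mem c h2⟩

/-- The product `S T` of unbounded operators, on its natural domain. -/
def opComp (S : F →ₗ.[ℂ] G) (T : E →ₗ.[ℂ] F) : E →ₗ.[ℂ] G := (compGraph S T).toLinearPMap

theorem opComp_graph (S : F →ₗ.[ℂ] G) (T : E →ₗ.[ℂ] F) :
    (opComp S T).graph = compGraph S T := by
  refine Submodule.toLinearPMap_graph_eq _ ?_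
  rintro ⟨x, z⟩ ⟨y, h1, h2⟩ hx
  have hx' : x = 0 := hx
  have hy : y = 0 := T.graph_fst_eq_zero_snd h1 hx'
  exact S.graph_fst_eq_zero_snd h2 hy

end Operators

section Spectrum

variable {E : Type*} [NormedAddCommGroup E] [NormedSpace ℂ E]

/-- `z` is in the resolvent set of `T`: `T - z` is a bijection of `D(T)` onto the whole space,
with a bounded inverse `R`. -/
def IsRegularValue (T : E →ₗ.[ℂ] E) (z : ℂ) : Prop :=
  ∃ R : E →L[ℂ] E, (∀ y : E, (R y, y + z • R y) ∈ T.graph) ∧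
    ∀ x : T.domain, R (T x - z • (x : E)) = x

/-- The spectrum of an unbounded operator. -/
def opSpectrum (T : E →ₗ.[ℂ] E) : Set ℂ := {z | ¬ IsRegularValue T z}

/-- The (real) spectrum, as a set of real numbers. -/
def realSpectrum (T : E →ₗ.[ℂ] E) : Set ℝ := {t | (t : ℂ) ∈ opSpectrum T}

/-- The spectrum of `T` has a finite infimum. -/
def HasFiniteInf (T : E →ₗ.[ℂ] E) : Prop :=
  (realSpectrum T).Nonempty ∧ BddBelow (realSpectrum T)

/-- The ground state energy `inf σ(T)`. -/
def groundEnergy (T : E →ₗ.[ℂ] E) : ℝ := sInf (realSpectrum T)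

end Spectrum

/-! ### Operators on `L²(ℝ³; K)` -/

/-- The space `ℝ³`, both for positions and for momenta. -/
abbrev R3 : Type := EuclideanSpace ℝ (Fin 3)

section Particle

variable (K : Type*) [NormedAddCommGroup K] [InnerProductSpace ℂ K] [CompleteSpace K]

/-- `L²(ℝ³; K)`, that is `L²(ℝ³) ⊗ K`. -/
abbrev ParticleSpace : Type _ := Lp K 2 (volume : Measure R3)

/-- The graph of `p_j = -i ∂_j`: pairs `(ψ, φ)` of `L²` functions with `∂_j ψ = i φ` in the sense
of (tempered) distributions. -/
def momentumGraph (j : Fin 3) : Submodule ℂ (ParticleSpace K × ParticleSpace K) where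
  carrier := {q | ∂_{(EuclideanSpace.single j (1 : ℝ) : R3)} (q.1 : 𝓢'(R3, K))
    = Complex.I • (q.2 : 𝓢'(R3, K))}
  add_mem' := by
    intro a b ha hb
    simp only [Set.mem_ofPred_eq, ← Lp.toTemperedDistributionCLM_apply, Prod.fst_add, Prod.snd_add,
      map_add, smul_add, LineDeriv.lineDerivOp_add] at ha hb ⊢
    rw [ha, hb]
  zero_mem' := by
    simp only [Set.mem_ofPred_eq, ← Lp.toTemperedDistributionCLM_apply, Prod.fst_zero,
      Prod.snd_zero, map_zero, smul_zero, LineDeriv.lineDerivOp_zero]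
  smul_mem' := by
    intro c a ha
    simp only [Set.mem_ofPred_eq, ← Lp.toTemperedDistributionCLM_apply, Prod.smul_fst,
      Prod.smul_snd, map_smul, LineDeriv.lineDerivOp_smul] at ha ⊢
    rw [ha, smul_comm]

/-- The momentum operator `p_j = -i ∂_j` of the particle, on its maximal domain. -/
def momentum (j : Fin 3) : ParticleSpace K →ₗ.[ℂ] ParticleSpace K :=
  (momentumGraph K j).toLinearPMap

theorem momentum_graph (j : Fin 3) : (momentum K j).graph = momentumGraph K j := by
  refine Submodule.toLinearPMap_graph_eq _ ?_
  rintro ⟨x, y⟩ h hx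
  have hx' : x = 0 := hx
  subst hx'
  have h' : ∂_{(EuclideanSpace.single j (1 : ℝ) : R3)} ((0 : ParticleSpace K) : 𝓢'(R3, K))
    = Complex.I • (y : 𝓢'(R3, K)) := h
  simp only [← Lp.toTemperedDistributionCLM_apply, map_zero, LineDeriv.lineDerivOp_zero] at h'
  have h2 : Lp.toTemperedDistributionCLM K volume 2 y = 0 := by
    rcases smul_eq_zero.mp h'.symm with h3 | h3
    · exact absurd h3 Complex.I_ne_zero
    · exact h3
  have h4 : y ∈ (Lp.toTemperedDistributionCLM K (volume : Measure R3) 2).ker := h2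
  rwa [Lp.ker_toTemperedDistributionCLM_eq_bot, Submodule.mem_bot] at h4

variable {K}

/-- The graph of the decomposable operator `(Tψ)(x) = T(x) ψ(x)`. -/
def fiberGraph (T : R3 → K →ₗ.[ℂ] K) : Submodule ℂ (ParticleSpace K × ParticleSpace K) where
  carrier := {q | ∀ᵐ x, (q.1 x, q.2 x) ∈ (T x).graph}
  add_mem' := by
    intro a b ha hb
    filter_upwards [ha, hb, Lp.coeFn_add a.1 b.1, Lp.coeFn_add a.2 b.2] with x h1 h2 h3 h4
    have h5 := (T x).graph.add_mem h1 h2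
    simp only [Prod.fst_add, Prod.snd_add]
    rw [h3, h4]
    exact h5
  zero_mem' := by
    filter_upwards [Lp.coeFn_zero K 2 (volume : Measure R3)] with x h1
    simp only [Prod.fst_zero, Prod.snd_zero]
    rw [h1]
    exact (T x).graph.zero_mem
  smul_mem' := by
    intro c a ha
    filter_upwards [ha, Lp.coeFn_smul c a.1, Lp.coeFn_smul c a.2] with x h1 h3 h4
    have h5 := (T x).graph.smul_mem c h1
    simp only [Prod.smul_fst, Prod.smul_snd]
    rw [h3, h4]
    exact h5

/-- The decomposable operator `(Tψ)(x) = T(x) ψ(x)` on `L²(ℝ³; K)`, on its maximal domain. -/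
def fiberOp (T : R3 → K →ₗ.[ℂ] K) : ParticleSpace K →ₗ.[ℂ] ParticleSpace K :=
  (fiberGraph T).toLinearPMap

theorem fiberOp_graph (T : R3 → K →ₗ.[ℂ] K) : (fiberOp T).graph = fiberGraph T := by
  refine Submodule.toLinearPMap_graph_eq _ ?_
  rintro ⟨x, y⟩ h hx
  have hx' : x = 0 := hx
  subst hx'
  have h' : ∀ᵐ t, ((0 : ParticleSpace K) t, y t) ∈ (T t).graph := h
  refine Lp.ext ?_
  filter_upwards [h', Lp.coeFn_zero K 2 (volume : Measure R3)] with t h1 h2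
  rw [h2] at h1 ⊢
  exact (T t).graph_fst_eq_zero_snd h1 rfl

/-- Multiplication by a real function of the position `x`, on its maximal domain. -/
def potential (V : R3 → ℝ) : ParticleSpace K →ₗ.[ℂ] ParticleSpace K :=
  fiberOp fun x => ((V x : ℂ) • (LinearMap.id : K →ₗ[ℂ] K)).toPMap ⊤

variable (K)

/-- The kinetic energy `p² / 2`. -/
def kinetic : ParticleSpace K →ₗ.[ℂ] ParticleSpace K :=
  (1 / 2 : ℂ) • ∑ j, opComp (momentum K j) (momentum K j)

/-- The atomic Hamiltonian `p² / 2 - e² Z / (4 π |x|)`. -/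
def atomicHamiltonian (e Z : ℝ) : ParticleSpace K →ₗ.[ℂ] ParticleSpace K :=
  kinetic K + potential fun x => -(e ^ 2 * Z / (4 * Real.pi * ‖x‖))

end Particle

/-! ### Symmetric Fock space over `L²(ℝ³)` -/

theorem measurePreserving_perm {n : ℕ} (σ : Equiv.Perm (Fin n)) :
    MeasurePreserving (fun k : Fin n → R3 => k ∘ σ) volume volume := by
  have h := volume_preserving_arrowCongr' (σ.symm) (MeasurableEquiv.refl R3)
    (MeasurePreserving.id volume)
  exact h

/-- The `n`-boson space: the symmetric functions in `L²((ℝ³)ⁿ)`. -/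
def bosonSector (n : ℕ) : Submodule ℂ (Lp ℂ 2 (volume : Measure (Fin n → R3))) :=
  ⨅ σ : Equiv.Perm (Fin n), LinearMap.eqLocus
    (Lp.compMeasurePreservingₗ ℂ (fun k : Fin n → R3 => k ∘ σ) (measurePreserving_perm σ))
    LinearMap.id

instance bosonSector_complete (n : ℕ) : CompleteSpace (bosonSector n) := by
  have h : IsClosed (bosonSector n : Set (Lp ℂ 2 (volume : Measure (Fin n → R3)))) := by
    simp only [bosonSector, Submodule.coe_iInf]
    refine isClosed_iInter fun σ => ?_
    exact isClosed_eq (Lp.isometry_compMeasurePreserving (measurePreserving_perm σ)).continuous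
      continuous_id
  exact h.completeSpace_coe

/-- The symmetric Fock space `𝓕` over `L²(ℝ³)`: square summable sequences of `n`-boson vectors. -/
abbrev FockSpace : Type := lp (fun n : ℕ => bosonSector n) 2

/-- The `n`-boson wave function of a Fock space vector. -/
def component (Ψ : FockSpace) (n : ℕ) : Lp ℂ 2 (volume : Measure (Fin n → R3)) := (Ψ n : _)

theorem component_add (Ψ Φ : FockSpace) (n : ℕ) :
    component (Ψ + Φ) n = component Ψ n + component Φ n := rfl

theorem component_smul (c : ℂ) (Ψ : FockSpace) (n : ℕ) :
    component (c • Ψ) n = c • component Ψ n := rfl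

theorem component_zero (n : ℕ) : component 0 n = 0 := rfl

theorem component_ext {Ψ Φ : FockSpace} (h : ∀ n, component Ψ n = component Φ n) : Ψ = Φ :=
  lp.ext (funext fun n => Subtype.ext (h n))

theorem quasiMeasurePreserving_removeNth {n : ℕ} (i : Fin (n + 1)) :
    Measure.QuasiMeasurePreserving (fun k : Fin (n + 1) → R3 => i.removeNth k)
      volume volume := by
  have h := (volume_preserving_piFinSuccAbove (fun _ : Fin (n + 1) => R3) i)
  exact Measure.quasiMeasurePreserving_snd.comp h.quasiMeasurePreserving

/-- The graph of the creation operator `a*(f) = ∫ f(k) a*(k) dk`: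
`(a*(f)Ψ)⁽ⁿ⁺¹⁾(k₀, …, kₙ) = (n+1)^{-1/2} ∑ᵢ f(kᵢ) Ψ⁽ⁿ⁾(k₀, …, k̂ᵢ, …, kₙ)`. -/
def creationGraph (f : R3 → ℂ) : Submodule ℂ (FockSpace × FockSpace) where
  carrier := {q | component q.2 0 = 0 ∧ ∀ n : ℕ, ∀ᵐ k : Fin (n + 1) → R3,
    component q.2 (n + 1) k =
      ((Real.sqrt (n + 1))⁻¹ : ℂ) * ∑ i, f (k i) * component q.1 n (i.removeNth k)}
  add_mem' := by
    rintro a b ⟨ha0, ha⟩ ⟨hb0, hb⟩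
    refine ⟨by rw [Prod.snd_add, component_add, ha0, hb0, add_zero], fun n => ?_⟩
    have h : ∀ᵐ k : Fin (n + 1) → R3, ∀ i : Fin (n + 1),
        component (a.1 + b.1) n (i.removeNth k) =
          component a.1 n (i.removeNth k) + component b.1 n (i.removeNth k) :=
      ae_all_iff.mpr fun i => (quasiMeasurePreserving_removeNth i).ae
        (Lp.coeFn_add (component a.1 n) (component b.1 n))
    filter_upwards [ha n, hb n, h,
      Lp.coeFn_add (component a.2 (n + 1)) (component b.2 (n + 1))] with k h1 h2 h3 h4
    simp only [Prod.fst_add, Prod.snd_add, h3, mul_add, Finset.sum_add_distrib]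
    rw [component_add, h4, Pi.add_apply, h1, h2]
  zero_mem' := by
    refine ⟨rfl, fun n => ?_⟩
    have h : ∀ᵐ k : Fin (n + 1) → R3, ∀ i : Fin (n + 1),
        component 0 n (i.removeNth k) = 0 :=
      ae_all_iff.mpr fun i => (quasiMeasurePreserving_removeNth i).ae
        (Lp.coeFn_zero ℂ 2 (volume : Measure (Fin n → R3)))
    filter_upwards [h, Lp.coeFn_zero ℂ 2 (volume : Measure (Fin (n + 1) → R3))] with k h1 h2
    simp only [Prod.fst_zero, Prod.snd_zero, h1, mul_zero, Finset.sum_const_zero]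
    exact h2
  smul_mem' := by
    rintro c a ⟨ha0, ha⟩
    refine ⟨by rw [Prod.smul_snd, component_smul, ha0, smul_zero], fun n => ?_⟩
    have h : ∀ᵐ k : Fin (n + 1) → R3, ∀ i : Fin (n + 1),
        component (c • a.1) n (i.removeNth k) = c * component a.1 n (i.removeNth k) :=
      ae_all_iff.mpr fun i => (quasiMeasurePreserving_removeNth i).ae
        (Lp.coeFn_smul c (component a.1 n))
    filter_upwards [ha n, h, Lp.coeFn_smul c (component a.2 (n + 1))] with k h1 h3 h4
    simp only [Prod.smul_fst, Prod.smul_snd, h3]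
    rw [component_smul, h4, Pi.smul_apply, h1, smul_eq_mul, mul_left_comm, Finset.mul_sum]
    simp only [mul_left_comm c]

/-- The creation operator `a*(f) = ∫ f(k) a*(k) dk`, on its maximal domain. -/
def creation (f : R3 → ℂ) : FockSpace →ₗ.[ℂ] FockSpace := (creationGraph f).toLinearPMap

theorem creation_graph (f : R3 → ℂ) : (creation f).graph = creationGraph f := by
  refine Submodule.toLinearPMap_graph_eq _ ?_
  rintro ⟨x, y⟩ ⟨h0, h⟩ hx
  have hx' : x = 0 := hx
  subst hx'
  refine component_ext fun n => ?_
  cases n with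
  | zero => exact h0
  | succ n =>
    have h' : ∀ᵐ k : Fin (n + 1) → R3, ∀ i : Fin (n + 1),
        component 0 n (i.removeNth k) = 0 :=
      ae_all_iff.mpr fun i => (quasiMeasurePreserving_removeNth i).ae
        (Lp.coeFn_zero ℂ 2 (volume : Measure (Fin n → R3)))
    refine Lp.ext ?_
    filter_upwards [h n, h', Lp.coeFn_zero ℂ 2 (volume : Measure (Fin (n + 1) → R3))]
      with k h1 h2 h3
    rw [component_zero, h3]
    simpa [h2] using h1

/-- The annihilation operator `a(f) = ∫ conj (f(k)) a(k) dk`, the adjoint of `a*(f)`. -/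
def annihilation (f : R3 → ℂ) : FockSpace →ₗ.[ℂ] FockSpace := (creation f)†

/-- The graph of the field energy `H_f = ∫ |k| a*(k) a(k) dk`, that is of multiplication by
`|k₁| + … + |kₙ|` on the `n`-boson wave functions. -/
def fieldEnergyGraph : Submodule ℂ (FockSpace × FockSpace) where
  carrier := {q | ∀ n : ℕ, ∀ᵐ k : Fin n → R3,
    component q.2 n k = ((∑ i, ‖k i‖ : ℝ) : ℂ) * component q.1 n k}
  add_mem' := by
    intro a b ha hb n
    filter_upwards [ha n, hb n, Lp.coeFn_add (component a.1 n) (component b.1 n),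
      Lp.coeFn_add (component a.2 n) (component b.2 n)] with k h1 h2 h3 h4
    rw [Prod.fst_add, Prod.snd_add, component_add, component_add, h3, h4, Pi.add_apply,
      Pi.add_apply, h1, h2, mul_add]
  zero_mem' := by
    intro n
    filter_upwards [Lp.coeFn_zero ℂ 2 (volume : Measure (Fin n → R3))] with k h
    rw [Prod.fst_zero, Prod.snd_zero, component_zero, h, Pi.zero_apply, mul_zero]
  smul_mem' := by
    intro c a ha n
    filter_upwards [ha n, Lp.coeFn_smul c (component a.1 n),
      Lp.coeFn_smul c (component a.2 n)] with k h1 h3 h4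
    rw [Prod.smul_fst, Prod.smul_snd, component_smul, component_smul, h3, h4, Pi.smul_apply,
      Pi.smul_apply, h1, smul_eq_mul, smul_eq_mul, mul_left_comm]

/-- The field energy `H_f` on Fock space, on its maximal domain. -/
def fieldEnergy : FockSpace →ₗ.[ℂ] FockSpace := fieldEnergyGraph.toLinearPMap

theorem fieldEnergy_graph : fieldEnergy.graph = fieldEnergyGraph := by
  refine Submodule.toLinearPMap_graph_eq _ ?_
  rintro ⟨x, y⟩ h hx
  have hx' : x = 0 := hx
  subst hx'
  refine component_ext fun n => Lp.ext ?_
  filter_upwards [h n, Lp.coeFn_zero ℂ 2 (volume : Measure (Fin n → R3))] with k h1 h2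
  rw [component_zero, h2]
  rw [component_zero, h2, Pi.zero_apply, mul_zero] at h1
  exact h1

/-! ### The cutoff Hamiltonian -/

/-- The Hilbert space `𝓗 = L²(ℝ³; 𝓕) = L²(ℝ³) ⊗ 𝓕`. -/
abbrev StateSpace : Type := ParticleSpace FockSpace

/-- The sharp form factor: `(2π)^{-3/2}` for `κ ≤ |k| ≤ Λ`, and `0` otherwise. -/
def formFactor (κ Λ : ℝ) (k : R3) : ℝ :=
  open Classical in if κ ≤ ‖k‖ ∧ ‖k‖ ≤ Λ then (2 * Real.pi) ^ (-(3 / 2) : ℝ) else 0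

/-- The coupling function `k ↦ φ̂(mk) (2|k|)^{-1/2} k_j (|k| + |k|²/2)^{-1} e^{-i k·x}`. -/
def coupling (m κ Λ : ℝ) (j : Fin 3) (x k : R3) : ℂ :=
  ((formFactor κ Λ (m • k) / Real.sqrt (2 * ‖k‖) * k j * (‖k‖ + ‖k‖ ^ 2 / 2)⁻¹ : ℝ) : ℂ)
    * Complex.exp (-(Complex.I * (⟪k, x⟫_ℝ : ℝ)))

/-- The `j`-th component of `A = ∫ φ̂(mk) (2|k|)^{-1/2} k (|k| + |k|²/2)^{-1} e^{i k·x} a(k) dk`. -/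
def opA (m κ Λ : ℝ) (j : Fin 3) : StateSpace →ₗ.[ℂ] StateSpace :=
  fiberOp fun x => annihilation (coupling m κ Λ j x)

/-- The `j`-th component of `A*`. -/
def opAStar (m κ Λ : ℝ) (j : Fin 3) : StateSpace →ₗ.[ℂ] StateSpace :=
  fiberOp fun x => creation (coupling m κ Λ j x)

/-- The interaction `e (p·A + A*·p) + (e²/2) (A² + 2 A*·A + A*²)`. -/
def interaction (m e κ Λ : ℝ) : StateSpace →ₗ.[ℂ] StateSpace :=
  (e : ℂ) • ∑ j, (opComp (momentum FockSpace j) (opA m κ Λ j)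
      + opComp (opAStar m κ Λ j) (momentum FockSpace j))
    + ((e : ℂ) ^ 2 / 2) • ∑ j, (opComp (opA m κ Λ j) (opA m κ Λ j)
      + (2 : ℂ) • opComp (opAStar m κ Λ j) (opA m κ Λ j)
      + opComp (opAStar m κ Λ j) (opAStar m κ Λ j))

/-- The cutoff Hamiltonian `H_{κΛ} = p²/2 - e²Z/(4π|x|) + H_f + e (p·A + A*·p)
+ (e²/2) (A² + 2 A*·A + A*²)`. -/
def hamiltonian (m e Z κ Λ : ℝ) : StateSpace →ₗ.[ℂ] StateSpace :=
  atomicHamiltonian FockSpace e Z + fiberOp (fun _ => fieldEnergy) + interaction m e κ Λ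

/-- The cutoff Hamiltonian without the external potential. -/
def hamiltonianFree (m e κ Λ : ℝ) : StateSpace →ₗ.[ℂ] StateSpace :=
  kinetic FockSpace + fiberOp (fun _ => fieldEnergy) + interaction m e κ Λ

/-- The binding energy `E_{κΛ}^{V=0} - E_{κΛ}`. -/
def bindingEnergy (m e Z κ Λ : ℝ) : ℝ :=
  groundEnergy (hamiltonianFree m e κ Λ) - groundEnergy (hamiltonian m e Z κ Λ)

/-- The ground state energy `E_at` of the atomic Hamiltonian on `L²(ℝ³)`. -/
def atomEnergy (e Z : ℝ) : ℝ := groundEnergy (atomicHamiltonian ℂ e Z)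

/-! ### The bound on the charge -/

/-- The function `C_UV` that determines the bound `e_UV` on the charge. -/
def CUV (Z e : ℝ) : ℝ :=
  2 * e / Real.pi * Real.sqrt (1 + 1 / 2 * (e ^ 2 * Z / (4 * Real.pi)) ^ 2)
    + 1 / (4 * Real.pi ^ 2) * (14 + Real.sqrt 6 * Real.pi) * e ^ 2

theorem existsUnique_CUV (Z : ℝ) : ∃! t : ℝ, 0 < t ∧ CUV Z t = 1 := by
  have hpi := Real.pi_pos
  have hmono : ∀ s t : ℝ, 0 ≤ s → s < t → CUV Z s < CUV Z t := by
    intro s t hs hst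
    unfold CUV
    have h1 : Real.sqrt (1 + 1 / 2 * (s ^ 2 * Z / (4 * Real.pi)) ^ 2)
        ≤ Real.sqrt (1 + 1 / 2 * (t ^ 2 * Z / (4 * Real.pi)) ^ 2) := by
      apply Real.sqrt_le_sqrt
      have h2 : (s ^ 2) ^ 2 ≤ (t ^ 2) ^ 2 := by gcongr
      have h3 : (s ^ 2) ^ 2 * (Z / (4 * Real.pi)) ^ 2 ≤ (t ^ 2) ^ 2 * (Z / (4 * Real.pi)) ^ 2 :=
        mul_le_mul_of_nonneg_right h2 (sq_nonneg _)
      have e1 : ∀ u : ℝ, (u ^ 2 * Z / (4 * Real.pi)) ^ 2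
          = (u ^ 2) ^ 2 * (Z / (4 * Real.pi)) ^ 2 := fun u => by ring
      rw [e1, e1]
      linarith
    have h4 : s ^ 2 < t ^ 2 := by gcongr
    have h5 : 2 * s / Real.pi < 2 * t / Real.pi := by gcongr
    have h6 : 0 < Real.sqrt (1 + 1 / 2 * (t ^ 2 * Z / (4 * Real.pi)) ^ 2) := by positivity
    have h7 : 0 ≤ 2 * s / Real.pi := by positivity
    have h8 : 0 < 1 / (4 * Real.pi ^ 2) * (14 + Real.sqrt 6 * Real.pi) := by positivity
    have h9 := mul_le_mul_of_nonneg_left h1 h7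
    have h10 := mul_lt_mul_of_pos_right h5 h6
    have h11 := mul_lt_mul_of_pos_left h4 h8
    linarith
  have hcont : Continuous (CUV Z) := by
    unfold CUV
    fun_prop
  have h0 : CUV Z 0 = 0 := by simp [CUV]
  have h4 : 1 ≤ CUV Z Real.pi := by
    unfold CUV
    have h1 : (1 : ℝ) ≤ Real.sqrt (1 + 1 / 2 * (Real.pi ^ 2 * Z / (4 * Real.pi)) ^ 2) := by
      rw [Real.one_le_sqrt]
      have := sq_nonneg (Real.pi ^ 2 * Z / (4 * Real.pi))
      linarith
    have h2 : 2 * Real.pi / Real.pi = 2 := by field_simp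
    have h3 : 0 ≤ 1 / (4 * Real.pi ^ 2) * (14 + Real.sqrt 6 * Real.pi) * Real.pi ^ 2 := by
      positivity
    rw [h2]
    linarith
  obtain ⟨t, ht, ht1⟩ := intermediate_value_Icc hpi.le hcont.continuousOn
    (show (1 : ℝ) ∈ Set.Icc (CUV Z 0) (CUV Z Real.pi) from ⟨by rw [h0]; norm_num, h4⟩)
  have htpos : 0 < t := by
    rcases ht.1.lt_or_eq with h | h
    · exact h
    · rw [← h, h0] at ht1
      norm_num at ht1
  refine ⟨t, ⟨htpos, ht1⟩, ?_⟩
  rintro s ⟨hs, hs1⟩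
  rcases lt_trichotomy s t with h | h | h
  · have := hmono s t hs.le h
    linarith
  · exact h
  · have := hmono t s htpos.le h
    linarith

/-- The constant `e_UV`: the unique positive solution of `C_UV(e) = 1`. -/
def chargeUV (Z : ℝ) : ℝ := (existsUnique_CUV Z).choose

end NelsonAtom

end

open NelsonAtom

noncomputable section

set_option linter.unusedSectionVars false

namespace NelsonAtom

/-! ### Graphs of sums, multiples and products -/

section Graphs

variable {E F G : Type*} [AddCommGroup E] [Module ℂ E] [AddCommGroup F] [Module ℂ F]
  [AddCommGroup G] [Module ℂ G]

/-! Let α = e²Z/(4π), so that the potential is -α/|x|, and let E be the ground state energy with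
potential. The binding inequality is proved with trial states. Let f(x) = exp(-α√(|x|²+δ)), a
smoothed hydrogenic ground state. If ψ is in the domain of the Hamiltonian H₀ without potential,
then fψ is admissible for the full Hamiltonian. The localization formula `exists_localization` gives
⟨fψ, H₀fψ⟩ = Re⟨fψ, fH₀ψ⟩ + ½∫|∇f|²|ψ|². The coupling to the field adds nothing, because it enters
through i times a symmetric operator. Since |∇f|² ≤ α²f², this bounds E∫f²|ψ|² by ∫f² Re⟨ψ, H₀ψ⟩ +
(α²/2)∫f²|ψ|² - α∫|x|⁻¹f²|ψ|² (`localized_energy_le`).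

H₀ commutes with translations of particle and field together, so ψ may be replaced by all its
translates. Integration over the translations decouples f from ψ (`integral_average`,
`energy_add_le`). As δ → 0 the quotient ∫|x|⁻¹f² / ∫f² tends to α, hence (E + α²/2)‖ψ‖² ≤ Re⟨ψ,
H₀ψ⟩. Near-minimizers ψ of H₀ then give `le_bindingEnergy`.

The energies are infima of spectra, so they must be shown to be finite and to be variational.
`groundEnergy_variational` does this for a symmetric operator all of whose sufficiently negative
points are regular. Regularity is a Kato-Rellich argument (`isRegularValue_of_relBounded`,
`isRegularValue_of_perturbation`): the resolvent of p²/2 + H_f is a Fourier multiplier whose values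
are functions of H_f, and the perturbation composed with it must have norm below one. The bounds
come from the weighted creation operators (H_f+s)^p a*(f) (H_f+s)^(-1/2-p) of `Adm.norm_cr_le`, with
‖f/√|k|‖ ≤ 1/(√2 π) uniformly in the cutoffs (`wnorm_refAmplitude_le`). As s → ∞ the relative bound
tends to √3|e|/π + 3e²/π², which is below one for |e| < e_UV (`relBound_limit_lt_one`); the charge
bound serves only this purpose. The Coulomb term vanishes in the limit by Hardy's inequality.

The value of E_at is a lower bound obtained by completing a square (`coulomb`) together with an
upper bound from the same functions f (`atomEnergy_le`). -/

theorem mem_graph_add_iff {S T : E →ₗ.[ℂ] F} {q : E × F} :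
    q ∈ (S + T).graph ↔ ∃ a b, (q.1, a) ∈ S.graph ∧ (q.1, b) ∈ T.graph ∧ q.2 = a + b := by
  obtain ⟨x, z⟩ := q
  simp only [LinearPMap.mem_graph_iff]
  constructor
  · rintro ⟨y, rfl, rfl⟩
    exact ⟨S ⟨y, y.2.1⟩, T ⟨y, y.2.2⟩, ⟨⟨y, y.2.1⟩, rfl, rfl⟩, ⟨⟨y, y.2.2⟩, rfl, rfl⟩,
      LinearPMap.add_apply _ _ _⟩
  · rintro ⟨a, b, ⟨u, hu, rfl⟩, ⟨v, hv, rfl⟩, h⟩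
    subst hu
    refine ⟨⟨u, u.2, hv ▸ v.2⟩, rfl, ?_⟩
    rw [h, LinearPMap.add_apply]
    congr 1
    congr 1
    exact Subtype.ext hv.symm

theorem mem_graph_smul_iff {T : E →ₗ.[ℂ] F} {c : ℂ} {q : E × F} :
    q ∈ (c • T).graph ↔ ∃ a, (q.1, a) ∈ T.graph ∧ q.2 = c • a := by
  obtain ⟨x, z⟩ := q
  simp only [LinearPMap.mem_graph_iff]
  constructor
  · rintro ⟨y, rfl, rfl⟩
    exact ⟨T ⟨y, y.2⟩, ⟨⟨y, y.2⟩, rfl, rfl⟩, rfl⟩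
  · rintro ⟨a, ⟨u, hu, rfl⟩, h⟩
    exact ⟨⟨u, u.2⟩, hu, h.symm⟩

theorem mem_graph_sum_iff {T : Fin 3 → E →ₗ.[ℂ] F} {q : E × F} :
    q ∈ (∑ j, T j).graph ↔ ∃ a : Fin 3 → F, (∀ j, (q.1, a j) ∈ (T j).graph) ∧ q.2 = ∑ j, a j := by
  simp only [Fin.sum_univ_three, mem_graph_add_iff]
  constructor
  · rintro ⟨_, c, ⟨a, b, ha, hb, rfl⟩, hc, h⟩
    refine ⟨![a, b, c], fun j => ?_, h⟩
    fin_cases j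
    exacts [ha, hb, hc]
  · rintro ⟨a, ha, h⟩
    exact ⟨_, _, ⟨_, _, ha 0, ha 1, rfl⟩, ha 2, h⟩

theorem mem_graph_opComp_iff {S : F →ₗ.[ℂ] G} {T : E →ₗ.[ℂ] F} {q : E × G} :
    q ∈ (opComp S T).graph ↔ ∃ y, (q.1, y) ∈ T.graph ∧ (y, q.2) ∈ S.graph := by
  rw [opComp_graph]
  rfl

theorem graph_unique {T : E →ₗ.[ℂ] F} {x : E} {y z : F} (hy : (x, y) ∈ T.graph)
    (hz : (x, z) ∈ T.graph) : y = z :=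
  T.mem_graph_snd_inj hy hz rfl

end Graphs

/-! ### Formal adjoints -/

section FormalAdjoint

variable {E F G : Type*} [NormedAddCommGroup E] [InnerProductSpace ℂ E]
  [NormedAddCommGroup F] [InnerProductSpace ℂ F] [NormedAddCommGroup G] [InnerProductSpace ℂ G]

/-- `S` and `T` are formally adjoint to each other, expressed through the graphs. -/
def AdjointPair (T : E →ₗ.[ℂ] F) (S : F →ₗ.[ℂ] E) : Prop :=
  ∀ x y, (x, y) ∈ T.graph → ∀ u v, (u, v) ∈ S.graph → ⟪y, u⟫_ℂ = ⟪x, v⟫_ℂ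

theorem AdjointPair.symm {T : E →ₗ.[ℂ] F} {S : F →ₗ.[ℂ] E} (h : AdjointPair T S) :
    AdjointPair S T := by
  intro x y hxy u v huv
  rw [← inner_conj_symm, ← h u v huv x y hxy, inner_conj_symm]

theorem AdjointPair.add {T T' : E →ₗ.[ℂ] F} {S S' : F →ₗ.[ℂ] E} (h : AdjointPair T S)
    (h' : AdjointPair T' S') : AdjointPair (T + T') (S + S') := by
  intro x y hxy u v huv
  obtain ⟨a, b, ha, hb, e1⟩ := mem_graph_add_iff.mp hxy
  obtain ⟨c, d, hc, hd, e2⟩ := mem_graph_add_iff.mp huv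
  dsimp only at e1 e2
  rw [e1, e2, inner_add_left, inner_add_right, h _ _ ha _ _ hc, h' _ _ hb _ _ hd]

theorem AdjointPair.smul {T : E →ₗ.[ℂ] F} {S : F →ₗ.[ℂ] E} (h : AdjointPair T S) {c : ℂ}
    (hc : (starRingEnd ℂ) c = c) : AdjointPair (c • T) (c • S) := by
  intro x y hxy u v huv
  obtain ⟨a, ha, e1⟩ := mem_graph_smul_iff.mp hxy
  obtain ⟨b, hb, e2⟩ := mem_graph_smul_iff.mp huv
  dsimp only at e1 e2
  rw [e1, e2, inner_smul_left, inner_smul_right, h _ _ ha _ _ hb, hc]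

theorem AdjointPair.sum {T : Fin 3 → E →ₗ.[ℂ] F} {S : Fin 3 → F →ₗ.[ℂ] E}
    (h : ∀ j, AdjointPair (T j) (S j)) : AdjointPair (∑ j, T j) (∑ j, S j) := by
  simp only [Fin.sum_univ_three]
  exact ((h 0).add (h 1)).add (h 2)

theorem AdjointPair.comp {T : E →ₗ.[ℂ] F} {S : F →ₗ.[ℂ] E} {T' : F →ₗ.[ℂ] G} {S' : G →ₗ.[ℂ] F}
    (h : AdjointPair T S) (h' : AdjointPair T' S') :
    AdjointPair (opComp T' T) (opComp S S') := by
  intro x y hxy u v huv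
  obtain ⟨a, ha, ha'⟩ := mem_graph_opComp_iff.mp hxy
  obtain ⟨b, hb, hb'⟩ := mem_graph_opComp_iff.mp huv
  rw [h' _ _ ha' _ _ hb, h _ _ ha _ _ hb']

/-- Taking formal adjoints exchanges the two summands. This is what makes p·A + A*·p and A² + A*²
symmetric, although no single summand is. -/
theorem AdjointPair.swap_add {T T' : E →ₗ.[ℂ] E} (h : AdjointPair T T') :
    AdjointPair (T + T') (T + T') := by
  intro x y hxy u v huv
  obtain ⟨a, b, ha, hb, e1⟩ := mem_graph_add_iff.mp hxy
  obtain ⟨c, d, hc, hd, e2⟩ := mem_graph_add_iff.mp huv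
  dsimp only at e1 e2
  rw [e1, e2, inner_add_left, inner_add_right, h _ _ ha _ _ hd, h.symm _ _ hb _ _ hc, add_comm]

end FormalAdjoint

/-! ### Semibounded symmetric operators -/

section Semibounded

variable {E : Type*} [NormedAddCommGroup E] [InnerProductSpace ℂ E] [CompleteSpace E]

/-- Here (T + s)R = 1 + W with ‖W‖ ≤ q < 1. A Neumann series inverts 1 + W, so R(1 + W)⁻¹ is a right
inverse of T + s. It is also a left inverse because R reaches all of the domain of T. -/
theorem isRegularValue_of_relBounded (T : E →ₗ.[ℂ] E) (R : E →L[ℂ] E) (s q : ℝ) (hq : q < 1)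
    (h : ∀ y, ∃ w, (R y, y - (s : ℂ) • R y + w) ∈ T.graph ∧ ‖w‖ ≤ q * ‖y‖)
    (hsurj : ∀ x ∈ T.domain, ∃ y, R y = x) : IsRegularValue T ((-s : ℝ) : ℂ) := by
  choose w hw hwq using h
  -- The vectors `w y` are merely chosen, but a graph determines its second entry, so the choice is
  -- automatically linear.
  let W : E →ₗ[ℂ] E :=
    { toFun := w
      map_add' := by
        intro a b
        have h1 := T.graph.add_mem (hw a) (hw b)
        have h2 := hw (a + b)
        simp only [map_add, Prod.mk_add_mk] at h1 h2
        have h3 := graph_unique h2 h1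
        rw [smul_add] at h3
        linear_combination (norm := module) h3
      map_smul' := by
        intro c a
        have h1 := T.graph.smul_mem c (hw a)
        have h2 := hw (c • a)
        simp only [map_smul, Prod.smul_mk] at h1 h2
        have h3 := graph_unique h2 h1
        rw [smul_add, smul_sub, smul_comm c (s : ℂ)] at h3
        exact add_left_cancel h3 }
  let Wc : E →L[ℂ] E := W.mkContinuous q hwq
  have hW : ‖-Wc‖ < 1 := by
    rw [norm_neg]
    exact lt_of_le_of_lt (W.mkContinuous_norm_le' _) (max_lt hq one_pos)
  let u := Units.oneSub (-Wc) hW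
  have hu : (u : E →L[ℂ] E) = 1 + Wc := by simp [u]
  have h1 : ∀ y : E, (u⁻¹ : (E →L[ℂ] E)ˣ).1 (y + w y) = y := by
    intro y
    have := congrArg (fun B : E →L[ℂ] E => B y) u.inv_mul
    rw [hu] at this
    exact this
  have h2 : ∀ y : E, (u⁻¹ : (E →L[ℂ] E)ˣ).1 y + w ((u⁻¹ : (E →L[ℂ] E)ˣ).1 y) = y := by
    intro y
    have := congrArg (fun B : E →L[ℂ] E => B y) u.mul_inv
    rw [hu] at this
    exact this
  refine ⟨R ∘L (u⁻¹ : (E →L[ℂ] E)ˣ).1, fun y => ?_, fun x => ?_⟩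
  · have h3 := hw ((u⁻¹ : (E →L[ℂ] E)ˣ).1 y)
    have h4 := h2 y
    set v := (u⁻¹ : (E →L[ℂ] E)ˣ).1 y
    have h5 : y + ((-s : ℝ) : ℂ) • R v = v - (s : ℂ) • R v + w v := by
      push_cast
      linear_combination (norm := module) -h4
    rw [ContinuousLinearMap.comp_apply, h5]
    exact h3
  · obtain ⟨y, hy⟩ := hsurj x x.2
    have h3 := hw y
    rw [hy] at h3
    have h4 := graph_unique (T.mem_graph x) h3
    rw [h4, ← hy]
    simp only [ContinuousLinearMap.comp_apply, Complex.ofReal_neg, neg_smul]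
    have h5 := h1 y
    rw [show y - (s : ℂ) • R y + w y - -((s : ℂ) • R y) = y + w y by abel, h5]

/-- The variational characterisation of the ground state energy of a symmetric operator all of
whose sufficiently negative points are regular. -/
theorem groundEnergy_variational [Nontrivial E] {T : E →ₗ.[ℂ] E} (hT : AdjointPair T T) {s₀ : ℝ}
    (hreg : ∀ s, s₀ < s → IsRegularValue T ((-s : ℝ) : ℂ)) :
    HasFiniteInf T ∧
    (∀ x y, (x, y) ∈ T.graph → groundEnergy T * ‖x‖ ^ 2 ≤ (⟪x, y⟫_ℂ).re) ∧
    ∀ d > 0, ∃ x y, (x, y) ∈ T.graph ∧ x ≠ 0 ∧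
      (⟪x, y⟫_ℂ).re ≤ (groundEnergy T + d) * ‖x‖ ^ 2 := by
  -- The spectral theory of T is read off from the bounded operator R = (T + c)⁻¹, self-adjoint
  -- since T is symmetric; a point r ≠ 0 for R corresponds to r⁻¹ - c for T.
  obtain ⟨c, hc⟩ : ∃ c, s₀ < c := exists_gt s₀
  obtain ⟨R, hR1, hR2⟩ := hreg c hc
  have hR1' : ∀ y, (R y, y - (c : ℂ) • R y) ∈ T.graph := by
    intro y
    have := hR1 y
    rwa [Complex.ofReal_neg, neg_smul, ← sub_eq_add_neg] at this
  have hR2' : ∀ x y, (x, y) ∈ T.graph → R (y + (c : ℂ) • x) = x := by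
    intro x y hxy
    obtain ⟨u, rfl, rfl⟩ := T.mem_graph_iff.mp hxy
    have := hR2 u
    rwa [Complex.ofReal_neg, neg_smul, sub_neg_eq_add] at this
  have hself : IsSelfAdjoint R := by
    rw [ContinuousLinearMap.isSelfAdjoint_iff_isSymmetric]
    intro x y
    have := hT _ _ (hR1' x) _ _ (hR1' y)
    simp only [inner_sub_left, inner_sub_right, inner_smul_left, inner_smul_right,
      Complex.conj_ofReal] at this
    change ⟪R x, y⟫_ℂ = ⟪x, R y⟫_ℂ
    linear_combination -this
  have hR0 : R ≠ 0 := by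
    intro h
    obtain ⟨x, hx⟩ := exists_ne (0 : E)
    have := hR1' x
    rw [h] at this
    simp only [_root_.zero_apply, smul_zero, sub_zero] at this
    exact hx (T.graph_fst_eq_zero_snd this rfl)
  have hN : 0 < ‖R‖ := norm_pos_iff.mpr hR0
  -- regular values of `T` give points outside the spectrum of `R`
  have key : ∀ r : ℝ, r ≠ 0 → IsRegularValue T ((r⁻¹ - c : ℝ) : ℂ) → (r : ℂ) ∉ spectrum ℂ R := by
    intro r hr hreg
    obtain ⟨Q, hQ1, hQ2⟩ := hreg
    have hr' : (r : ℂ) ≠ 0 := by exact_mod_cast hr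
    rw [spectrum.notMem_iff, ContinuousLinearMap.isUnit_iff_bijective]
    have e1 : ∀ y : E, (algebraMap ℂ (E →L[ℂ] E) (r : ℂ) - R) y = (r : ℂ) • y - R y := by
      intro y
      rw [_root_.sub_apply, Algebra.algebraMap_eq_smul_one]
      rfl
    have hQ2' : ∀ x y, (x, y) ∈ T.graph → Q (y - ((r⁻¹ - c : ℝ) : ℂ) • x) = x := by
      intro x y hxy
      obtain ⟨u, rfl, rfl⟩ := T.mem_graph_iff.mp hxy
      exact hQ2 u
    constructor
    · rw [injective_iff_map_eq_zero]
      intro y hy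
      rw [e1, sub_eq_zero] at hy
      have h1 := hQ2' _ _ (hR1' y)
      have h2 : y - (c : ℂ) • R y - ((r⁻¹ - c : ℝ) : ℂ) • R y = 0 := by
        rw [← hy]
        push_cast
        rw [smul_smul, smul_smul, sub_mul, inv_mul_cancel₀ hr']
        module
      rw [h2, map_zero, ← hy] at h1
      exact (smul_eq_zero.mp h1.symm).resolve_left hr'
    · intro z
      refine ⟨(r : ℂ)⁻¹ • (z + (r : ℂ)⁻¹ • Q z), ?_⟩
      have h1 := hR2' _ _ (hQ1 z)
      have h2 : z + ((r⁻¹ - c : ℝ) : ℂ) • Q z + (c : ℂ) • Q z = z + (r : ℂ)⁻¹ • Q z := by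
        push_cast
        module
      rw [h2] at h1
      rw [e1, map_smul, h1, smul_smul, mul_inv_cancel₀ hr', one_smul]
      abel
  -- T - t = (1 - (t + c)R)(T + c), and the first factor is inverted by a Neumann series.
  have key2 : ∀ t : ℝ, |t + c| * ‖R‖ < 1 → IsRegularValue T (t : ℂ) := by
    intro t ht
    have ht' : ‖((t + c : ℝ) : ℂ) • R‖ < 1 := by
      rw [norm_smul, Complex.norm_real]
      exact ht
    let u := Units.oneSub _ ht'
    have hu : (u : E →L[ℂ] E) = 1 - ((t + c : ℝ) : ℂ) • R := by simp [u]
    have h1 : ∀ y : E, (u⁻¹ : (E →L[ℂ] E)ˣ).1 (y - ((t + c : ℝ) : ℂ) • R y) = y := by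
      intro y
      have := congrArg (fun B : E →L[ℂ] E => B y) u.inv_mul
      rw [hu] at this
      exact this
    have h2 : ∀ y : E, (u⁻¹ : (E →L[ℂ] E)ˣ).1 y
        - ((t + c : ℝ) : ℂ) • R ((u⁻¹ : (E →L[ℂ] E)ˣ).1 y) = y := by
      intro y
      have := congrArg (fun B : E →L[ℂ] E => B y) u.mul_inv
      rw [hu] at this
      exact this
    refine ⟨R ∘L (u⁻¹ : (E →L[ℂ] E)ˣ).1, fun y => ?_, fun x => ?_⟩
    · have h4 := h2 y
      push_cast at h4
      have h5 : y + (t : ℂ) • R ((u⁻¹ : (E →L[ℂ] E)ˣ).1 y) = (u⁻¹ : (E →L[ℂ] E)ˣ).1 y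
          - (c : ℂ) • R ((u⁻¹ : (E →L[ℂ] E)ˣ).1 y) := by
        linear_combination (norm := module) -h4
      rw [ContinuousLinearMap.comp_apply, h5]
      exact hR1' _
    · have h3 := hR2' _ _ (T.mem_graph x)
      have h4 := h1 (T x + (c : ℂ) • (x : E))
      rw [h3] at h4
      have h5 : T x + (c : ℂ) • (x : E) - ((t + c : ℝ) : ℂ) • (x : E) = T x - (t : ℂ) • (x : E) := by
        push_cast
        module
      rw [h5] at h4
      rw [ContinuousLinearMap.comp_apply, h4, h3]
  have hneg : ∀ r : ℝ, r < 0 → (r : ℂ) ∉ spectrum ℂ R := by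
    intro r hr
    refine key r hr.ne ?_
    have h1 : r⁻¹ < 0 := inv_lt_zero.mpr hr
    have := hreg (c - r⁻¹) (by linarith)
    rwa [neg_sub] at this
  have hspec : ∀ z ∈ spectrum ℂ R, ∃ r : ℝ, 0 ≤ r ∧ r ≤ ‖R‖ ∧ z = r := by
    intro z hz
    have h1 := hself.mem_spectrum_eq_re hz
    refine ⟨z.re, ?_, ?_, h1⟩
    · by_contra! h
      exact hneg _ h (h1 ▸ hz)
    · exact (Complex.re_le_norm z).trans (spectrum.norm_le_norm_of_mem hz)
  -- For a self-adjoint operator the spectral radius is the norm and is attained; as the spectrum is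
  -- nonnegative, it is attained at ‖R‖ itself and not at -‖R‖.
  have hNmem : ((‖R‖ : ℝ) : ℂ) ∈ spectrum ℂ R := by
    obtain ⟨z, hz, hz2⟩ := spectrum.exists_nnnorm_eq_spectralRadius R
    rw [hself.spectralRadius_eq_nnnorm] at hz2
    have hz3 : ‖z‖ = ‖R‖ := by
      have : ‖z‖₊ = ‖R‖₊ := by exact_mod_cast hz2
      exact congrArg NNReal.toReal this
    obtain ⟨r, hr0, -, rfl⟩ := hspec z hz
    rw [Complex.norm_real, Real.norm_of_nonneg hr0] at hz3
    rwa [← hz3]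
  -- The top ‖R‖ of the spectrum of R corresponds to the bottom of the spectrum of T.
  set E₀ : ℝ := ‖R‖⁻¹ - c with hE₀
  have hmem : E₀ ∈ realSpectrum T := fun h => key ‖R‖ hN.ne' h hNmem
  have hlow : ∀ t ∈ realSpectrum T, E₀ ≤ t := by
    intro t ht
    by_contra! h
    apply ht
    rcases lt_or_ge t (-c) with h1 | h1
    · have := hreg (-t) (by linarith)
      rwa [neg_neg] at this
    · refine key2 t ?_
      rw [abs_of_nonneg (by linarith), ← lt_div_iff₀ hN, one_div]
      linarith
  have hground : groundEnergy T = E₀ :=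
    le_antisymm (csInf_le ⟨E₀, hlow⟩ hmem) (le_csInf ⟨E₀, hmem⟩ hlow)
  -- `R` is nonnegative
  have hpos : ∀ y, ‖R y‖ ^ 2 ≤ ‖R‖ * (⟪R y, y⟫_ℂ).re := by
    intro y
    -- Because the spectrum of R lies in [0, ‖R‖], the centred operator ‖R‖/2 - R has norm at most
    -- ‖R‖/2. Squaring ‖By‖ ≤ (‖R‖/2)‖y‖ gives the claim.
    set B : E →L[ℂ] E := algebraMap ℂ (E →L[ℂ] E) ((‖R‖ / 2 : ℝ) : ℂ) - R with hB
    have hBs : IsSelfAdjoint B := by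
      refine IsSelfAdjoint.sub ?_ hself
      rw [Algebra.algebraMap_eq_smul_one]
      exact IsSelfAdjoint.smul (Complex.conj_ofReal _) (IsSelfAdjoint.one _)
    have hBn : ‖B‖ ≤ ‖R‖ / 2 := by
      obtain ⟨z, hz, hz2⟩ := spectrum.exists_nnnorm_eq_spectralRadius B
      rw [hBs.spectralRadius_eq_nnnorm] at hz2
      have hz3 : ‖z‖ = ‖B‖ := by
        have : ‖z‖₊ = ‖B‖₊ := by exact_mod_cast hz2
        exact congrArg NNReal.toReal this
      rw [← hz3]
      rw [hB, ← spectrum.singleton_sub_eq] at hz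
      obtain ⟨a, ha, b, hb, rfl⟩ := Set.mem_sub.mp hz
      rw [Set.mem_singleton_iff] at ha
      subst ha
      obtain ⟨r, hr0, hr1, rfl⟩ := hspec b hb
      rw [← Complex.ofReal_sub, Complex.norm_real, Real.norm_eq_abs, abs_le]
      constructor <;> linarith
    have h1 : ‖B y‖ ≤ ‖R‖ / 2 * ‖y‖ := B.le_of_opNorm_le hBn y
    have h2 : B y = ((‖R‖ / 2 : ℝ) : ℂ) • y - R y := by
      rw [hB, _root_.sub_apply, Algebra.algebraMap_eq_smul_one]
      rfl
    have h3 : ‖B y‖ ^ 2 ≤ (‖R‖ / 2 * ‖y‖) ^ 2 := by gcongr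
    rw [h2, @norm_sub_sq ℂ, norm_smul, Complex.norm_real, Real.norm_of_nonneg (by positivity),
      inner_smul_left, Complex.conj_ofReal] at h3
    have h4 : RCLike.re (((‖R‖ / 2 : ℝ) : ℂ) * ⟪y, R y⟫_ℂ) = ‖R‖ / 2 * (⟪R y, y⟫_ℂ).re := by
      change (((‖R‖ / 2 : ℝ) : ℂ) * ⟪y, R y⟫_ℂ).re = _
      rw [Complex.re_ofReal_mul, ← inner_conj_symm, Complex.conj_re]
    rw [h4] at h3
    nlinarith
  refine ⟨⟨⟨E₀, hmem⟩, ⟨E₀, hlow⟩⟩, ?_, ?_⟩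
  · intro x y hxy
    have h1 := hR2' x y hxy
    have h2 := hpos (y + (c : ℂ) • x)
    rw [h1, inner_add_right, inner_smul_right, inner_self_eq_norm_sq_to_K] at h2
    have h3 : (⟪x, y⟫_ℂ + (c : ℂ) * ((‖x‖ : ℂ)) ^ 2).re = (⟪x, y⟫_ℂ).re + c * ‖x‖ ^ 2 := by
      rw [Complex.add_re, ← Complex.ofReal_pow, ← Complex.ofReal_mul, Complex.ofReal_re]
    have h2' : ‖x‖ ^ 2 ≤ ‖R‖ * ((⟪x, y⟫_ℂ).re + c * ‖x‖ ^ 2) := by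
      rw [← h3]
      exact h2
    rw [hground, hE₀]
    have h5 : ‖R‖⁻¹ * ‖x‖ ^ 2 ≤ ‖R‖⁻¹ * (‖R‖ * ((⟪x, y⟫_ℂ).re + c * ‖x‖ ^ 2)) := by gcongr
    rw [inv_mul_cancel_left₀ hN.ne'] at h5
    linarith
  · intro d hd
    -- If every quotient exceeded E₀ + d, then (‖R‖⁻¹ + d)‖Ry‖ ≤ ‖y‖ for all y, which would make the
    -- norm of R smaller than ‖R‖.
    by_contra! hcon
    rw [hground, hE₀] at hcon
    have h1 : ‖R‖ ≤ (‖R‖⁻¹ + d)⁻¹ := by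
      refine ContinuousLinearMap.opNorm_le_bound _ (by positivity) fun y => ?_
      by_cases hy : R y = 0
      · rw [hy, norm_zero]
        positivity
      · have h2 := hcon _ _ (hR1' y) hy
        have h3 : (⟪R y, y - (c : ℂ) • R y⟫_ℂ).re = (⟪R y, y⟫_ℂ).re - c * ‖R y‖ ^ 2 := by
          rw [inner_sub_right, inner_smul_right, inner_self_eq_norm_sq_to_K, Complex.sub_re]
          congr 1
          change ((c : ℂ) * ((‖R y‖ : ℂ)) ^ 2).re = _
          rw [← Complex.ofReal_pow, ← Complex.ofReal_mul, Complex.ofReal_re]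
        rw [h3] at h2
        have h4 : (⟪R y, y⟫_ℂ).re ≤ ‖R y‖ * ‖y‖ := re_inner_le_norm (𝕜 := ℂ) (R y) y
        have h5 : 0 < ‖R y‖ := norm_pos_iff.mpr hy
        have h6 : (‖R‖⁻¹ + d) * ‖R y‖ ≤ ‖y‖ := by
          by_contra! h7
          nlinarith
        rw [inv_mul_eq_div, le_div_iff₀ (by positivity), mul_comm]
        exact h6
    have h2 : (‖R‖⁻¹ + d)⁻¹ < ‖R‖ := by
      rw [inv_lt_comm₀ (by positivity) hN]
      linarith
    linarith

end Semibounded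

section Particle

open FourierTransform

variable {K : Type*} [NormedAddCommGroup K] [InnerProductSpace ℂ K] [CompleteSpace K]

/-! ### Bounded decomposable operators -/

/-- Norm continuous and bounded operator families. -/
def BddCont (D : R3 → K →L[ℂ] K) : Prop := Continuous D ∧ ∃ C, ∀ x, ‖D x‖ ≤ C

/-- Norm continuity of the family supplies measurability without any separability assumption on `K`.
-/
theorem BddCont.memLp {D : R3 → K →L[ℂ] K} (h : BddCont D) (ψ : ParticleSpace K) :
    MemLp (fun x => D x (ψ x)) 2 := by
  obtain ⟨C, hC⟩ := h.2
  refine (Lp.memLp ψ).of_le_mul (c := C) ?_ (Filter.Eventually.of_forall fun x => ?_)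
  · exact isBoundedBilinearMap_apply.continuous.comp_aestronglyMeasurable
      (h.1.aestronglyMeasurable.prodMk (Lp.aestronglyMeasurable ψ))
  · exact (D x).le_of_opNorm_le (hC x) _

open Classical in
/-- The operator `(Dψ)(x) = D(x) ψ(x)` for a norm continuous bounded family `D`. -/
def fiberCLM (D : R3 → K →L[ℂ] K) : ParticleSpace K →L[ℂ] ParticleSpace K :=
  if h : BddCont D then
    LinearMap.mkContinuousOfExistsBound
      { toFun := fun ψ => (h.memLp ψ).toLp
        map_add' := by
          intro a b
          refine Lp.ext ?_
          filter_upwards [(h.memLp (a + b)).coeFn_toLp, (h.memLp a).coeFn_toLp,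
            (h.memLp b).coeFn_toLp, Lp.coeFn_add a b,
            Lp.coeFn_add (h.memLp a).toLp (h.memLp b).toLp] with x h1 h2 h3 h4 h5
          rw [h1, h5, Pi.add_apply, h2, h3, h4, Pi.add_apply, map_add]
        map_smul' := by
          intro c a
          refine Lp.ext ?_
          filter_upwards [(h.memLp (c • a)).coeFn_toLp, (h.memLp a).coeFn_toLp,
            Lp.coeFn_smul c a, Lp.coeFn_smul c (h.memLp a).toLp] with x h1 h2 h4 h5
          rw [h1, RingHom.id_apply, h5, Pi.smul_apply, h2, h4, Pi.smul_apply, map_smul] }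
      ⟨h.2.choose, fun ψ => by
        refine Lp.norm_le_mul_norm_of_ae_le_mul ?_
        filter_upwards [(h.memLp ψ).coeFn_toLp] with x h1
        change ‖(h.memLp ψ).toLp _ x‖ ≤ _
        rw [h1]
        exact (D x).le_of_opNorm_le (h.2.choose_spec x) _⟩
  else 0

theorem fiberCLM_ae {D : R3 → K →L[ℂ] K} (h : BddCont D) (ψ : ParticleSpace K) :
    ∀ᵐ x, fiberCLM D ψ x = D x (ψ x) := by
  rw [fiberCLM, dif_pos h]
  exact (h.memLp ψ).coeFn_toLp

theorem norm_fiberCLM_le {D : R3 → K →L[ℂ] K} (h : BddCont D) {C : ℝ} (hC : ∀ x, ‖D x‖ ≤ C)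
    (ψ : ParticleSpace K) : ‖fiberCLM D ψ‖ ≤ C * ‖ψ‖ := by
  refine Lp.norm_le_mul_norm_of_ae_le_mul ?_
  filter_upwards [fiberCLM_ae h ψ] with x h1
  rw [h1]
  exact (D x).le_of_opNorm_le (hC x) _

theorem bddCont_const (B : K →L[ℂ] K) : BddCont fun _ : R3 => B :=
  ⟨continuous_const, ‖B‖, fun _ => le_rfl⟩

theorem BddCont.comp {D D' : R3 → K →L[ℂ] K} (h : BddCont D) (h' : BddCont D') :
    BddCont fun x => D x ∘L D' x := by
  obtain ⟨C, hC⟩ := h.2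
  obtain ⟨C', hC'⟩ := h'.2
  refine ⟨h.1.clm_comp h'.1, C * C', fun x => (ContinuousLinearMap.opNorm_comp_le _ _).trans ?_⟩
  exact mul_le_mul (hC x) (hC' x) (norm_nonneg _) ((norm_nonneg _).trans (hC x))

theorem fiberCLM_comp {D D' : R3 → K →L[ℂ] K} (h : BddCont D) (h' : BddCont D')
    (ψ : ParticleSpace K) :
    fiberCLM D (fiberCLM D' ψ) = fiberCLM (fun x => D x ∘L D' x) ψ := by
  refine Lp.ext ?_
  filter_upwards [fiberCLM_ae h (fiberCLM D' ψ), fiberCLM_ae h' ψ,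
    fiberCLM_ae (h.comp h') ψ] with x h1 h2 h3
  rw [h1, h2, h3, ContinuousLinearMap.comp_apply]

/-- Multiplication by a real function, as a family of operators. -/
def scalarFamily (g : R3 → ℝ) (x : R3) : K →L[ℂ] K := (g x : ℂ) • ContinuousLinearMap.id ℂ K

theorem scalarFamily_apply (g : R3 → ℝ) (x : R3) (u : K) :
    scalarFamily g x u = (g x : ℂ) • u := rfl

theorem norm_scalarFamily_le (g : R3 → ℝ) (x : R3) : ‖(scalarFamily g x : K →L[ℂ] K)‖ ≤ |g x| := by
  refine ContinuousLinearMap.opNorm_le_bound _ (abs_nonneg _) fun u => ?_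
  rw [scalarFamily_apply, norm_smul, Complex.norm_real, Real.norm_eq_abs]

theorem bddCont_scalar {g : R3 → ℝ} (hg : Continuous g) {C : ℝ} (hC : ∀ x, |g x| ≤ C) :
    BddCont (scalarFamily g : R3 → K →L[ℂ] K) := by
  refine ⟨?_, C, fun x => (norm_scalarFamily_le g x).trans (hC x)⟩
  unfold scalarFamily
  fun_prop

/-! ### The momentum operator -/

theorem mem_momentum_iff {j : Fin 3} {ψ φ : ParticleSpace K} :
    (ψ, φ) ∈ (momentum K j).graph ↔ ∀ g : 𝓢(R3, ℂ),
      ∫ x, (∂_{(EuclideanSpace.single j (1 : ℝ) : R3)} g) x • ψ x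
        = -(Complex.I • ∫ x, g x • φ x) := by
  rw [momentum_graph]
  change ∂_{(EuclideanSpace.single j (1 : ℝ) : R3)} (ψ : 𝓢'(R3, K))
    = Complex.I • (φ : 𝓢'(R3, K)) ↔ _
  constructor
  · intro h g
    have h1 := DFunLike.congr_fun h g
    rw [TemperedDistribution.lineDerivOp_apply_apply, map_neg, Lp.toTemperedDistribution_apply]
      at h1
    rw [← neg_eq_iff_eq_neg, h1]
    change Complex.I • (φ : 𝓢'(R3, K)) g = _
    rw [Lp.toTemperedDistribution_apply]
  · intro h
    ext g
    rw [TemperedDistribution.lineDerivOp_apply_apply, map_neg, Lp.toTemperedDistribution_apply,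
      h g, neg_neg]
    change _ = Complex.I • (φ : 𝓢'(R3, K)) g
    rw [Lp.toTemperedDistribution_apply]

theorem toTemperedDistribution_inj {ψ φ : ParticleSpace K}
    (h : (ψ : 𝓢'(R3, K)) = (φ : 𝓢'(R3, K))) : ψ = φ := by
  have h4 : ψ - φ ∈ (Lp.toTemperedDistributionCLM K (volume : Measure R3) 2).ker := by
    simp only [LinearMap.mem_ker, map_sub]
    exact sub_eq_zero.mpr h
  rwa [Lp.ker_toTemperedDistributionCLM_eq_bot, Submodule.mem_bot, sub_eq_zero] at h4

theorem locallyIntegrable_smul_of_continuous {c : R3 → ℂ} {f : R3 → K} (hc : Continuous c)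
    (hf : LocallyIntegrable f) : LocallyIntegrable fun x => c x • f x :=
  hf.continuous_smul hc

theorem locallyIntegrable_particle (χ : ParticleSpace K) : LocallyIntegrable χ :=
  (Lp.memLp χ).locallyIntegrable (by norm_num)

/-- Compactly supported smooth functions are Schwartz functions, and they already separate locally
integrable functions. -/
theorem ae_eq_of_forall_schwartz {f f' : R3 → K} (hf : LocallyIntegrable f)
    (hf' : LocallyIntegrable f') (h : ∀ g : 𝓢(R3, ℂ), ∫ x, g x • f x = ∫ x, g x • f' x) :
    ∀ᵐ x, f x = f' x := by
  refine ae_eq_of_integral_contDiff_smul_eq hf hf' fun g hg hgc => ?_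
  have hg' : ContDiff ℝ (⊤ : ℕ∞) fun x => (g x : ℂ) := Complex.ofRealCLM.contDiff.comp hg
  have hgc' : HasCompactSupport fun x => (g x : ℂ) :=
    hgc.comp_left (g := Complex.ofReal) Complex.ofReal_zero
  have h1 := h (hgc'.toSchwartzMap hg')
  have h2 : ∀ x, hgc'.toSchwartzMap hg' x = (g x : ℂ) := fun x => rfl
  have h3 : ∀ f : R3 → K, ∫ x, g x • f x = ∫ x, hgc'.toSchwartzMap hg' x • f x := fun f =>
    integral_congr_ae (Filter.Eventually.of_forall fun x => by
      dsimp only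
      rw [h2, Complex.coe_smul])
  rw [h3, h3, h1]

/-- The Fourier transform with phase 2πx·ξ turns ∂_j into 2πiξ_j, hence the factor 2π. The product
with ξ_j need not be square integrable, so the equality of distributions is first tested on Schwartz
functions and then made pointwise. -/
theorem mem_momentum_iff_fourier {j : Fin 3} {ψ φ : ParticleSpace K} :
    (ψ, φ) ∈ (momentum K j).graph ↔
      ∀ᵐ ξ, (𝓕 φ) ξ = ((2 * Real.pi * ξ j : ℝ) : ℂ) • (𝓕 ψ) ξ := by
  have hin : ∀ ξ : R3, ⟪ξ, (EuclideanSpace.single j (1 : ℝ) : R3)⟫_ℝ = ξ j := by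
    intro ξ
    simp [EuclideanSpace.inner_single_right]
  have htg : Function.HasTemperateGrowth
      (fun ξ : R3 => ((⟪ξ, (EuclideanSpace.single j (1 : ℝ) : R3)⟫_ℝ : ℝ) : ℂ)) := by
    fun_prop
  have hcont : Continuous fun ξ : R3 => ((2 * Real.pi * ξ j : ℝ) : ℂ) := by fun_prop
  have step1 : (ψ, φ) ∈ (momentum K j).graph ↔ ∀ g : 𝓢(R3, ℂ),
      ∫ ξ, g ξ • ((2 * Real.pi * ξ j : ℝ) : ℂ) • (𝓕 ψ) ξ = ∫ ξ, g ξ • (𝓕 φ) ξ := by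
    rw [momentum_graph]
    change ∂_{(EuclideanSpace.single j (1 : ℝ) : R3)} (ψ : 𝓢'(R3, K))
      = Complex.I • (φ : 𝓢'(R3, K)) ↔ _
    have e1 : ∂_{(EuclideanSpace.single j (1 : ℝ) : R3)} (ψ : 𝓢'(R3, K))
        = Complex.I • (φ : 𝓢'(R3, K)) ↔
        𝓕 (∂_{(EuclideanSpace.single j (1 : ℝ) : R3)} (ψ : 𝓢'(R3, K)))
        = 𝓕 (Complex.I • (φ : 𝓢'(R3, K))) := by
      refine ⟨fun h => by rw [h], fun h => ?_⟩
      have := congrArg (fun T : 𝓢'(R3, K) => 𝓕⁻ T) h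
      simpa only [fourierInv_fourier_eq] using this
    rw [e1, TemperedDistribution.fourier_lineDerivOp_eq, FourierTransform.fourier_smul,
      Lp.fourier_toTemperedDistribution_eq, Lp.fourier_toTemperedDistribution_eq]
    have e2 : ∀ g : 𝓢(R3, ℂ), ((2 * (Real.pi : ℂ) * Complex.I) •
        (TemperedDistribution.smulLeftCLM K fun x : R3 =>
          ((⟪x, (EuclideanSpace.single j (1 : ℝ) : R3)⟫_ℝ : ℝ) : ℂ))
          ((𝓕 ψ : ParticleSpace K) : 𝓢'(R3, K))) g
        = Complex.I • ∫ ξ, g ξ • ((2 * Real.pi * ξ j : ℝ) : ℂ) • (𝓕 ψ) ξ := by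
      intro g
      change (2 * (Real.pi : ℂ) * Complex.I) • ((TemperedDistribution.smulLeftCLM K fun x : R3 =>
          ((⟪x, (EuclideanSpace.single j (1 : ℝ) : R3)⟫_ℝ : ℝ) : ℂ))
          ((𝓕 ψ : ParticleSpace K) : 𝓢'(R3, K))) g = _
      rw [TemperedDistribution.smulLeftCLM_apply_apply, Lp.toTemperedDistribution_apply,
        mul_comm, mul_smul, ← integral_smul]
      congr 1
      refine integral_congr_ae (Filter.Eventually.of_forall fun ξ => ?_)
      dsimp only
      rw [SchwartzMap.smulLeftCLM_apply_apply htg, hin, smul_smul, smul_smul]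
      congr 1
      simp only [smul_eq_mul]
      push_cast
      ring
    constructor
    · intro h g
      have h1 := DFunLike.congr_fun h g
      rw [e2 g] at h1
      have h2 : (Complex.I • ((𝓕 φ : ParticleSpace K) : 𝓢'(R3, K))) g
        = Complex.I • ∫ ξ, g ξ • (𝓕 φ) ξ := by
        rw [← Lp.toTemperedDistribution_apply]
        rfl
      rw [h2] at h1
      exact smul_right_injective K Complex.I_ne_zero h1
    · intro h
      ext g
      rw [e2 g, h g, ← Lp.toTemperedDistribution_apply]
      rfl
  rw [step1]
  constructor
  · intro h
    exact (ae_eq_of_forall_schwartz (locallyIntegrable_smul_of_continuous hcont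
      (locallyIntegrable_particle (𝓕 ψ))) (locallyIntegrable_particle (𝓕 φ)) h).mono
      fun ξ hξ => hξ.symm
  · intro h g
    refine integral_congr_ae ?_
    filter_upwards [h] with ξ hξ
    rw [hξ]

/-- By Plancherel the momentum is multiplication by a real function. -/
theorem momentum_symm (j : Fin 3) : AdjointPair (momentum K j) (momentum K j) := by
  intro x y hxy u v huv
  rw [mem_momentum_iff_fourier] at hxy huv
  rw [← Lp.inner_fourier_eq, ← Lp.inner_fourier_eq x v, L2.inner_def, L2.inner_def]
  refine integral_congr_ae ?_
  filter_upwards [hxy, huv] with ξ h1 h2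
  rw [h1, h2, inner_smul_left, inner_smul_right, Complex.conj_ofReal]

/-- The Fourier transform commutes with constant operators. -/
theorem fourier_fiberCLM_const (B : K →L[ℂ] K) (ψ : ParticleSpace K) :
    𝓕 (fiberCLM (fun _ => B) ψ) = fiberCLM (fun _ => B) (𝓕 ψ) := by
  have key : ∀ (χ : ParticleSpace K) (g : 𝓢(R3, ℂ)),
      (fiberCLM (fun _ => B) χ : 𝓢'(R3, K)) g = B ((χ : 𝓢'(R3, K)) g) := by
    intro χ g
    rw [Lp.toTemperedDistribution_apply, Lp.toTemperedDistribution_apply]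
    rw [← ContinuousLinearMap.integral_comp_comm]
    · refine integral_congr_ae ?_
      filter_upwards [fiberCLM_ae (bddCont_const B) χ] with x hx
      rw [hx, map_smul]
    · exact memLp_one_iff_integrable.mp ((Lp.memLp χ).smul (g.memLp 2))
  apply toTemperedDistribution_inj
  rw [← Lp.fourier_toTemperedDistribution_eq]
  ext g
  rw [TemperedDistribution.fourier_apply, key, key, ← Lp.fourier_toTemperedDistribution_eq,
    TemperedDistribution.fourier_apply]

end Particle

/-! ### Classical derivatives, the product rule for the momentum, translations and multiplication
operators. -/

section Calculus

open FourierTransform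

variable {K : Type*} [NormedAddCommGroup K] [InnerProductSpace ℂ K] [CompleteSpace K]

/-- The `j`-th basis vector of `ℝ³`. -/
abbrev basisVec (j : Fin 3) : R3 := EuclideanSpace.single j (1 : ℝ)

theorem integrable_schwartz_smul (g : 𝓢(R3, ℂ)) {f : R3 → K} (hf : MemLp f 2 volume) :
    Integrable fun x => g x • f x :=
  memLp_one_iff_integrable.mp (hf.smul (g.memLp 2))

theorem schwartz_hasLineDerivAt (g : 𝓢(R3, ℂ)) (v x : R3) :
    HasLineDerivAt ℝ g ((∂_{v} g) x) x v := by
  rw [SchwartzMap.lineDerivOp_apply]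
  exact g.differentiableAt.lineDifferentiableAt.hasLineDerivAt

/-- Classically differentiable square integrable functions are in the domain of the momentum. -/
theorem mem_momentum_of_hasLineDerivAt {j : Fin 3} {η η' : R3 → K} (h : MemLp η 2 volume)
    (h' : MemLp η' 2 volume) (hd : ∀ x, HasLineDerivAt ℝ η (η' x) x (basisVec j)) :
    (h.toLp η, (-Complex.I) • h'.toLp η') ∈ (momentum K j).graph := by
  rw [mem_momentum_iff]
  intro g
  have e1 : ∫ x, (∂_{basisVec j} g) x • (h.toLp η : ParticleSpace K) x = ∫ x, (∂_{basisVec j} g) x • η x := by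
    refine integral_congr_ae ?_
    filter_upwards [h.coeFn_toLp] with x hx
    rw [hx]
  have e2 : ∫ x, g x • ((-Complex.I) • h'.toLp η' : ParticleSpace K) x
      = (-Complex.I) • ∫ x, g x • η' x := by
    rw [← integral_smul]
    refine integral_congr_ae ?_
    filter_upwards [h'.coeFn_toLp, Lp.coeFn_smul (-Complex.I) (h'.toLp η')] with x hx hx2
    rw [hx2, Pi.smul_apply, hx, smul_comm]
  rw [e1, e2, smul_smul]
  have h3 := integral_bilinear_hasLineDerivAt_right_eq_neg_left_of_integrable
    (μ := (volume : Measure R3)) (f := g) (f' := fun x => (∂_{basisVec j} g) x) (g := η) (g' := η')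
    (v := basisVec j) (B := ContinuousLinearMap.lsmul ℝ ℂ)
    (integrable_schwartz_smul _ h) (integrable_schwartz_smul _ h') (integrable_schwartz_smul _ h)
    (fun x _ => schwartz_hasLineDerivAt g _ x) (fun x _ => hd x)
  simp only [ContinuousLinearMap.lsmul_apply] at h3
  rw [mul_neg, Complex.I_mul_I, neg_neg, one_smul, h3, neg_neg]

theorem hasLineDerivAt_adjoint_apply {D : R3 → K →L[ℂ] K} {D' : K →L[ℂ] K} {x v : R3}
    (h : HasLineDerivAt ℝ D D' x v) (u : K) :
    HasLineDerivAt ℝ (fun y => (ContinuousLinearMap.adjoint (D y)) u)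
      ((ContinuousLinearMap.adjoint D') u) x v := by
  have h1 : HasDerivAt (fun t : ℝ => star (D (x + t • v))) (star D') 0 := HasDerivAt.star h
  have h2 : HasFDerivAt (fun B : K →L[ℂ] K => B u)
      ((ContinuousLinearMap.apply ℂ K u).restrictScalars ℝ) (star (D (x + (0 : ℝ) • v))) :=
    ((ContinuousLinearMap.apply ℂ K u).restrictScalars ℝ).hasFDerivAt
  exact h2.comp_hasDerivAt (0 : ℝ) h1

/-- The product rule for the momentum operator. -/
theorem momentum_leibniz {j : Fin 3} {D D' : R3 → K →L[ℂ] K} (hD : BddCont D) (hD' : BddCont D')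
    (hd : ∀ x, HasLineDerivAt ℝ D (D' x) x (basisVec j)) {ψ φ : ParticleSpace K}
    (h : (ψ, φ) ∈ (momentum K j).graph) :
    (fiberCLM D ψ, fiberCLM D φ - Complex.I • fiberCLM D' ψ) ∈ (momentum K j).graph := by
  rw [mem_momentum_iff]
  intro g
  -- After pairing with a vector u, the family D can be moved to the test side. There x ↦ conj(g(x))
  -- D(x)*u is classically differentiable, hence in the domain of the momentum, and symmetry of the
  -- momentum replaces a product rule for distributions.
  refine ext_inner_left ℂ fun u => ?_
  obtain ⟨C, hC⟩ := hD.2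
  obtain ⟨C', hC'⟩ := hD'.2
  have memA : ∀ (g : 𝓢(R3, ℂ)) {B : R3 → K →L[ℂ] K} (_ : BddCont B),
      MemLp (fun x => (starRingEnd ℂ) (g x) • (ContinuousLinearMap.adjoint (B x)) u) 2 := by
    intro g B hB
    obtain ⟨c, hc⟩ := hB.2
    refine (g.memLp 2).of_le_mul (c := c * ‖u‖) ?_ (Filter.Eventually.of_forall fun x => ?_)
    · have hcont : Continuous fun x => (ContinuousLinearMap.adjoint (B x)) u :=
        (ContinuousLinearMap.adjoint.continuous.comp hB.1).clm_apply continuous_const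
      have hg : Continuous fun x => (starRingEnd ℂ) (g x) :=
        Complex.continuous_conj.comp g.continuous
      exact (hg.smul hcont).aestronglyMeasurable
    · rw [norm_smul, RCLike.norm_conj, mul_comm]
      gcongr
      refine ((ContinuousLinearMap.adjoint (B x)).le_opNorm u).trans ?_
      rw [LinearIsometryEquiv.norm_map]
      gcongr
      exact hc x
  have m1 := memA g hD
  have m2 := (memA (∂_{basisVec j} g) hD).add (memA g hD')
  have hη : ∀ x, HasLineDerivAt ℝ
      (fun x => (starRingEnd ℂ) (g x) • (ContinuousLinearMap.adjoint (D x)) u)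
      (((fun x => (starRingEnd ℂ) ((∂_{basisVec j} g) x) • (ContinuousLinearMap.adjoint (D x)) u) +
        fun x => (starRingEnd ℂ) (g x) • (ContinuousLinearMap.adjoint (D' x)) u) x) x
        (basisVec j) := by
    intro x
    have a1 : HasDerivAt (fun t : ℝ => (starRingEnd ℂ) (g (x + t • basisVec j)))
        ((starRingEnd ℂ) ((∂_{basisVec j} g) x)) 0 :=
      HasDerivAt.star (schwartz_hasLineDerivAt g (basisVec j) x)
    have a2 : HasDerivAt (fun t : ℝ => (ContinuousLinearMap.adjoint (D (x + t • basisVec j))) u)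
        ((ContinuousLinearMap.adjoint (D' x)) u) 0 := hasLineDerivAt_adjoint_apply (hd x) u
    have a3 := a1.smul a2
    simp only [zero_smul, add_zero] at a3
    unfold HasLineDerivAt
    rw [Pi.add_apply, add_comm]
    exact a3
  have key := momentum_symm (K := K) j _ _ (mem_momentum_of_hasLineDerivAt m1 m2 hη) _ _ h
  rw [L2.inner_def, L2.inner_def] at key
  have i1 := integrable_schwartz_smul (∂_{basisVec j} g) (Lp.memLp (fiberCLM D ψ))
  have i2 := integrable_schwartz_smul g (Lp.memLp (fiberCLM D φ))
  have i3 := integrable_schwartz_smul g (Lp.memLp (fiberCLM D' ψ))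
  have k1 : ∫ x, ⟪((-Complex.I) • m2.toLp _ : ParticleSpace K) x, ψ x⟫_ℂ
      = Complex.I * (∫ x, ⟪u, (∂_{basisVec j} g) x • fiberCLM D ψ x⟫_ℂ)
        + Complex.I * ∫ x, ⟪u, g x • fiberCLM D' ψ x⟫_ℂ := by
    rw [← mul_add, ← integral_add (i1.const_inner u) (i3.const_inner u), ← integral_const_mul]
    refine integral_congr_ae ?_
    filter_upwards [m2.coeFn_toLp, Lp.coeFn_smul (-Complex.I) (m2.toLp _), fiberCLM_ae hD ψ,
      fiberCLM_ae hD' ψ] with x h1 h2 h3 h4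
    rw [h2, Pi.smul_apply, h1, h3, h4, Pi.add_apply]
    simp only [inner_smul_left, inner_add_left, inner_smul_right,
      ContinuousLinearMap.adjoint_inner_left, map_neg, Complex.conj_I, neg_neg, Complex.conj_conj]
  have k2 : ∫ x, ⟪(m1.toLp _ : ParticleSpace K) x, φ x⟫_ℂ = ∫ x, ⟪u, g x • fiberCLM D φ x⟫_ℂ := by
    refine integral_congr_ae ?_
    filter_upwards [m1.coeFn_toLp, fiberCLM_ae hD φ] with x h1 h2
    rw [h1, h2]
    simp only [inner_smul_left, inner_smul_right,
      ContinuousLinearMap.adjoint_inner_left, Complex.conj_conj]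
  rw [k1, k2, integral_inner i1, integral_inner i2, integral_inner i3] at key
  have k3 : ∫ x, g x • (fiberCLM D φ - Complex.I • fiberCLM D' ψ : ParticleSpace K) x
      = (∫ x, g x • fiberCLM D φ x) - Complex.I • ∫ x, g x • fiberCLM D' ψ x := by
    have i4 : Integrable fun x => Complex.I • g x • fiberCLM D' ψ x := i3.smul Complex.I
    rw [← integral_smul, ← integral_sub i2 i4]
    refine integral_congr_ae ?_
    filter_upwards [Lp.coeFn_sub (fiberCLM D φ) (Complex.I • fiberCLM D' ψ),
      Lp.coeFn_smul Complex.I (fiberCLM D' ψ)] with x h1 h2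
    rw [h1, Pi.sub_apply, h2, Pi.smul_apply, smul_sub, smul_comm Complex.I]
  rw [k3, smul_sub, smul_smul, Complex.I_mul_I, inner_neg_right, inner_sub_right, inner_smul_right,
    inner_smul_right]
  linear_combination (-Complex.I) * key + (⟪u, ∫ x, (∂_{basisVec j} g) x • fiberCLM D ψ x⟫_ℂ +
    ⟪u, ∫ x, g x • fiberCLM D' ψ x⟫_ℂ) * Complex.I_sq

/-! ### Translations -/

/-- Translation of the particle by `y`. -/
def translate (y : R3) (ψ : ParticleSpace K) : ParticleSpace K :=
  Lp.compMeasurePreserving (fun x => x - y) (measurePreserving_sub_right volume y) ψ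

theorem translate_ae (y : R3) (ψ : ParticleSpace K) :
    ∀ᵐ x, translate y ψ x = ψ (x - y) :=
  Lp.coeFn_compMeasurePreserving ψ (measurePreserving_sub_right volume y)

theorem ae_sub {P : R3 → Prop} (h : ∀ᵐ x, P x) (y : R3) : ∀ᵐ x, P (x - y) :=
  (measurePreserving_sub_right volume y).quasiMeasurePreserving.ae h

theorem momentum_translate {j : Fin 3} {ψ φ : ParticleSpace K}
    (h : (ψ, φ) ∈ (momentum K j).graph) (y : R3) :
    (translate y ψ, translate y φ) ∈ (momentum K j).graph := by
  rw [mem_momentum_iff] at h ⊢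
  intro g
  have h1 := h (SchwartzMap.compSubConstCLM ℂ (-y) g)
  have e : ∀ (g : 𝓢(R3, ℂ)) (χ : ParticleSpace K),
      ∫ x, g x • translate y χ x = ∫ x, g (x + y) • χ x := by
    intro g χ
    rw [← integral_sub_right_eq_self (μ := (volume : Measure R3)) (fun x => g (x + y) • χ x) y]
    refine integral_congr_ae ?_
    filter_upwards [translate_ae y χ] with x hx
    rw [hx, sub_add_cancel]
  rw [e, e]
  have e2 : ∀ x, (∂_{basisVec j} (SchwartzMap.compSubConstCLM ℂ (-y) g)) x
      = (∂_{basisVec j} g) (x + y) := by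
    intro x
    rw [SchwartzMap.lineDerivOp_apply, SchwartzMap.lineDerivOp_apply]
    simp only [lineDeriv, SchwartzMap.compSubConstCLM_apply, sub_neg_eq_add]
    congr 1
    ext t
    congr 1
    abel
  simp only [e2, SchwartzMap.compSubConstCLM_apply, sub_neg_eq_add] at h1
  exact h1

/-! ### Multiplication by real functions -/

/-- Multiplication by a real function. -/
abbrev mulCLM (g : R3 → ℝ) : ParticleSpace K →L[ℂ] ParticleSpace K := fiberCLM (scalarFamily g)

/-- Continuous and bounded real functions. -/
def BddFun (g : R3 → ℝ) : Prop := Continuous g ∧ ∃ C, ∀ x, |g x| ≤ C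

theorem BddFun.bddCont {g : R3 → ℝ} (h : BddFun g) :
    BddCont (scalarFamily g : R3 → K →L[ℂ] K) :=
  bddCont_scalar h.1 h.2.choose_spec

theorem BddFun.mul {f g : R3 → ℝ} (hf : BddFun f) (hg : BddFun g) :
    BddFun fun x => f x * g x := by
  obtain ⟨C, hC⟩ := hf.2
  obtain ⟨C', hC'⟩ := hg.2
  refine ⟨hf.1.mul hg.1, C * C', fun x => ?_⟩
  rw [abs_mul]
  exact mul_le_mul (hC x) (hC' x) (abs_nonneg _) ((abs_nonneg _).trans (hC x))

theorem BddFun.add {f g : R3 → ℝ} (hf : BddFun f) (hg : BddFun g) :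
    BddFun fun x => f x + g x := by
  obtain ⟨C, hC⟩ := hf.2
  obtain ⟨C', hC'⟩ := hg.2
  exact ⟨hf.1.add hg.1, C + C', fun x => (abs_add_le _ _).trans (add_le_add (hC x) (hC' x))⟩

theorem mulCLM_ae {g : R3 → ℝ} (h : BddFun g) (ψ : ParticleSpace K) :
    ∀ᵐ x, mulCLM g ψ x = (g x : ℂ) • ψ x :=
  fiberCLM_ae h.bddCont ψ

theorem mulCLM_mul {f g : R3 → ℝ} (hf : BddFun f) (hg : BddFun g) (ψ : ParticleSpace K) :
    mulCLM f (mulCLM g ψ) = mulCLM (fun x => f x * g x) ψ := by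
  refine Lp.ext ?_
  filter_upwards [mulCLM_ae hf (mulCLM g ψ), mulCLM_ae hg ψ, mulCLM_ae (hf.mul hg) ψ]
    with x h1 h2 h3
  rw [h1, h2, h3, smul_smul, Complex.ofReal_mul]

theorem inner_mulCLM_left {g : R3 → ℝ} (h : BddFun g) (ψ φ : ParticleSpace K) :
    ⟪mulCLM g ψ, φ⟫_ℂ = ∫ x, (g x : ℂ) * ⟪ψ x, φ x⟫_ℂ := by
  rw [L2.inner_def]
  refine integral_congr_ae ?_
  filter_upwards [mulCLM_ae h ψ] with x h1
  rw [h1, inner_smul_left, Complex.conj_ofReal]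

theorem inner_mulCLM_comm {g : R3 → ℝ} (h : BddFun g) (ψ φ : ParticleSpace K) :
    ⟪mulCLM g ψ, φ⟫_ℂ = ⟪ψ, mulCLM g φ⟫_ℂ := by
  rw [L2.inner_def, L2.inner_def]
  refine integral_congr_ae ?_
  filter_upwards [mulCLM_ae h ψ, mulCLM_ae h φ] with x h1 h2
  rw [h1, h2, inner_smul_left, inner_smul_right, Complex.conj_ofReal]

theorem inner_mulCLM_self {g : R3 → ℝ} (h : BddFun g) (ψ : ParticleSpace K) :
    ⟪mulCLM g ψ, ψ⟫_ℂ = ((∫ x, g x * ‖ψ x‖ ^ 2 : ℝ) : ℂ) := by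
  rw [inner_mulCLM_left h, ← integral_complex_ofReal]
  refine integral_congr_ae (Filter.Eventually.of_forall fun x => ?_)
  dsimp only
  rw [inner_self_eq_norm_sq_to_K]
  push_cast
  rfl

theorem norm_mulCLM_sq {g : R3 → ℝ} (h : BddFun g) (ψ : ParticleSpace K) :
    ‖mulCLM g ψ‖ ^ 2 = ∫ x, g x ^ 2 * ‖ψ x‖ ^ 2 := by
  have h1 := inner_mulCLM_self (h.mul h) ψ
  rw [← mulCLM_mul h h, inner_mulCLM_comm h, inner_self_eq_norm_sq_to_K] at h1
  simp only [← pow_two] at h1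
  exact Complex.ofReal_injective (by rw [Complex.ofReal_pow]; exact h1)

theorem norm_sq_eq_integral (ψ : ParticleSpace K) : ‖ψ‖ ^ 2 = ∫ x, ‖ψ x‖ ^ 2 := by
  have h1 : ⟪ψ, ψ⟫_ℂ = ((∫ x, ‖ψ x‖ ^ 2 : ℝ) : ℂ) := by
    rw [L2.inner_def, ← integral_complex_ofReal]
    refine integral_congr_ae (Filter.Eventually.of_forall fun x => ?_)
    dsimp only
    rw [inner_self_eq_norm_sq_to_K]
    push_cast
    rfl
  rw [inner_self_eq_norm_sq_to_K] at h1
  exact Complex.ofReal_injective (by rw [Complex.ofReal_pow]; exact h1)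

theorem integrable_norm_sq (ψ : ParticleSpace K) : Integrable fun x => ‖ψ x‖ ^ 2 :=
  (Lp.memLp ψ).integrable_norm_pow (by norm_num)

theorem integrable_mul_norm_sq {g : R3 → ℝ} (h : BddFun g) (ψ : ParticleSpace K) :
    Integrable fun x => g x * ‖ψ x‖ ^ 2 := by
  obtain ⟨C, hC⟩ := h.2
  exact (integrable_norm_sq ψ).bdd_mul h.1.aestronglyMeasurable (Filter.Eventually.of_forall hC)

theorem hasLineDerivAt_scalarFamily {g : R3 → ℝ} {g' : ℝ} {x v : R3}
    (h : HasLineDerivAt ℝ g g' x v) :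
    HasLineDerivAt ℝ (scalarFamily g : R3 → K →L[ℂ] K)
      ((g' : ℂ) • ContinuousLinearMap.id ℂ K) x v := by
  have h1 : HasDerivAt (fun t : ℝ => ((g (x + t • v) : ℝ) : ℂ)) (g' : ℂ) 0 :=
    HasDerivAt.ofReal_comp h
  exact h1.smul_const (ContinuousLinearMap.id ℂ K)

theorem momentum_mul {j : Fin 3} {g g' : R3 → ℝ} (hg : BddFun g) (hg' : BddFun g')
    (hd : ∀ x, HasLineDerivAt ℝ g (g' x) x (basisVec j)) {ψ φ : ParticleSpace K}
    (h : (ψ, φ) ∈ (momentum K j).graph) :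
    (mulCLM g ψ, mulCLM g φ - Complex.I • mulCLM g' ψ) ∈ (momentum K j).graph :=
  momentum_leibniz hg.bddCont hg'.bddCont (fun x => hasLineDerivAt_scalarFamily (hd x)) h

/-- Expand ‖(p_j - ig)ψ‖² ≥ 0; the cross terms form the commutator i[p_j, g] = g'. -/
theorem integral_deriv_mul_le {j : Fin 3} {g g' : R3 → ℝ} (hg : BddFun g) (hg' : BddFun g')
    (hd : ∀ x, HasLineDerivAt ℝ g (g' x) x (basisVec j)) {ψ φ : ParticleSpace K}
    (h : (ψ, φ) ∈ (momentum K j).graph) :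
    ∫ x, g' x * ‖ψ x‖ ^ 2 ≤ ‖φ‖ ^ 2 + ∫ x, g x ^ 2 * ‖ψ x‖ ^ 2 := by
  have h1 := momentum_symm j _ _ h _ _ (momentum_mul hg hg' hd h)
  rw [inner_sub_right, inner_smul_right, ← inner_mulCLM_comm hg' ψ ψ, inner_mulCLM_self hg',
    ← inner_mulCLM_comm hg ψ φ, ← inner_conj_symm (mulCLM g ψ) φ] at h1
  have h2 := congrArg Complex.im h1
  simp only [Complex.sub_im, Complex.conj_im, Complex.mul_im, Complex.I_re, Complex.I_im,
    Complex.ofReal_re, Complex.ofReal_im] at h2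
  have h3 : 0 ≤ ‖φ - Complex.I • mulCLM g ψ‖ ^ 2 := by positivity
  rw [@norm_sub_sq ℂ, inner_smul_right, norm_smul, Complex.norm_I, one_mul, norm_mulCLM_sq hg]
    at h3
  have h4 : RCLike.re (Complex.I * ⟪φ, mulCLM g ψ⟫_ℂ) = -(⟪φ, mulCLM g ψ⟫_ℂ).im := by
    change (Complex.I * ⟪φ, mulCLM g ψ⟫_ℂ).re = _
    simp
  rw [h4] at h3
  linarith

end Calculus

section Inequalities

open FourierTransform Filter Topology

variable {K : Type*} [NormedAddCommGroup K] [InnerProductSpace ℂ K] [CompleteSpace K]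

/-! ### The Hardy and Coulomb inequalities -/

/-- A vector field g with w ≤ div g - |g|² certifies w ≤ p² as forms. The Hardy and Coulomb
inequalities are two choices of g. -/
theorem integral_weight_le {g g' : Fin 3 → R3 → ℝ} {w : R3 → ℝ} (hg : ∀ j, BddFun (g j))
    (hg' : ∀ j, BddFun (g' j)) (hw : BddFun w)
    (hd : ∀ j x, HasLineDerivAt ℝ (g j) (g' j x) x (basisVec j))
    (hle : ∀ x, w x ≤ ∑ j, (g' j x - g j x ^ 2)) {ψ : ParticleSpace K} {P : Fin 3 → ParticleSpace K}
    (h : ∀ j, (ψ, P j) ∈ (momentum K j).graph) :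
    ∫ x, w x * ‖ψ x‖ ^ 2 ≤ ∑ j, ‖P j‖ ^ 2 := by
  have i1 : ∀ j, Integrable fun x => g' j x * ‖ψ x‖ ^ 2 := fun j => integrable_mul_norm_sq (hg' j) ψ
  have i2 : ∀ j, Integrable fun x => g j x ^ 2 * ‖ψ x‖ ^ 2 := fun j => by
    simpa only [← pow_two] using integrable_mul_norm_sq ((hg j).mul (hg j)) ψ
  calc ∫ x, w x * ‖ψ x‖ ^ 2
      ≤ ∫ x, ∑ j, (g' j x * ‖ψ x‖ ^ 2 - g j x ^ 2 * ‖ψ x‖ ^ 2) := by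
        refine integral_mono (integrable_mul_norm_sq hw ψ)
          (integrable_finsetSum _ fun j _ => (i1 j).sub (i2 j)) fun x => ?_
        simp only [← sub_mul, ← Finset.sum_mul]
        exact mul_le_mul_of_nonneg_right (hle x) (by positivity)
    _ = ∑ j, ((∫ x, g' j x * ‖ψ x‖ ^ 2) - ∫ x, g j x ^ 2 * ‖ψ x‖ ^ 2) := by
        refine (integral_finsetSum _ fun j _ => (i1 j).sub (i2 j)).trans ?_
        exact Finset.sum_congr rfl fun j _ => integral_sub (i1 j) (i2 j)
    _ ≤ ∑ j, ‖P j‖ ^ 2 := by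
        refine Finset.sum_le_sum fun j _ => ?_
        have := integral_deriv_mul_le (hg j) (hg' j) (hd j) (h j)
        linarith

theorem norm_add_smul_basisVec_sq (x : R3) (t : ℝ) (j : Fin 3) :
    ‖x + t • basisVec j‖ ^ 2 = ‖x‖ ^ 2 + 2 * t * x j + t ^ 2 := by
  rw [norm_add_sq_real, inner_smul_right, EuclideanSpace.inner_single_right, norm_smul,
    PiLp.norm_single]
  simp
  ring

theorem hasDerivAt_norm_sq_line (x : R3) (j : Fin 3) :
    HasDerivAt (fun t : ℝ => ‖x + t • basisVec j‖ ^ 2) (2 * x j) 0 := by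
  simp only [norm_add_smul_basisVec_sq]
  have h := (((hasDerivAt_id (0 : ℝ)).const_mul 2).mul_const (x j)).const_add (‖x‖ ^ 2)
    |>.add ((hasDerivAt_id (0 : ℝ)).pow 2)
  refine h.congr_deriv ?_
  simp

theorem hasDerivAt_coord_line (x : R3) (j : Fin 3) :
    HasDerivAt (fun t : ℝ => (x + t • basisVec j) j) 1 0 := by
  have h : ∀ t : ℝ, (x + t • basisVec j) j = x j + t := by
    intro t
    simp
  simp only [h]
  exact (hasDerivAt_id (0 : ℝ)).const_add _

theorem abs_coord_le (x : R3) (j : Fin 3) : |x j| ≤ ‖x‖ := by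
  have := PiLp.norm_apply_le x j
  rwa [Real.norm_eq_abs] at this

theorem sum_coord_sq (x : R3) : ∑ j, x j ^ 2 = ‖x‖ ^ 2 := by
  rw [EuclideanSpace.norm_sq_eq]
  simp

/-- Fatou's lemma; it removes the regularization δ of the singular weights. -/
theorem integrable_and_integral_le_of_tendsto {f : ℕ → R3 → ℝ} {F : R3 → ℝ} {C : ℝ}
    (h0 : ∀ n x, 0 ≤ f n x) (hi : ∀ n, Integrable (f n)) (hC : ∀ n, ∫ x, f n x ≤ C)
    (ht : ∀ᵐ x, Tendsto (fun n => f n x) atTop (𝓝 (F x))) :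
    Integrable F ∧ ∫ x, F x ≤ C := by
  have hm : AEStronglyMeasurable F :=
    aestronglyMeasurable_of_tendsto_ae atTop (fun n => (hi n).aestronglyMeasurable) ht
  have hF0 : 0 ≤ᵐ[volume] F := by
    filter_upwards [ht] with x hx
    exact ge_of_tendsto' hx fun n => h0 n x
  have hC0 : 0 ≤ C := (integral_nonneg (h0 0)).trans (hC 0)
  have key : ∫⁻ x, ENNReal.ofReal (F x) ≤ ENNReal.ofReal C := by
    calc ∫⁻ x, ENNReal.ofReal (F x)
        = ∫⁻ x, liminf (fun n => ENNReal.ofReal (f n x)) atTop := by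
          refine lintegral_congr_ae ?_
          filter_upwards [ht] with x hx
          exact ((ENNReal.continuous_ofReal.tendsto _).comp hx).liminf_eq.symm
      _ ≤ liminf (fun n => ∫⁻ x, ENNReal.ofReal (f n x)) atTop :=
          lintegral_liminf_le' fun n => (hi n).aestronglyMeasurable.aemeasurable.ennreal_ofReal
      _ ≤ ENNReal.ofReal C := by
          refine (liminf_le_liminf (Eventually.of_forall fun n => ?_)).trans
            (liminf_const (f := atTop) (ENNReal.ofReal C)).le
          rw [← ofReal_integral_eq_lintegral_ofReal (hi n) (Eventually.of_forall (h0 n))]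
          exact ENNReal.ofReal_le_ofReal (hC n)
  constructor
  · refine ⟨hm, ?_⟩
    rw [hasFiniteIntegral_iff_ofReal hF0]
    exact key.trans_lt ENNReal.ofReal_lt_top
  · rw [integral_eq_lintegral_of_nonneg_ae hF0 hm]
    exact ENNReal.toReal_le_of_le_ofReal hC0 key

theorem tendsto_inv_nat_succ : Tendsto (fun n : ℕ => ((n : ℝ) + 1)⁻¹) atTop (𝓝 0) := by
  simpa only [one_div] using tendsto_one_div_add_atTop_nhds_zero_nat (𝕜 := ℝ)

theorem ae_ne_zero : ∀ᵐ x : R3, x ≠ 0 := by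
  simp [ae_iff]

/-- Vector field x/(2(|x|²+δ)). With ρ = (|x|²+δ)⁻¹ one has div g - |g|² = (3/2)ρ - (5/4)|x|²ρ²,
which is at least ρ/4 because |x|²ρ ≤ 1. Then δ → 0. -/
theorem hardy {ψ : ParticleSpace K} {P : Fin 3 → ParticleSpace K}
    (h : ∀ j, (ψ, P j) ∈ (momentum K j).graph) :
    Integrable (fun x => (‖x‖ ^ 2)⁻¹ * ‖ψ x‖ ^ 2) ∧
      ∫ x, (‖x‖ ^ 2)⁻¹ * ‖ψ x‖ ^ 2 ≤ 4 * ∑ j, ‖P j‖ ^ 2 := by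
  have hb : ∀ δ : ℝ, 0 < δ → BddFun fun x : R3 => (‖x‖ ^ 2 + δ)⁻¹ := by
    intro δ hδ
    refine ⟨Continuous.inv₀ (by fun_prop) fun x => by positivity, δ⁻¹, fun x => ?_⟩
    dsimp only
    rw [abs_of_nonneg (by positivity)]
    gcongr
    nlinarith [sq_nonneg ‖x‖]
  have key : ∀ δ : ℝ, 0 < δ → ∫ x, (‖x‖ ^ 2 + δ)⁻¹ * ‖ψ x‖ ^ 2 ≤ 4 * ∑ j, ‖P j‖ ^ 2 := by
    intro δ hδ
    have hpos : ∀ x : R3, 0 < ‖x‖ ^ 2 + δ := fun x => by positivity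
    have hcont : Continuous fun x : R3 => (‖x‖ ^ 2 + δ)⁻¹ := (hb δ hδ).1
    have hg : ∀ j, BddFun fun x : R3 => x j / 2 * (‖x‖ ^ 2 + δ)⁻¹ := by
      intro j
      refine ⟨by fun_prop, δ⁻¹ + 1, fun x => ?_⟩
      dsimp only
      rw [abs_mul, abs_of_pos (inv_pos.mpr (hpos x)), ← div_eq_mul_inv, div_le_iff₀ (hpos x), abs_div,
        abs_two]
      have h1 := abs_coord_le x j
      have h2 : (δ⁻¹ + 1) * (‖x‖ ^ 2 + δ) = δ⁻¹ * ‖x‖ ^ 2 + 1 + ‖x‖ ^ 2 + δ := by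
        field_simp
        ring
      have h3 : 0 ≤ δ⁻¹ * ‖x‖ ^ 2 := by positivity
      rw [h2]
      nlinarith [sq_nonneg (‖x‖ - 1)]
    have hg' : ∀ j, BddFun fun x : R3 => (‖x‖ ^ 2 + δ)⁻¹ / 2 - x j ^ 2 * ((‖x‖ ^ 2 + δ)⁻¹) ^ 2 := by
      intro j
      refine ⟨by fun_prop, δ⁻¹ + δ⁻¹, fun x => ?_⟩
      have h1 : (‖x‖ ^ 2 + δ)⁻¹ ≤ δ⁻¹ := by
        gcongr
        nlinarith [sq_nonneg ‖x‖]
      have h2 : 0 < (‖x‖ ^ 2 + δ)⁻¹ := inv_pos.mpr (hpos x)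
      have h3 : x j ^ 2 ≤ ‖x‖ ^ 2 := sq_le_sq' (abs_le.mp (abs_coord_le x j)).1
        (abs_le.mp (abs_coord_le x j)).2
      have h4 : x j ^ 2 * (‖x‖ ^ 2 + δ)⁻¹ ≤ 1 := by
        rw [← div_eq_mul_inv, div_le_one (hpos x)]
        linarith
      have h5 : 0 ≤ x j ^ 2 * (‖x‖ ^ 2 + δ)⁻¹ := by positivity
      rw [abs_le]
      constructor <;> nlinarith
    have hw : BddFun fun x : R3 => (1 / 4) * (‖x‖ ^ 2 + δ)⁻¹ :=
      BddFun.mul (f := fun _ => 1 / 4) ⟨continuous_const, 1 / 4, fun x => by norm_num⟩ (hb δ hδ)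
    have := integral_weight_le hg hg' hw ?_ ?_ h
    · simp only [mul_assoc] at this
      rw [integral_const_mul] at this
      linarith
    · intro j x
      have h1 := ((hasDerivAt_norm_sq_line x j).add_const δ).inv (by simpa using (hpos x).ne')
      have h2 := ((hasDerivAt_coord_line x j).div_const 2).mul h1
      unfold HasLineDerivAt
      refine h2.congr_deriv ?_
      simp only [zero_smul, add_zero, Pi.inv_apply]
      have := (hpos x).ne'
      field_simp
      ring
    · intro x
      have h1 : ∑ j, ((‖x‖ ^ 2 + δ)⁻¹ / 2 - x j ^ 2 * ((‖x‖ ^ 2 + δ)⁻¹) ^ 2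
          - (x j / 2 * (‖x‖ ^ 2 + δ)⁻¹) ^ 2) = 3 / 2 * (‖x‖ ^ 2 + δ)⁻¹
          - 5 / 4 * ‖x‖ ^ 2 * ((‖x‖ ^ 2 + δ)⁻¹) ^ 2 := by
        rw [← sum_coord_sq]
        simp only [Fin.sum_univ_three]
        ring
      rw [h1]
      have h2 : ‖x‖ ^ 2 * (‖x‖ ^ 2 + δ)⁻¹ ≤ 1 := by
        rw [← div_eq_mul_inv, div_le_one (hpos x)]
        linarith
      have h3 : 0 < (‖x‖ ^ 2 + δ)⁻¹ := inv_pos.mpr (hpos x)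
      nlinarith
  refine integrable_and_integral_le_of_tendsto
    (f := fun n x => (‖x‖ ^ 2 + ((n : ℝ) + 1)⁻¹)⁻¹ * ‖ψ x‖ ^ 2) (fun n x => by positivity)
    (fun n => integrable_mul_norm_sq (hb _ (by positivity)) ψ) (fun n => key _ (by positivity)) ?_
  filter_upwards [ae_ne_zero] with x hx
  have h1 : Tendsto (fun n : ℕ => ‖x‖ ^ 2 + ((n : ℝ) + 1)⁻¹) atTop (𝓝 (‖x‖ ^ 2)) := by
    simpa using tendsto_inv_nat_succ.const_add (‖x‖ ^ 2)
  exact (h1.inv₀ (by positivity)).mul_const _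

/-- Vector field αx/r with r = √(|x|²+δ). Here div g - |g|² is at least 2α/r - α², because |x| ≤ r.
In the limit δ → 0 this is the sharp bound p²/2 - α/|x| ≥ -α²/2. -/
theorem coulomb {ψ : ParticleSpace K} {P : Fin 3 → ParticleSpace K}
    (h : ∀ j, (ψ, P j) ∈ (momentum K j).graph) {α : ℝ} (hα : 0 ≤ α) :
    Integrable (fun x => ‖x‖⁻¹ * ‖ψ x‖ ^ 2) ∧
      2 * α * ∫ x, ‖x‖⁻¹ * ‖ψ x‖ ^ 2 ≤ (∑ j, ‖P j‖ ^ 2) + α ^ 2 * ‖ψ‖ ^ 2 := by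
  have hint : Integrable (fun x => ‖x‖⁻¹ * ‖ψ x‖ ^ 2) := by
    -- Integrability comes from Hardy's inequality, since 1/|x| ≤ 1 + 1/|x|².
    refine ((integrable_norm_sq ψ).add (hardy h).1).mono' ?_ (Eventually.of_forall fun x => ?_)
    · exact (measurable_norm.inv.aestronglyMeasurable).mul
        (integrable_norm_sq ψ).aestronglyMeasurable
    · rw [Real.norm_of_nonneg (by positivity), Pi.add_apply, ← one_add_mul]
      gcongr
      rw [← inv_pow]
      nlinarith [sq_nonneg (‖x‖⁻¹ - 1)]
  refine ⟨hint, ?_⟩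
  have hb : ∀ δ : ℝ, 0 < δ → BddFun fun x : R3 => (√(‖x‖ ^ 2 + δ))⁻¹ := by
    intro δ hδ
    refine ⟨Continuous.inv₀ (by fun_prop) fun x => by positivity, (√δ)⁻¹, fun x => ?_⟩
    dsimp only
    rw [abs_of_nonneg (by positivity)]
    gcongr
    nlinarith [sq_nonneg ‖x‖]
  have key : ∀ δ : ℝ, 0 < δ → ∫ x, 2 * α * ((√(‖x‖ ^ 2 + δ))⁻¹ * ‖ψ x‖ ^ 2)
      ≤ (∑ j, ‖P j‖ ^ 2) + α ^ 2 * ‖ψ‖ ^ 2 := by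
    intro δ hδ
    have hpos : ∀ x : R3, 0 < √(‖x‖ ^ 2 + δ) := fun x => by positivity
    have hsq : ∀ x : R3, √(‖x‖ ^ 2 + δ) ^ 2 = ‖x‖ ^ 2 + δ := fun x => Real.sq_sqrt (by positivity)
    have hcont : Continuous fun x : R3 => (√(‖x‖ ^ 2 + δ))⁻¹ := (hb δ hδ).1
    have hc1 : ∀ (x : R3), ‖x‖ ^ 2 * ((√(‖x‖ ^ 2 + δ))⁻¹) ^ 2 ≤ 1 := by
      intro x
      rw [inv_pow, ← div_eq_mul_inv, div_le_one (by positivity), hsq]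
      linarith
    have hc2 : ∀ (x : R3) j, x j ^ 2 ≤ ‖x‖ ^ 2 := fun x j =>
      sq_le_sq' (abs_le.mp (abs_coord_le x j)).1 (abs_le.mp (abs_coord_le x j)).2
    have hc : ∀ (x : R3) j, x j ^ 2 * ((√(‖x‖ ^ 2 + δ))⁻¹) ^ 2 ≤ 1 := fun x j =>
      (mul_le_mul_of_nonneg_right (hc2 x j) (by positivity)).trans (hc1 x)
    have hg : ∀ j, BddFun fun x : R3 => α * x j * (√(‖x‖ ^ 2 + δ))⁻¹ := by
      intro j
      refine ⟨by fun_prop, α, fun x => ?_⟩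
      dsimp only
      rw [mul_assoc, abs_mul, abs_of_nonneg hα]
      refine mul_le_of_le_one_right hα ?_
      rw [← sq_le_one_iff_abs_le_one, mul_pow]
      exact hc x j
    have hg' : ∀ j, BddFun fun x : R3 => α * ((√(‖x‖ ^ 2 + δ))⁻¹
        - x j ^ 2 * ((√(‖x‖ ^ 2 + δ))⁻¹) ^ 3) := by
      intro j
      refine ⟨by fun_prop, α * (√δ)⁻¹, fun x => ?_⟩
      rw [abs_mul, abs_of_nonneg hα]
      have h1 : (√(‖x‖ ^ 2 + δ))⁻¹ ≤ (√δ)⁻¹ := by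
        gcongr
        nlinarith [sq_nonneg ‖x‖]
      have h2 : 0 < (√(‖x‖ ^ 2 + δ))⁻¹ := inv_pos.mpr (hpos x)
      have h4 := hc x j
      have h5 : 0 ≤ x j ^ 2 * ((√(‖x‖ ^ 2 + δ))⁻¹) ^ 2 := by positivity
      have h6 : x j ^ 2 * ((√(‖x‖ ^ 2 + δ))⁻¹) ^ 3
        = x j ^ 2 * ((√(‖x‖ ^ 2 + δ))⁻¹) ^ 2 * (√(‖x‖ ^ 2 + δ))⁻¹ := by ring
      gcongr
      rw [h6, abs_le]
      constructor <;> nlinarith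
    have hw : BddFun fun x : R3 => 2 * α * (√(‖x‖ ^ 2 + δ))⁻¹ + -α ^ 2 :=
      (BddFun.mul (f := fun _ => 2 * α) ⟨continuous_const, |2 * α|, fun x => le_rfl⟩ (hb δ hδ)).add
        ⟨continuous_const, |-α ^ 2|, fun x => le_rfl⟩
    have := integral_weight_le hg hg' hw ?_ ?_ h
    · simp only [add_mul] at this
      rw [integral_add, integral_const_mul (-α ^ 2), ← norm_sq_eq_integral] at this
      · simp only [← mul_assoc]
        linarith
      · exact integrable_mul_norm_sq
          (BddFun.mul (f := fun _ => 2 * α) ⟨continuous_const, |2 * α|, fun x => le_rfl⟩ (hb δ hδ)) ψ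
      · exact (integrable_norm_sq ψ).const_mul _
    · intro j x
      have h0 : (‖x + (0 : ℝ) • basisVec j‖ ^ 2 + δ) ≠ 0 := by positivity
      have h1 := (((hasDerivAt_norm_sq_line x j).add_const δ).sqrt h0).inv
        (by simpa using (hpos x).ne')
      have h2 := ((hasDerivAt_coord_line x j).const_mul α).mul h1
      unfold HasLineDerivAt
      refine h2.congr_deriv ?_
      simp only [zero_smul, add_zero, Pi.inv_apply]
      have := (hpos x).ne'
      field_simp
      ring
    · intro x
      have h1 : ∑ j, (α * ((√(‖x‖ ^ 2 + δ))⁻¹ - x j ^ 2 * ((√(‖x‖ ^ 2 + δ))⁻¹) ^ 3)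
          - (α * x j * (√(‖x‖ ^ 2 + δ))⁻¹) ^ 2) = α * (3 * (√(‖x‖ ^ 2 + δ))⁻¹
          - ‖x‖ ^ 2 * ((√(‖x‖ ^ 2 + δ))⁻¹) ^ 2 * (√(‖x‖ ^ 2 + δ))⁻¹)
          - α ^ 2 * (‖x‖ ^ 2 * ((√(‖x‖ ^ 2 + δ))⁻¹) ^ 2) := by
        rw [← sum_coord_sq]
        simp only [Fin.sum_univ_three]
        ring
      rw [h1]
      have h2 := hc1 x
      have h3 : 0 < (√(‖x‖ ^ 2 + δ))⁻¹ := inv_pos.mpr (hpos x)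
      have h4 : ‖x‖ ^ 2 * ((√(‖x‖ ^ 2 + δ))⁻¹) ^ 2 * (√(‖x‖ ^ 2 + δ))⁻¹ ≤ (√(‖x‖ ^ 2 + δ))⁻¹ :=
        mul_le_of_le_one_left h3.le h2
      have h5 : α ^ 2 * (‖x‖ ^ 2 * ((√(‖x‖ ^ 2 + δ))⁻¹) ^ 2) ≤ α ^ 2 :=
        mul_le_of_le_one_right (by positivity) h2
      nlinarith
  have := (integrable_and_integral_le_of_tendsto
    (f := fun n x => 2 * α * ((√(‖x‖ ^ 2 + ((n : ℝ) + 1)⁻¹))⁻¹ * ‖ψ x‖ ^ 2))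
    (F := fun x => 2 * α * (‖x‖⁻¹ * ‖ψ x‖ ^ 2)) (fun n x => by positivity)
    (fun n => (integrable_mul_norm_sq (hb _ (by positivity)) ψ).const_mul _)
    (fun n => key _ (by positivity)) ?_).2
  · rwa [integral_const_mul] at this
  · filter_upwards [ae_ne_zero] with x hx
    have h1 : Tendsto (fun n : ℕ => ‖x‖ ^ 2 + ((n : ℝ) + 1)⁻¹) atTop (𝓝 (‖x‖ ^ 2)) := by
      simpa using tendsto_inv_nat_succ.const_add (‖x‖ ^ 2)
    have h2 := (Real.continuous_sqrt.tendsto _).comp h1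
    rw [Real.sqrt_sq (norm_nonneg x)] at h2
    exact ((h2.inv₀ (by positivity)).mul_const _).const_mul _

end Inequalities

section Multipliers

open FourierTransform

variable {K : Type*} [NormedAddCommGroup K] [InnerProductSpace ℂ K] [CompleteSpace K]

/-! ### Fourier multipliers -/

theorem norm_sq_le_of_ae {ι : Type*} [Fintype ι] {ψ : ι → ParticleSpace K} {φ : ParticleSpace K}
    {C : ℝ} (h : ∀ᵐ x, ∑ j, ‖ψ j x‖ ^ 2 ≤ C * ‖φ x‖ ^ 2) : ∑ j, ‖ψ j‖ ^ 2 ≤ C * ‖φ‖ ^ 2 := by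
  simp only [norm_sq_eq_integral]
  rw [← integral_finsetSum _ fun j _ => integrable_norm_sq (ψ j), ← integral_const_mul]
  exact integral_mono_ae (integrable_finsetSum _ fun j _ => integrable_norm_sq (ψ j))
    ((integrable_norm_sq φ).const_mul C) h

/-- The Fourier multiplier with operator valued symbol `D`. -/
def fourierMul (D : R3 → K →L[ℂ] K) (ψ : ParticleSpace K) : ParticleSpace K :=
  𝓕⁻ (fiberCLM D (𝓕 ψ))

/-- The Fourier multiplier as a bounded operator. -/
def fourierMulCLM (D : R3 → K →L[ℂ] K) : ParticleSpace K →L[ℂ] ParticleSpace K :=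
  ((Lp.fourierTransformₗᵢ R3 K).symm.toContinuousLinearEquiv : _ →L[ℂ] _) ∘L fiberCLM D ∘L
    ((Lp.fourierTransformₗᵢ R3 K).toContinuousLinearEquiv : _ →L[ℂ] _)

theorem fourierMulCLM_apply (D : R3 → K →L[ℂ] K) (ψ : ParticleSpace K) :
    fourierMulCLM D ψ = fourierMul D ψ := rfl

theorem fourier_fourierMul (D : R3 → K →L[ℂ] K) (ψ : ParticleSpace K) :
    𝓕 (fourierMul D ψ) = fiberCLM D (𝓕 ψ) :=
  fourier_fourierInv_eq _

theorem fourier_injective {ψ φ : ParticleSpace K} (h : 𝓕 ψ = 𝓕 φ) : ψ = φ :=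
  (Lp.fourierTransformₗᵢ R3 K).injective h

theorem sum_norm_fourierMul_sq_le {ι : Type*} [Fintype ι] {D : ι → R3 → K →L[ℂ] K}
    (hD : ∀ j, BddCont (D j)) {C : ℝ} (h : ∀ ξ u, ∑ j, ‖D j ξ u‖ ^ 2 ≤ C * ‖u‖ ^ 2)
    (ψ : ParticleSpace K) : ∑ j, ‖fourierMul (D j) ψ‖ ^ 2 ≤ C * ‖ψ‖ ^ 2 := by
  have h1 : ∑ j, ‖fiberCLM (D j) (𝓕 ψ)‖ ^ 2 ≤ C * ‖𝓕 ψ‖ ^ 2 := by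
    refine norm_sq_le_of_ae ?_
    have := ae_all_iff.mpr fun j => fiberCLM_ae (hD j) (𝓕 ψ)
    filter_upwards [this] with ξ hξ
    simp only [hξ]
    exact h ξ _
  simpa only [← fourier_fourierMul, Lp.norm_fourier_eq] using h1

theorem norm_fourierMul_le {D : R3 → K →L[ℂ] K} (hD : BddCont D) {C : ℝ} (h : ∀ ξ, ‖D ξ‖ ≤ C)
    (ψ : ParticleSpace K) : ‖fourierMul D ψ‖ ≤ C * ‖ψ‖ := by
  rw [← Lp.norm_fourier_eq, fourier_fourierMul, ← Lp.norm_fourier_eq ψ]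
  exact norm_fiberCLM_le hD h _

theorem fourierMul_congr {D D' : R3 → K →L[ℂ] K} (h : ∀ ξ, D ξ = D' ξ) (ψ : ParticleSpace K) :
    fourierMul D ψ = fourierMul D' ψ := by
  rw [funext h]

theorem fiberCLM_const_fourierMul {D : R3 → K →L[ℂ] K} (B : K →L[ℂ] K) (hD : BddCont D)
    (ψ : ParticleSpace K) :
    fiberCLM (fun _ => B) (fourierMul D ψ) = fourierMul (fun ξ => B ∘L D ξ) ψ := by
  apply fourier_injective
  rw [fourier_fiberCLM_const, fourier_fourierMul, fourier_fourierMul,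
    fiberCLM_comp (bddCont_const B) hD]

theorem mem_momentum_fourierMul {j : Fin 3} {D D' : R3 → K →L[ℂ] K} (hD : BddCont D)
    (hD' : BddCont D') (h : ∀ ξ, D' ξ = ((2 * Real.pi * ξ j : ℝ) : ℂ) • D ξ)
    (ψ : ParticleSpace K) :
    (fourierMul D ψ, fourierMul D' ψ) ∈ (momentum K j).graph := by
  rw [mem_momentum_iff_fourier, fourier_fourierMul, fourier_fourierMul]
  filter_upwards [fiberCLM_ae hD (𝓕 ψ), fiberCLM_ae hD' (𝓕 ψ)] with ξ h1 h2
  rw [h1, h2, h]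
  rfl

/-! ### The kinetic energy -/

theorem mem_kinetic_iff {ψ χ : ParticleSpace K} :
    (ψ, χ) ∈ (kinetic K).graph ↔ ∃ P Q : Fin 3 → ParticleSpace K,
      (∀ j, (ψ, P j) ∈ (momentum K j).graph) ∧ (∀ j, (P j, Q j) ∈ (momentum K j).graph) ∧
      χ = (1 / 2 : ℂ) • ∑ j, Q j := by
  rw [kinetic, mem_graph_smul_iff]
  simp only [mem_graph_sum_iff, mem_graph_opComp_iff]
  constructor
  · rintro ⟨_, ⟨Q, hQ, rfl⟩, h⟩
    choose P hP using hQ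
    exact ⟨P, Q, fun j => (hP j).1, fun j => (hP j).2, h⟩
  · rintro ⟨P, Q, hP, hQ, h⟩
    exact ⟨_, ⟨Q, fun j => ⟨P j, hP j, hQ j⟩, rfl⟩, h⟩

theorem kinetic_symm : AdjointPair (kinetic K) (kinetic K) := by
  refine AdjointPair.smul (AdjointPair.sum fun j => ?_)
    (by rw [show (1 / 2 : ℂ) = ((1 / 2 : ℝ) : ℂ) by norm_num, Complex.conj_ofReal])
  exact (momentum_symm j).comp (momentum_symm j)

theorem inner_kinetic {ψ χ : ParticleSpace K} (h : (ψ, χ) ∈ (kinetic K).graph)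
    {P : Fin 3 → ParticleSpace K} (hP : ∀ j, (ψ, P j) ∈ (momentum K j).graph) :
    (⟪ψ, χ⟫_ℂ).re = (1 / 2) * ∑ j, ‖P j‖ ^ 2 := by
  obtain ⟨P', Q, hP', hQ, rfl⟩ := mem_kinetic_iff.mp h
  obtain rfl : P = P' := funext fun j => graph_unique (hP j) (hP' j)
  have h1 : ∀ j, ⟪ψ, Q j⟫_ℂ = ((‖P j‖ ^ 2 : ℝ) : ℂ) := by
    intro j
    rw [← momentum_symm j _ _ (hP j) _ _ (hQ j), inner_self_eq_norm_sq_to_K, Complex.ofReal_pow]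
    rfl
  rw [inner_smul_right, inner_sum]
  simp only [h1]
  rw [← Complex.ofReal_sum, show (1 / 2 : ℂ) = ((1 / 2 : ℝ) : ℂ) by norm_num,
    ← Complex.ofReal_mul, Complex.ofReal_re]

/-- The symbol `2π²|ξ|²` of `p²/2`. -/
def kineticSymbol (ξ : R3) : ℝ := 2 * Real.pi ^ 2 * ‖ξ‖ ^ 2

theorem kineticSymbol_nonneg (ξ : R3) : 0 ≤ kineticSymbol ξ := by
  unfold kineticSymbol
  positivity

theorem continuous_kineticSymbol : Continuous kineticSymbol := by
  unfold kineticSymbol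
  fun_prop

theorem sum_momentumSymbol_sq (ξ : R3) :
    ∑ j, (2 * Real.pi * ξ j) ^ 2 = 2 * kineticSymbol ξ := by
  simp only [mul_pow, ← Finset.mul_sum, sum_coord_sq, kineticSymbol]
  ring

theorem momentumSymbol_sq_le (ξ : R3) (j : Fin 3) :
    (2 * Real.pi * ξ j) ^ 2 ≤ 2 * kineticSymbol ξ := by
  rw [← sum_momentumSymbol_sq]
  exact Finset.single_le_sum (f := fun j => (2 * Real.pi * ξ j) ^ 2)
    (fun i _ => sq_nonneg _) (Finset.mem_univ j)

theorem fourier_kinetic {ψ χ : ParticleSpace K} (h : (ψ, χ) ∈ (kinetic K).graph) :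
    ∀ᵐ ξ, (𝓕 χ) ξ = (kineticSymbol ξ : ℂ) • (𝓕 ψ) ξ := by
  obtain ⟨P, Q, hP, hQ, rfl⟩ := mem_kinetic_iff.mp h
  simp only [mem_momentum_iff_fourier] at hP hQ
  have e : 𝓕 ((1 / 2 : ℂ) • ∑ j, Q j) = (1 / 2 : ℂ) • (𝓕 (Q 0) + 𝓕 (Q 1) + 𝓕 (Q 2)) := by
    rw [Fin.sum_univ_three, FourierTransform.fourier_smul, FourierTransform.fourier_add,
      FourierTransform.fourier_add]
  rw [e]
  filter_upwards [ae_all_iff.mpr hP, ae_all_iff.mpr hQ,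
    Lp.coeFn_smul (1 / 2 : ℂ) (𝓕 (Q 0) + 𝓕 (Q 1) + 𝓕 (Q 2)),
    Lp.coeFn_add (𝓕 (Q 0) + 𝓕 (Q 1)) (𝓕 (Q 2)), Lp.coeFn_add (𝓕 (Q 0)) (𝓕 (Q 1))]
    with ξ h1 h2 h3 h4 h5
  rw [h3, Pi.smul_apply, h4, Pi.add_apply, h5, Pi.add_apply]
  simp only [h1, h2, smul_smul, ← add_smul]
  congr 1
  have := sum_momentumSymbol_sq ξ
  rw [Fin.sum_univ_three] at this
  have h6 : kineticSymbol ξ = 1 / 2 * (2 * Real.pi * ξ 0 * (2 * Real.pi * ξ 0)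
      + 2 * Real.pi * ξ 1 * (2 * Real.pi * ξ 1) + 2 * Real.pi * ξ 2 * (2 * Real.pi * ξ 2)) := by
    linarith
  rw [h6]
  push_cast
  ring

/-! ### Resolvents of nonnegative operators, coupled to the kinetic energy -/

/-- `Q t` behaves like the resolvent `(h + t)⁻¹` of a nonnegative operator `h`. -/
structure IsResolventFamily (Q : ℝ → K →L[ℂ] K) : Prop where
  norm_le : ∀ t, 0 < t → ‖Q t‖ ≤ t⁻¹
  resolvent : ∀ s t, 0 < s → 0 < t → Q s - Q t = ((t - s : ℝ) : ℂ) • (Q s ∘L Q t)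

theorem bddCont_smul {c : R3 → ℂ} {D : R3 → K →L[ℂ] K} (hc : Continuous c) (hD : Continuous D)
    {C : ℝ} (h : ∀ ξ, ‖c ξ‖ * ‖D ξ‖ ≤ C) : BddCont fun ξ => c ξ • D ξ :=
  ⟨hc.smul hD, C, fun ξ => by rw [norm_smul]; exact h ξ⟩

namespace IsResolventFamily

variable {Q : ℝ → K →L[ℂ] K} (hQ : IsResolventFamily Q) {s : ℝ} (hs : 0 < s)
include hQ hs

/-- The resolvent identity makes t ↦ Q t Lipschitz on [s, ∞), with constant s⁻². -/
theorem continuous_symbol : Continuous fun ξ => Q (kineticSymbol ξ + s) := by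
  have hpos : ∀ ξ, 0 < kineticSymbol ξ + s := fun ξ => by
    have := kineticSymbol_nonneg ξ
    linarith
  have hb : ∀ ξ, ‖Q (kineticSymbol ξ + s)‖ ≤ s⁻¹ := fun ξ =>
    (hQ.norm_le _ (hpos ξ)).trans (by
      gcongr
      linarith [kineticSymbol_nonneg ξ])
  rw [continuous_iff_continuousAt]
  intro ξ₀
  rw [ContinuousAt, tendsto_iff_norm_sub_tendsto_zero]
  have h1 : Filter.Tendsto (fun ξ => |kineticSymbol ξ₀ - kineticSymbol ξ| * (s⁻¹ * s⁻¹))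
      (nhds ξ₀) (nhds 0) := by
    have : Continuous fun ξ => |kineticSymbol ξ₀ - kineticSymbol ξ| * (s⁻¹ * s⁻¹) := by
      have := continuous_kineticSymbol
      fun_prop
    simpa using this.tendsto ξ₀
  refine squeeze_zero (fun _ => norm_nonneg _) (fun ξ => ?_) h1
  rw [hQ.resolvent _ _ (hpos ξ) (hpos ξ₀), norm_smul, Complex.norm_real, Real.norm_eq_abs,
    add_sub_add_right_eq_sub]
  gcongr
  exact (ContinuousLinearMap.opNorm_comp_le _ _).trans
    (mul_le_mul (hb _) (hb _) (norm_nonneg _) (by positivity))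

theorem norm_symbol_le (ξ : R3) : ‖Q (kineticSymbol ξ + s)‖ ≤ (kineticSymbol ξ + s)⁻¹ :=
  hQ.norm_le _ (by linarith [kineticSymbol_nonneg ξ])

theorem bddCont_symbol : BddCont fun ξ => Q (kineticSymbol ξ + s) :=
  ⟨hQ.continuous_symbol hs, s⁻¹, fun ξ => (hQ.norm_symbol_le hs ξ).trans (by
      gcongr
      linarith [kineticSymbol_nonneg ξ])⟩

theorem bddCont_mul_symbol {c : R3 → ℝ} (hc : Continuous c) {C : ℝ}
    (h : ∀ ξ, |c ξ| ≤ C * (kineticSymbol ξ + s)) :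
    BddCont fun ξ => (c ξ : ℂ) • Q (kineticSymbol ξ + s) := by
  refine bddCont_smul (by fun_prop) (hQ.continuous_symbol hs) (C := C) fun ξ => ?_
  have hpos : 0 < kineticSymbol ξ + s := by linarith [kineticSymbol_nonneg ξ]
  rw [Complex.norm_real, Real.norm_eq_abs]
  calc |c ξ| * ‖Q (kineticSymbol ξ + s)‖
      ≤ (C * (kineticSymbol ξ + s)) * (kineticSymbol ξ + s)⁻¹ := by
        refine mul_le_mul (h ξ) (hQ.norm_symbol_le hs ξ) (norm_nonneg _)
          ((abs_nonneg _).trans (h ξ))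
    _ = C := by field_simp

theorem bddCont_momentum_symbol (j : Fin 3) :
    BddCont fun ξ => ((2 * Real.pi * ξ j : ℝ) : ℂ) • Q (kineticSymbol ξ + s) := by
  -- With a the kinetic symbol, (1 + s⁻¹)(a + s) = a + s + a/s + 1, and its square contains the term
  -- 2a, which dominates (2πξ_j)².
  refine hQ.bddCont_mul_symbol hs (C := 1 + s⁻¹) (by fun_prop) fun ξ => ?_
  have h1 := momentumSymbol_sq_le ξ j
  have h2 := kineticSymbol_nonneg ξ
  have h3 : (1 + s⁻¹) * (kineticSymbol ξ + s) = kineticSymbol ξ + s + s⁻¹ * kineticSymbol ξ + 1 := by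
    field_simp
    ring
  have h4 : 0 ≤ s⁻¹ * kineticSymbol ξ := by positivity
  rw [h3]
  refine abs_le_of_sq_le_sq (h1.trans ?_) (by positivity)
  nlinarith [mul_nonneg h2 hs.le, mul_nonneg h2 h4, mul_nonneg hs.le h4, sq_nonneg (kineticSymbol ξ)]

theorem bddCont_momentum_sq_symbol (j : Fin 3) :
    BddCont fun ξ => (((2 * Real.pi * ξ j) ^ 2 : ℝ) : ℂ) • Q (kineticSymbol ξ + s) := by
  refine hQ.bddCont_mul_symbol hs (C := 2) (by fun_prop) fun ξ => ?_
  have h1 := momentumSymbol_sq_le ξ j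
  rw [abs_of_nonneg (sq_nonneg _)]
  linarith

theorem bddCont_kinetic_symbol :
    BddCont fun ξ => (kineticSymbol ξ : ℂ) • Q (kineticSymbol ξ + s) := by
  refine hQ.bddCont_mul_symbol hs (C := 1) continuous_kineticSymbol fun ξ => ?_
  rw [abs_of_nonneg (kineticSymbol_nonneg _)]
  linarith

theorem momentum_mem (j : Fin 3) (y : ParticleSpace K) :
    (fourierMul (fun ξ => Q (kineticSymbol ξ + s)) y,
      fourierMul (fun ξ => ((2 * Real.pi * ξ j : ℝ) : ℂ) • Q (kineticSymbol ξ + s)) y)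
      ∈ (momentum K j).graph :=
  mem_momentum_fourierMul (hQ.bddCont_symbol hs) (hQ.bddCont_momentum_symbol hs j)
    (fun _ => rfl) y

theorem kinetic_mem (y : ParticleSpace K) :
    (fourierMul (fun ξ => Q (kineticSymbol ξ + s)) y,
      fourierMul (fun ξ => (kineticSymbol ξ : ℂ) • Q (kineticSymbol ξ + s)) y)
      ∈ (kinetic K).graph := by
  have hmem : (fourierMul (fun ξ => Q (kineticSymbol ξ + s)) y, (1 / 2 : ℂ) • ∑ j,
      fourierMul (fun ξ => (((2 * Real.pi * ξ j) ^ 2 : ℝ) : ℂ) • Q (kineticSymbol ξ + s)) y)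
      ∈ (kinetic K).graph := by
    refine mem_kinetic_iff.mpr ⟨_, _, fun j => hQ.momentum_mem hs j y, fun j => ?_, rfl⟩
    refine mem_momentum_fourierMul (hQ.bddCont_momentum_symbol hs j)
      (hQ.bddCont_momentum_sq_symbol hs j) (fun ξ => ?_) y
    rw [smul_smul]
    congr 1
    push_cast
    ring
  convert hmem using 2
  apply fourier_injective
  refine Lp.ext ?_
  filter_upwards [fourier_kinetic hmem, fiberCLM_ae (hQ.bddCont_symbol hs) (𝓕 y),
    fiberCLM_ae (hQ.bddCont_kinetic_symbol hs) (𝓕 y)] with ξ h1 h2 h3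
  rw [h1, fourier_fourierMul, fourier_fourierMul, h2, h3]
  rfl

/-- By Plancherel this is 2a/(a + s)² ≤ 1/(2s), an instance of (a - s)² ≥ 0. -/
theorem sum_norm_momentum_sq_le (y : ParticleSpace K) :
    ∑ j, ‖fourierMul (fun ξ => ((2 * Real.pi * ξ j : ℝ) : ℂ) • Q (kineticSymbol ξ + s)) y‖ ^ 2
      ≤ (2 * s)⁻¹ * ‖y‖ ^ 2 := by
  refine sum_norm_fourierMul_sq_le (hQ.bddCont_momentum_symbol hs) (fun ξ u => ?_) y
  have h0 := kineticSymbol_nonneg ξ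
  have hpos : 0 < kineticSymbol ξ + s := by linarith
  have h1 : ‖Q (kineticSymbol ξ + s) u‖ ^ 2 ≤ ((kineticSymbol ξ + s)⁻¹ * ‖u‖) ^ 2 := by
    gcongr
    exact (Q _).le_of_opNorm_le (hQ.norm_symbol_le hs ξ) u
  have h2 : ∀ j : Fin 3, ‖(((2 * Real.pi * ξ j : ℝ) : ℂ) • Q (kineticSymbol ξ + s)) u‖ ^ 2
      = (2 * Real.pi * ξ j) ^ 2 * ‖Q (kineticSymbol ξ + s) u‖ ^ 2 := by
    intro j
    rw [_root_.smul_apply, norm_smul, mul_pow, Complex.norm_real, Real.norm_eq_abs, sq_abs]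
  simp only [h2, ← Finset.sum_mul, sum_momentumSymbol_sq]
  calc 2 * kineticSymbol ξ * ‖Q (kineticSymbol ξ + s) u‖ ^ 2
      ≤ 2 * kineticSymbol ξ * ((kineticSymbol ξ + s)⁻¹ * ‖u‖) ^ 2 := by gcongr
    _ = (2 * kineticSymbol ξ * ((kineticSymbol ξ + s)⁻¹) ^ 2) * ‖u‖ ^ 2 := by ring
    _ ≤ (2 * s)⁻¹ * ‖u‖ ^ 2 := by
        gcongr
        rw [inv_pow, ← div_eq_mul_inv, div_le_iff₀ (by positivity), inv_mul_eq_div,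
          le_div_iff₀ (by positivity)]
        nlinarith [sq_nonneg (kineticSymbol ξ - s)]

end IsResolventFamily

end Multipliers

section FockOperators

/-! ### Bounded operators on Fock space -/

theorem norm_sq_eq_integral_Lp {α : Type*} [MeasurableSpace α] {μ : Measure α} (v : Lp ℂ 2 μ) :
    ‖v‖ ^ 2 = ∫ x, ‖v x‖ ^ 2 ∂μ := by
  have h1 : ⟪v, v⟫_ℂ = ((∫ x, ‖v x‖ ^ 2 ∂μ : ℝ) : ℂ) := by
    rw [L2.inner_def, ← integral_complex_ofReal]
    refine integral_congr_ae (Filter.Eventually.of_forall fun x => ?_)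
    dsimp only
    rw [inner_self_eq_norm_sq_to_K]
    push_cast
    rfl
  rw [inner_self_eq_norm_sq_to_K] at h1
  exact Complex.ofReal_injective (by rw [Complex.ofReal_pow]; exact h1)

theorem mem_bosonSector_iff {n : ℕ} {v : Lp ℂ 2 (volume : Measure (Fin n → R3))} :
    v ∈ bosonSector n ↔ ∀ σ : Equiv.Perm (Fin n), ∀ᵐ k, v (k ∘ σ) = v k := by
  simp only [bosonSector, Submodule.mem_iInf, LinearMap.mem_eqLocus, LinearMap.id_apply]
  refine forall_congr' fun σ => ?_
  have h := Lp.coeFn_compMeasurePreserving v (measurePreserving_perm σ)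
  constructor
  · intro hv
    have h' : (Lp.compMeasurePreserving (fun k : Fin n → R3 => k ∘ σ)
      (measurePreserving_perm σ) v) = v := hv
    rw [h'] at h
    filter_upwards [h] with k hk
    exact hk.symm
  · intro hv
    change (Lp.compMeasurePreserving (fun k : Fin n → R3 => k ∘ σ)
      (measurePreserving_perm σ) v) = v
    refine Lp.ext ?_
    filter_upwards [h, hv] with k hk hk2
    rw [hk]
    exact hk2

theorem component_symm (Ψ : FockSpace) (n : ℕ) (σ : Equiv.Perm (Fin n)) :
    ∀ᵐ k, component Ψ n (k ∘ σ) = component Ψ n k :=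
  mem_bosonSector_iff.mp (Ψ n).2 σ

theorem fock_summable (Ψ : FockSpace) : Summable fun n => ‖Ψ n‖ ^ 2 := by
  have := (lp.memℓp Ψ).summable (by norm_num)
  simpa using this

theorem fock_norm_sq (Ψ : FockSpace) : ‖Ψ‖ ^ 2 = ∑' n, ‖Ψ n‖ ^ 2 := by
  have := lp.norm_rpow_eq_tsum (p := 2) (by norm_num) Ψ
  simpa using this

theorem fock_inner (Ψ Φ : FockSpace) :
    ⟪Ψ, Φ⟫_ℂ = ∑' n, ⟪component Ψ n, component Φ n⟫_ℂ :=
  lp.inner_eq_tsum Ψ Φ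

theorem exists_fockCLM (w : FockSpace → ∀ n, bosonSector n)
    (hadd : ∀ Ψ Φ n, w (Ψ + Φ) n = w Ψ n + w Φ n) (hsmul : ∀ (c : ℂ) Ψ n, w (c • Ψ) n = c • w Ψ n)
    {C : ℝ} (hC : 0 ≤ C) (hsum : ∀ Ψ, Summable fun n => ‖w Ψ n‖ ^ 2)
    (hle : ∀ Ψ, ∑' n, ‖w Ψ n‖ ^ 2 ≤ C ^ 2 * ‖Ψ‖ ^ 2) :
    ∃ B : FockSpace →L[ℂ] FockSpace, ‖B‖ ≤ C ∧ ∀ Ψ n, B Ψ n = w Ψ n := by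
  have hmem : ∀ Ψ, Memℓp (w Ψ) 2 := fun Ψ => memℓp_gen (by simpa using hsum Ψ)
  let L : FockSpace →ₗ[ℂ] FockSpace :=
    { toFun := fun Ψ => ⟨w Ψ, hmem Ψ⟩
      map_add' := fun Ψ Φ => lp.ext (funext fun n => hadd Ψ Φ n)
      map_smul' := fun c Ψ => lp.ext (funext fun n => hsmul c Ψ n) }
  have hL : ∀ Ψ, ‖L Ψ‖ ≤ C * ‖Ψ‖ := by
    intro Ψ
    refine abs_le_of_sq_le_sq' ?_ (by positivity) |>.2
    rw [mul_pow, fock_norm_sq (L Ψ)]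
    exact hle Ψ
  exact ⟨L.mkContinuous C hL, L.mkContinuous_norm_le hC _, fun Ψ n => rfl⟩

/-! ### Symmetric multiplication operators -/

/-- `B` multiplies the `n`-boson wave functions by `θ n`. -/
def IsFockMul (θ : ∀ n, (Fin n → R3) → ℂ) (B : FockSpace →L[ℂ] FockSpace) : Prop :=
  ∀ Ψ n, ∀ᵐ k, component (B Ψ) n k = θ n k * component Ψ n k

/-- Measurable symmetric multipliers that are bounded by `C`. -/
structure SymmMul (θ : ∀ n, (Fin n → R3) → ℂ) (C : ℝ) : Prop where
  meas : ∀ n, Measurable (θ n)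
  symm : ∀ n (σ : Equiv.Perm (Fin n)) k, θ n (k ∘ σ) = θ n k
  bound : ∀ n k, ‖θ n k‖ ≤ C

theorem SymmMul.exists {θ : ∀ n, (Fin n → R3) → ℂ} {C : ℝ} (h : SymmMul θ C) :
    ∃ B, ‖B‖ ≤ C ∧ IsFockMul θ B := by
  have hC : 0 ≤ C := (norm_nonneg _).trans (h.bound 0 0)
  have hm : ∀ Ψ n, MemLp (fun k => θ n k * component Ψ n k) 2 volume := fun Ψ n =>
    (Lp.memLp (component Ψ n)).of_le_mul (c := C)
      ((h.meas n).aestronglyMeasurable.mul (Lp.aestronglyMeasurable _))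
      (Filter.Eventually.of_forall fun k => by
        rw [norm_mul]
        exact mul_le_mul_of_nonneg_right (h.bound n k) (norm_nonneg _))
  have hs : ∀ Ψ n, (hm Ψ n).toLp _ ∈ bosonSector n := by
    intro Ψ n
    rw [mem_bosonSector_iff]
    intro σ
    have h1 := (measurePreserving_perm σ).quasiMeasurePreserving.ae (hm Ψ n).coeFn_toLp
    filter_upwards [h1, (hm Ψ n).coeFn_toLp, component_symm Ψ n σ] with k h1 h2 h3
    rw [h1, h2, h.symm, h3]
  have hn : ∀ Ψ n, ‖(⟨_, hs Ψ n⟩ : bosonSector n)‖ ^ 2 ≤ C ^ 2 * ‖Ψ n‖ ^ 2 := by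
    intro Ψ n
    rw [← mul_pow]
    refine pow_le_pow_left₀ (norm_nonneg _) ?_ 2
    change ‖(hm Ψ n).toLp _‖ ≤ C * ‖component Ψ n‖
    refine Lp.norm_le_mul_norm_of_ae_le_mul ?_
    filter_upwards [(hm Ψ n).coeFn_toLp] with k hk
    rw [hk, norm_mul]
    exact mul_le_mul_of_nonneg_right (h.bound n k) (norm_nonneg _)
  have hsum : ∀ Ψ, Summable fun n => ‖(⟨_, hs Ψ n⟩ : bosonSector n)‖ ^ 2 := fun Ψ =>
    Summable.of_nonneg_of_le (fun n => by positivity) (hn Ψ) ((fock_summable Ψ).mul_left _)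
  have hadd : ∀ Ψ Φ n, (⟨_, hs (Ψ + Φ) n⟩ : bosonSector n) = (⟨_, hs Ψ n⟩ : bosonSector n) + (⟨_, hs Φ n⟩ : bosonSector n) := by
    intro Ψ Φ n
    refine Subtype.ext (Lp.ext ?_)
    filter_upwards [(hm (Ψ + Φ) n).coeFn_toLp, (hm Ψ n).coeFn_toLp, (hm Φ n).coeFn_toLp,
      Lp.coeFn_add ((hm Ψ n).toLp _) ((hm Φ n).toLp _),
      Lp.coeFn_add (component Ψ n) (component Φ n)] with k h1 h2 h3 h4 h5
    rw [h1, component_add, h5]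
    refine Eq.trans ?_ h4.symm
    rw [Pi.add_apply, Pi.add_apply, h2, h3, mul_add]
  have hsmul : ∀ (c : ℂ) Ψ n, (⟨_, hs (c • Ψ) n⟩ : bosonSector n) = c • (⟨_, hs Ψ n⟩ : bosonSector n) := by
    intro c Ψ n
    refine Subtype.ext (Lp.ext ?_)
    filter_upwards [(hm (c • Ψ) n).coeFn_toLp, (hm Ψ n).coeFn_toLp,
      Lp.coeFn_smul c ((hm Ψ n).toLp _), Lp.coeFn_smul c (component Ψ n)] with k h1 h2 h4 h5
    rw [h1, component_smul, h5]
    refine Eq.trans ?_ h4.symm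
    rw [Pi.smul_apply, Pi.smul_apply, h2, smul_eq_mul, smul_eq_mul]
    ring
  have hle : ∀ Ψ, ∑' n, ‖(⟨_, hs Ψ n⟩ : bosonSector n)‖ ^ 2 ≤ C ^ 2 * ‖Ψ‖ ^ 2 := by
    intro Ψ
    rw [fock_norm_sq, ← tsum_mul_left]
    exact (hsum Ψ).tsum_le_tsum (hn Ψ) ((fock_summable Ψ).mul_left _)
  obtain ⟨B, hB, hB2⟩ := exists_fockCLM (fun Ψ n => ⟨_, hs Ψ n⟩) hadd hsmul hC hsum hle
  refine ⟨B, hB, fun Ψ n => ?_⟩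
  rw [component, hB2]
  exact (hm Ψ n).coeFn_toLp

/-- Uniqueness reduces operator identities to identities between multipliers; `IsCrea.unique` plays
the same role for kernels. -/
theorem IsFockMul.unique {θ : ∀ n, (Fin n → R3) → ℂ} {B B' : FockSpace →L[ℂ] FockSpace}
    (h : IsFockMul θ B) (h' : IsFockMul θ B') : B = B' := by
  ext1 Ψ
  refine component_ext fun n => Lp.ext ?_
  filter_upwards [h Ψ n, h' Ψ n] with k h1 h2
  rw [h1, h2]

/-- Multiplication of the `n`-boson wave functions by `θ n`. -/
def fockMul (θ : ∀ n, (Fin n → R3) → ℂ) : FockSpace →L[ℂ] FockSpace :=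
  Classical.epsilon (IsFockMul θ)

theorem SymmMul.isFockMul {θ : ∀ n, (Fin n → R3) → ℂ} {C : ℝ} (h : SymmMul θ C) :
    IsFockMul θ (fockMul θ) := by
  obtain ⟨B, -, hB⟩ := h.exists
  exact Classical.epsilon_spec ⟨B, hB⟩

theorem SymmMul.norm_le {θ : ∀ n, (Fin n → R3) → ℂ} {C : ℝ} (h : SymmMul θ C) :
    ‖fockMul θ‖ ≤ C := by
  obtain ⟨B, hB1, hB⟩ := h.exists
  rwa [h.isFockMul.unique hB]

theorem IsFockMul.comp {θ θ' : ∀ n, (Fin n → R3) → ℂ} {B B' : FockSpace →L[ℂ] FockSpace}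
    (h : IsFockMul θ B) (h' : IsFockMul θ' B') :
    IsFockMul (fun n k => θ n k * θ' n k) (B ∘L B') := by
  intro Ψ n
  filter_upwards [h (B' Ψ) n, h' Ψ n] with k h1 h2
  rw [ContinuousLinearMap.comp_apply, h1, h2, mul_assoc]

theorem IsFockMul.sub {θ θ' : ∀ n, (Fin n → R3) → ℂ} {B B' : FockSpace →L[ℂ] FockSpace}
    (h : IsFockMul θ B) (h' : IsFockMul θ' B') :
    IsFockMul (fun n k => θ n k - θ' n k) (B - B') := by
  intro Ψ n
  have e : component ((B - B') Ψ) n = component (B Ψ) n - component (B' Ψ) n := rfl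
  rw [e]
  filter_upwards [h Ψ n, h' Ψ n, Lp.coeFn_sub (component (B Ψ) n) (component (B' Ψ) n)]
    with k h1 h2 h3
  rw [h3, Pi.sub_apply, h1, h2, sub_mul]

theorem IsFockMul.smul {θ : ∀ n, (Fin n → R3) → ℂ} {B : FockSpace →L[ℂ] FockSpace}
    (h : IsFockMul θ B) (c : ℂ) : IsFockMul (fun n k => c * θ n k) (c • B) := by
  intro Ψ n
  have e : component ((c • B) Ψ) n = c • component (B Ψ) n := rfl
  rw [e]
  filter_upwards [h Ψ n, Lp.coeFn_smul c (component (B Ψ) n)] with k h1 h3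
  rw [h3, Pi.smul_apply, h1, smul_eq_mul, mul_assoc]

theorem isFockMul_one : IsFockMul (fun _ _ => 1) (ContinuousLinearMap.id ℂ FockSpace) := by
  intro Ψ n
  exact Filter.Eventually.of_forall fun k => (one_mul _).symm

theorem IsFockMul.inner_eq {θ : ∀ n, (Fin n → R3) → ℂ} {B B' : FockSpace →L[ℂ] FockSpace}
    (h : IsFockMul θ B) (h' : IsFockMul (fun n k => (starRingEnd ℂ) (θ n k)) B')
    (Ψ Φ : FockSpace) : ⟪B Ψ, Φ⟫_ℂ = ⟪Ψ, B' Φ⟫_ℂ := by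
  rw [fock_inner, fock_inner]
  refine tsum_congr fun n => ?_
  rw [L2.inner_def, L2.inner_def]
  refine integral_congr_ae ?_
  filter_upwards [h Ψ n, h' Φ n] with k h1 h2
  rw [h1, h2]
  simp only [RCLike.inner_apply, map_mul]
  ring

/-! ### Creation type operators -/

/-- The total energy `|k₁| + … + |kₙ|`. -/
def energy {n : ℕ} (k : Fin n → R3) : ℝ := ∑ i, ‖k i‖

theorem energy_nonneg {n : ℕ} (k : Fin n → R3) : 0 ≤ energy k :=
  Finset.sum_nonneg fun _ _ => norm_nonneg _

theorem measurable_energy {n : ℕ} : Measurable (energy : (Fin n → R3) → ℝ) := by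
  unfold energy
  fun_prop

theorem energy_comp {n : ℕ} (k : Fin n → R3) (σ : Equiv.Perm (Fin n)) :
    energy (k ∘ σ) = energy k :=
  Equiv.sum_comp σ fun i => ‖k i‖

theorem energy_succ {n : ℕ} (k : Fin (n + 1) → R3) (i : Fin (n + 1)) :
    energy k = ‖k i‖ + energy (i.removeNth k) :=
  Fin.sum_univ_succAbove (fun i => ‖k i‖) i

/-- `B` is the creation type operator with kernel `Θ`. -/
def IsCrea (Θ : ∀ n, (Fin (n + 1) → R3) → Fin (n + 1) → ℂ) (B : FockSpace →L[ℂ] FockSpace) :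
    Prop :=
  ∀ Ψ, component (B Ψ) 0 = 0 ∧ ∀ n, ∀ᵐ k, component (B Ψ) (n + 1) k =
    ((Real.sqrt (n + 1))⁻¹ : ℂ) * ∑ i, Θ n k i * component Ψ n (i.removeNth k)

/-- Equivariant kernels that are controlled by the integral of `g`. -/
structure KernelBound (Θ : ∀ n, (Fin (n + 1) → R3) → Fin (n + 1) → ℂ) (g : R3 → ℝ) : Prop where
  meas : ∀ n i, Measurable fun k => Θ n k i
  equivariant : ∀ n (σ : Equiv.Perm (Fin (n + 1))) k i, Θ n (k ∘ σ) i = Θ n k (σ i)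
  zero : ∀ n k i, k i = 0 → Θ n k i = 0
  nonneg : ∀ q, 0 ≤ g q
  integrable : Integrable g
  bound : ∀ n k i, ‖Θ n k i‖ ^ 2 * energy k ≤ ‖k i‖ * g (k i)

/-- Needed to see that an equivariant kernel sends symmetric functions to symmetric functions: the
leftover permutation τ is absorbed by the symmetry of the n-boson function. -/
theorem exists_perm_removeNth {n : ℕ} (σ : Equiv.Perm (Fin (n + 1))) (i : Fin (n + 1)) :
    ∃ τ : Equiv.Perm (Fin n), ∀ k : Fin (n + 1) → R3,
      i.removeNth (k ∘ σ) = ((σ i).removeNth k) ∘ τ := by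
  have h : ∀ j, ∃ l, (σ i).succAbove l = σ (i.succAbove j) := fun j =>
    Fin.exists_succAbove_eq fun h => Fin.succAbove_ne i j (σ.injective h)
  choose τ hτ using h
  have hinj : Function.Injective τ := by
    intro a b hab
    have := hτ a
    rw [hab, hτ b] at this
    exact Fin.succAbove_right_injective (σ.injective this.symm)
  refine ⟨Equiv.ofBijective τ (Finite.injective_iff_bijective.mp hinj), fun k => ?_⟩
  ext1 j
  change k (σ (i.succAbove j)) = k ((σ i).succAbove (τ j))
  rw [hτ]

theorem integrable_insert_mul {n : ℕ} (i : Fin (n + 1)) {g : R3 → ℝ} {v : (Fin n → R3) → ℝ}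
    (hg : Integrable g) (hv : Integrable v) :
    Integrable (fun k : Fin (n + 1) → R3 => g (k i) * v (i.removeNth k)) ∧
      ∫ k : Fin (n + 1) → R3, g (k i) * v (i.removeNth k) = (∫ q, g q) * ∫ k, v k := by
  have hmp := volume_preserving_piFinSuccAbove (fun _ : Fin (n + 1) => R3) i
  have hemb := (MeasurableEquiv.piFinSuccAbove (fun _ : Fin (n + 1) => R3) i).measurableEmbedding
  constructor
  · exact (hmp.integrable_comp_emb hemb).mpr (hg.mul_prod hv)
  · rw [← integral_prod_mul]
    exact hmp.integral_comp hemb fun z : R3 × (Fin n → R3) => g z.1 * v z.2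

/-- Cauchy-Schwarz with weights |k_i|: the factor Σ|k_i| is the total energy, and the kernel bound
trades it for |k_i|g(k_i). The vanishing of the kernel at k_i = 0 excludes division by zero. -/
theorem KernelBound.pointwise {Θ : ∀ n, (Fin (n + 1) → R3) → Fin (n + 1) → ℂ} {g : R3 → ℝ}
    (h : KernelBound Θ g) {n : ℕ} (k : Fin (n + 1) → R3) (v : Fin (n + 1) → ℂ) :
    ‖((Real.sqrt (n + 1))⁻¹ : ℂ) * ∑ i, Θ n k i * v i‖ ^ 2
      ≤ ((n : ℝ) + 1)⁻¹ * ∑ i, g (k i) * ‖v i‖ ^ 2 := by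
  have hn : (0 : ℝ) ≤ (n : ℝ) + 1 := by positivity
  have h1 : ‖((Real.sqrt (n + 1))⁻¹ : ℂ)‖ ^ 2 = ((n : ℝ) + 1)⁻¹ := by
    rw [norm_inv, Complex.norm_real, Real.norm_eq_abs, abs_of_nonneg (Real.sqrt_nonneg _), inv_pow,
      Real.sq_sqrt hn]
  rw [norm_mul, mul_pow, h1]
  gcongr
  calc ‖∑ i, Θ n k i * v i‖ ^ 2 ≤ (∑ i, ‖Θ n k i * v i‖) ^ 2 := by
        gcongr
        exact norm_sum_le _ _
    _ ≤ (∑ i, ‖Θ n k i * v i‖ ^ 2 / ‖k i‖) * ∑ i, ‖k i‖ := by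
        refine Finset.sum_sq_le_sum_mul_sum_of_sq_le_mul _ (fun i _ => by positivity)
          (fun i _ => norm_nonneg _) fun i _ => ?_
        by_cases hk : k i = 0
        · rw [h.zero n k i hk]
          simp
        · have : ‖k i‖ ≠ 0 := norm_ne_zero_iff.mpr hk
          rw [div_mul_cancel₀ _ this]
    _ ≤ ∑ i, g (k i) * ‖v i‖ ^ 2 := by
        rw [Finset.sum_mul]
        refine Finset.sum_le_sum fun i _ => ?_
        by_cases hk : k i = 0
        · rw [h.zero n k i hk]
          simp only [zero_mul, norm_zero]
          have := h.nonneg (k i)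
          rw [zero_pow two_ne_zero, zero_div, zero_mul]
          positivity
        · have hk' : 0 < ‖k i‖ := norm_pos_iff.mpr hk
          have h2 := h.bound n k i
          change _ * energy k ≤ _
          rw [norm_mul, mul_pow, div_mul_eq_mul_div, div_le_iff₀ hk']
          nlinarith [sq_nonneg ‖v i‖]

/-- Integrating the pointwise bound, each of the n + 1 summands contributes (∫g)‖Ψₙ‖² by Fubini, and
the prefactor 1/(n+1) cancels their number. -/
theorem KernelBound.exists {Θ : ∀ n, (Fin (n + 1) → R3) → Fin (n + 1) → ℂ} {g : R3 → ℝ}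
    (h : KernelBound Θ g) : ∃ B, ‖B‖ ≤ Real.sqrt (∫ q, g q) ∧ IsCrea Θ B := by
  have hg0 : 0 ≤ ∫ q, g q := integral_nonneg h.nonneg
  let W : FockSpace → ∀ n, (Fin (n + 1) → R3) → ℂ := fun Ψ n k =>
    ((Real.sqrt (n + 1))⁻¹ : ℂ) * ∑ i, Θ n k i * component Ψ n (i.removeNth k)
  have hWm : ∀ Ψ n, AEStronglyMeasurable (W Ψ n) volume := by
    intro Ψ n
    refine AEStronglyMeasurable.const_mul ?_ _
    refine Finset.aestronglyMeasurable_fun_sum _ fun i _ => ?_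
    exact (h.meas n i).aestronglyMeasurable.mul ((Lp.aestronglyMeasurable (component Ψ n)).comp_quasiMeasurePreserving
      (quasiMeasurePreserving_removeNth i))
  have hv : ∀ Ψ n, Integrable fun k => ‖component Ψ n k‖ ^ 2 := fun Ψ n =>
    (Lp.memLp (component Ψ n)).integrable_norm_pow (by norm_num)
  have hi : ∀ Ψ n, Integrable fun k : Fin (n + 1) → R3 =>
      ((n : ℝ) + 1)⁻¹ * ∑ i, g (k i) * ‖component Ψ n (i.removeNth k)‖ ^ 2 := fun Ψ n =>
    (integrable_finsetSum _ fun i _ =>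
      (integrable_insert_mul i h.integrable (hv Ψ n)).1).const_mul _
  have hWi : ∀ Ψ n, Integrable fun k => ‖W Ψ n k‖ ^ 2 := by
    intro Ψ n
    refine (hi Ψ n).mono' ((hWm Ψ n).norm.pow 2) (Filter.Eventually.of_forall fun k => ?_)
    rw [Real.norm_of_nonneg (by positivity)]
    exact h.pointwise k _
  have hW : ∀ Ψ n, MemLp (W Ψ n) 2 volume := fun Ψ n =>
    (memLp_two_iff_integrable_sq_norm (hWm Ψ n)).mpr (hWi Ψ n)
  have hs : ∀ Ψ n, (hW Ψ n).toLp _ ∈ bosonSector (n + 1) := by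
    intro Ψ n
    rw [mem_bosonSector_iff]
    intro σ
    have h1 := (measurePreserving_perm σ).quasiMeasurePreserving.ae (hW Ψ n).coeFn_toLp
    choose τ hτ using exists_perm_removeNth σ
    have h2 : ∀ᵐ k : Fin (n + 1) → R3, ∀ i, component Ψ n (((σ i).removeNth k) ∘ τ i)
        = component Ψ n ((σ i).removeNth k) :=
      ae_all_iff.mpr fun i => (quasiMeasurePreserving_removeNth (σ i)).ae
        (component_symm Ψ n (τ i))
    filter_upwards [h1, (hW Ψ n).coeFn_toLp, h2] with k h1 h2 h3
    rw [h1, h2]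
    change _ * _ = _ * _
    congr 1
    simp only [hτ, h3, h.equivariant]
    exact Equiv.sum_comp σ fun i => Θ n k i * component Ψ n (i.removeNth k)
  have hn : ∀ Ψ n, ‖(⟨_, hs Ψ n⟩ : bosonSector (n + 1))‖ ^ 2 ≤ (∫ q, g q) * ‖Ψ n‖ ^ 2 := by
    intro Ψ n
    change ‖(hW Ψ n).toLp _‖ ^ 2 ≤ (∫ q, g q) * ‖component Ψ n‖ ^ 2
    rw [norm_sq_eq_integral_Lp, norm_sq_eq_integral_Lp]
    calc ∫ k, ‖(hW Ψ n).toLp _ k‖ ^ 2 = ∫ k, ‖W Ψ n k‖ ^ 2 := by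
          refine integral_congr_ae ?_
          filter_upwards [(hW Ψ n).coeFn_toLp] with k hk
          rw [hk]
      _ ≤ ∫ k : Fin (n + 1) → R3,
          ((n : ℝ) + 1)⁻¹ * ∑ i, g (k i) * ‖component Ψ n (i.removeNth k)‖ ^ 2 :=
          integral_mono (hWi Ψ n) (hi Ψ n) fun k => h.pointwise k _
      _ = (∫ q, g q) * ∫ k, ‖component Ψ n k‖ ^ 2 := by
          rw [integral_const_mul, integral_finsetSum _ fun i _ =>
            (integrable_insert_mul i h.integrable (hv Ψ n)).1]
          simp only [fun i => (integrable_insert_mul i h.integrable (hv Ψ n)).2]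
          rw [Finset.sum_const, Finset.card_univ, Fintype.card_fin, nsmul_eq_mul]
          push_cast
          have : ((n : ℝ) + 1) ≠ 0 := by positivity
          field_simp
  -- The index is shifted by one: creation leaves no vacuum component.
  let w : FockSpace → ∀ n, bosonSector n := fun Ψ n =>
    match n with
    | 0 => 0
    | n + 1 => ⟨_, hs Ψ n⟩
  have hws : ∀ Ψ, Summable fun n => ‖w Ψ (n + 1)‖ ^ 2 := fun Ψ =>
    Summable.of_nonneg_of_le (fun n => by positivity) (hn Ψ) ((fock_summable Ψ).mul_left _)
  have hws' : ∀ Ψ, Summable fun n => ‖w Ψ n‖ ^ 2 := fun Ψ => (summable_nat_add_iff 1).mp (hws Ψ)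
  have hadd : ∀ Ψ Φ n, w (Ψ + Φ) n = w Ψ n + w Φ n := by
    intro Ψ Φ n
    cases n with
    | zero => exact (add_zero _).symm
    | succ n =>
      refine Subtype.ext (Lp.ext ?_)
      have ha : ∀ᵐ k : Fin (n + 1) → R3, ∀ i : Fin (n + 1),
          component (Ψ + Φ) n (i.removeNth k) =
            component Ψ n (i.removeNth k) + component Φ n (i.removeNth k) :=
        ae_all_iff.mpr fun i => (quasiMeasurePreserving_removeNth i).ae
          (Lp.coeFn_add (component Ψ n) (component Φ n))
      filter_upwards [(hW (Ψ + Φ) n).coeFn_toLp, (hW Ψ n).coeFn_toLp, (hW Φ n).coeFn_toLp,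
        Lp.coeFn_add ((hW Ψ n).toLp _) ((hW Φ n).toLp _), ha] with k h1 h2 h3 h4 h5
      refine h1.trans (Eq.trans ?_ h4.symm)
      rw [Pi.add_apply, h2, h3]
      simp only [W, h5, mul_add, Finset.sum_add_distrib]
  have hsmul : ∀ (c : ℂ) Ψ n, w (c • Ψ) n = c • w Ψ n := by
    intro c Ψ n
    cases n with
    | zero => exact (smul_zero _).symm
    | succ n =>
      refine Subtype.ext (Lp.ext ?_)
      have ha : ∀ᵐ k : Fin (n + 1) → R3, ∀ i : Fin (n + 1),
          component (c • Ψ) n (i.removeNth k) = c * component Ψ n (i.removeNth k) :=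
        ae_all_iff.mpr fun i => (quasiMeasurePreserving_removeNth i).ae
          (Lp.coeFn_smul c (component Ψ n))
      filter_upwards [(hW (c • Ψ) n).coeFn_toLp, (hW Ψ n).coeFn_toLp,
        Lp.coeFn_smul c ((hW Ψ n).toLp _), ha] with k h1 h2 h4 h5
      refine h1.trans (Eq.trans ?_ h4.symm)
      rw [Pi.smul_apply, h2, smul_eq_mul]
      simp only [W, h5, mul_left_comm _ c, ← Finset.mul_sum]
  have hle : ∀ Ψ, ∑' n, ‖w Ψ n‖ ^ 2 ≤ Real.sqrt (∫ q, g q) ^ 2 * ‖Ψ‖ ^ 2 := by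
    intro Ψ
    rw [Real.sq_sqrt hg0, fock_norm_sq, ← tsum_mul_left, (hws' Ψ).tsum_eq_zero_add]
    have h0 : ‖w Ψ 0‖ ^ 2 = 0 := by simp [w]
    rw [h0, zero_add]
    exact (hws Ψ).tsum_le_tsum (hn Ψ) ((fock_summable Ψ).mul_left _)
  obtain ⟨B, hB, hB2⟩ := exists_fockCLM w hadd hsmul (Real.sqrt_nonneg (∫ q, g q)) hws' hle
  refine ⟨B, hB, fun Ψ => ⟨?_, fun n => ?_⟩⟩
  · rw [component, hB2]
    rfl
  · rw [component, hB2]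
    exact (hW Ψ n).coeFn_toLp

theorem IsCrea.unique {Θ : ∀ n, (Fin (n + 1) → R3) → Fin (n + 1) → ℂ}
    {B B' : FockSpace →L[ℂ] FockSpace} (h : IsCrea Θ B) (h' : IsCrea Θ B') : B = B' := by
  ext1 Ψ
  refine component_ext fun n => ?_
  cases n with
  | zero => rw [(h Ψ).1, (h' Ψ).1]
  | succ n =>
    refine Lp.ext ?_
    filter_upwards [(h Ψ).2 n, (h' Ψ).2 n] with k h1 h2
    rw [h1, h2]

/-- The creation type operator with kernel `Θ`. -/
def crea (Θ : ∀ n, (Fin (n + 1) → R3) → Fin (n + 1) → ℂ) : FockSpace →L[ℂ] FockSpace :=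
  Classical.epsilon (IsCrea Θ)

theorem KernelBound.isCrea {Θ : ∀ n, (Fin (n + 1) → R3) → Fin (n + 1) → ℂ} {g : R3 → ℝ}
    (h : KernelBound Θ g) : IsCrea Θ (crea Θ) := by
  obtain ⟨B, -, hB⟩ := h.exists
  exact Classical.epsilon_spec ⟨B, hB⟩

theorem KernelBound.norm_le {Θ : ∀ n, (Fin (n + 1) → R3) → Fin (n + 1) → ℂ} {g : R3 → ℝ}
    (h : KernelBound Θ g) : ‖crea Θ‖ ≤ Real.sqrt (∫ q, g q) := by
  obtain ⟨B, hB1, hB⟩ := h.exists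
  rwa [h.isCrea.unique hB]

theorem IsCrea.sub {Θ Θ' : ∀ n, (Fin (n + 1) → R3) → Fin (n + 1) → ℂ}
    {B B' : FockSpace →L[ℂ] FockSpace} (h : IsCrea Θ B) (h' : IsCrea Θ' B') :
    IsCrea (fun n k i => Θ n k i - Θ' n k i) (B - B') := by
  intro Ψ
  have e : ∀ n, component ((B - B') Ψ) n = component (B Ψ) n - component (B' Ψ) n := fun n => rfl
  refine ⟨by rw [e, (h Ψ).1, (h' Ψ).1, sub_zero], fun n => ?_⟩
  rw [e]
  filter_upwards [(h Ψ).2 n, (h' Ψ).2 n,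
    Lp.coeFn_sub (component (B Ψ) (n + 1)) (component (B' Ψ) (n + 1))] with k h1 h2 h3
  rw [h3, Pi.sub_apply, h1, h2, ← mul_sub, ← Finset.sum_sub_distrib]
  simp only [sub_mul]

theorem IsCrea.smul {Θ : ∀ n, (Fin (n + 1) → R3) → Fin (n + 1) → ℂ}
    {B : FockSpace →L[ℂ] FockSpace} (h : IsCrea Θ B) (c : ℂ) :
    IsCrea (fun n k i => c * Θ n k i) (c • B) := by
  intro Ψ
  have e : ∀ n, component ((c • B) Ψ) n = c • component (B Ψ) n := fun n => rfl
  refine ⟨by rw [e, (h Ψ).1, smul_zero], fun n => ?_⟩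
  rw [e]
  filter_upwards [(h Ψ).2 n, Lp.coeFn_smul c (component (B Ψ) (n + 1))] with k h1 h3
  rw [h3, Pi.smul_apply, h1, smul_eq_mul, mul_left_comm, Finset.mul_sum]
  simp only [mul_assoc]

theorem IsFockMul.comp_crea {θ : ∀ n, (Fin n → R3) → ℂ}
    {Θ : ∀ n, (Fin (n + 1) → R3) → Fin (n + 1) → ℂ} {B B' : FockSpace →L[ℂ] FockSpace}
    (h : IsFockMul θ B) (h' : IsCrea Θ B') :
    IsCrea (fun n k i => θ (n + 1) k * Θ n k i) (B ∘L B') := by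
  intro Ψ
  constructor
  · refine Lp.ext ?_
    filter_upwards [h (B' Ψ) 0, Lp.coeFn_zero ℂ 2 (volume : Measure (Fin 0 → R3))] with k h1 h2
    rw [ContinuousLinearMap.comp_apply, h1, (h' Ψ).1, h2, Pi.zero_apply, mul_zero]
  · intro n
    filter_upwards [h (B' Ψ) (n + 1), (h' Ψ).2 n] with k h1 h2
    rw [ContinuousLinearMap.comp_apply, h1, h2, mul_left_comm, Finset.mul_sum]
    simp only [mul_assoc]

theorem IsCrea.comp_fockMul {θ : ∀ n, (Fin n → R3) → ℂ}
    {Θ : ∀ n, (Fin (n + 1) → R3) → Fin (n + 1) → ℂ} {B B' : FockSpace →L[ℂ] FockSpace}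
    (h : IsCrea Θ B) (h' : IsFockMul θ B') :
    IsCrea (fun n k i => Θ n k i * θ n (i.removeNth k)) (B ∘L B') := by
  intro Ψ
  refine ⟨(h (B' Ψ)).1, fun n => ?_⟩
  have h2 : ∀ᵐ k : Fin (n + 1) → R3, ∀ i : Fin (n + 1), component (B' Ψ) n (i.removeNth k)
      = θ n (i.removeNth k) * component Ψ n (i.removeNth k) :=
    ae_all_iff.mpr fun i => (quasiMeasurePreserving_removeNth i).ae (h' Ψ n)
  filter_upwards [(h (B' Ψ)).2 n, h2] with k h1 h2
  rw [ContinuousLinearMap.comp_apply, h1]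
  simp only [h2, mul_assoc]

end FockOperators

section FockGraphs

/-! ### Functions of the field energy -/

/-- Measurable functions that are bounded on `[0, ∞)`. -/
def BddEnergyFun (φ : ℝ → ℝ) (C : ℝ) : Prop := Measurable φ ∧ ∀ E, 0 ≤ E → |φ E| ≤ C

/-- The function `φ(H_f)` of the field energy. -/
def eMul (φ : ℝ → ℝ) : FockSpace →L[ℂ] FockSpace := fockMul fun _ k => (φ (energy k) : ℂ)

theorem BddEnergyFun.symmMul {φ : ℝ → ℝ} {C : ℝ} (h : BddEnergyFun φ C) :
    SymmMul (fun _ k => (φ (energy k) : ℂ)) C where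
  meas _ := Complex.measurable_ofReal.comp (h.1.comp measurable_energy)
  symm n σ k := by rw [energy_comp]
  bound n k := by
    rw [Complex.norm_real]
    exact h.2 _ (energy_nonneg k)

theorem BddEnergyFun.isFockMul {φ : ℝ → ℝ} {C : ℝ} (h : BddEnergyFun φ C) :
    IsFockMul (fun _ k => (φ (energy k) : ℂ)) (eMul φ) := h.symmMul.isFockMul

theorem BddEnergyFun.norm_le {φ : ℝ → ℝ} {C : ℝ} (h : BddEnergyFun φ C) : ‖eMul φ‖ ≤ C :=
  h.symmMul.norm_le

theorem IsFockMul.congr {θ θ' : ∀ n, (Fin n → R3) → ℂ} {B : FockSpace →L[ℂ] FockSpace}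
    (h : IsFockMul θ B) (e : ∀ n k, θ n k = θ' n k) : IsFockMul θ' B := by
  have : θ = θ' := funext fun n => funext fun k => e n k
  rwa [← this]

theorem IsCrea.congr {Θ Θ' : ∀ n, (Fin (n + 1) → R3) → Fin (n + 1) → ℂ}
    {B : FockSpace →L[ℂ] FockSpace} (h : IsCrea Θ B) (e : ∀ n k i, Θ n k i = Θ' n k i) :
    IsCrea Θ' B := by
  have : Θ = Θ' := funext fun n => funext fun k => funext fun i => e n k i
  rwa [← this]

theorem eMul_inner {φ : ℝ → ℝ} {C : ℝ} (h : BddEnergyFun φ C) (Ψ Φ : FockSpace) :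
    ⟪eMul φ Ψ, Φ⟫_ℂ = ⟪Ψ, eMul φ Φ⟫_ℂ :=
  h.isFockMul.inner_eq (h.isFockMul.congr fun _ _ => (Complex.conj_ofReal _).symm) Ψ Φ

theorem adjoint_eMul {φ : ℝ → ℝ} {C : ℝ} (h : BddEnergyFun φ C) :
    ContinuousLinearMap.adjoint (eMul φ) = eMul φ :=
  ((ContinuousLinearMap.eq_adjoint_iff _ _).mpr (eMul_inner h)).symm

/-- The resolvent `(H_f + t)⁻¹`. -/
def fieldResolvent (t : ℝ) : FockSpace →L[ℂ] FockSpace := eMul fun E => (E + t)⁻¹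

/-- The operator `(H_f + s)^{-1/2}`. -/
def fieldInvSqrt (s : ℝ) : FockSpace →L[ℂ] FockSpace := eMul fun E => (E + s) ^ (-(1 / 2) : ℝ)

theorem bdd_fieldResolvent {t : ℝ} (ht : 0 < t) : BddEnergyFun (fun E => (E + t)⁻¹) t⁻¹ := by
  refine ⟨by fun_prop, fun E hE => ?_⟩
  rw [abs_of_nonneg (by positivity)]
  exact inv_anti₀ ht (by linarith)

theorem bdd_fieldInvSqrt {s : ℝ} (hs : 0 < s) :
    BddEnergyFun (fun E => (E + s) ^ (-(1 / 2) : ℝ)) (s ^ (-(1 / 2) : ℝ)) := by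
  refine ⟨by fun_prop, fun E hE => ?_⟩
  rw [abs_of_nonneg (by positivity)]
  exact Real.rpow_le_rpow_of_nonpos hs (by linarith) (by norm_num)

theorem isResolventFamily_field : IsResolventFamily fieldResolvent where
  norm_le t ht := (bdd_fieldResolvent ht).norm_le
  resolvent s t hs ht := by
    refine IsFockMul.unique ((bdd_fieldResolvent hs).isFockMul.sub
      (bdd_fieldResolvent ht).isFockMul) ?_
    refine (((bdd_fieldResolvent hs).isFockMul.comp (bdd_fieldResolvent ht).isFockMul).smul
      _).congr fun n k => ?_
    have hE := energy_nonneg k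
    have h1 : energy k + s ≠ 0 := by positivity
    have h2 : energy k + t ≠ 0 := by positivity
    rw [← Complex.ofReal_sub, ← Complex.ofReal_mul, ← Complex.ofReal_mul]
    congr 1
    field_simp
    ring

theorem fieldInvSqrt_sq {s : ℝ} (hs : 0 < s) :
    fieldInvSqrt s ∘L fieldInvSqrt s = fieldResolvent s := by
  refine IsFockMul.unique (((bdd_fieldInvSqrt hs).isFockMul.comp
    (bdd_fieldInvSqrt hs).isFockMul).congr fun n k => ?_) (bdd_fieldResolvent hs).isFockMul
  have hE := energy_nonneg k
  rw [← Complex.ofReal_mul, ← Real.rpow_add (by positivity)]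
  congr 1
  rw [← Real.rpow_neg_one]
  norm_num

theorem mem_fieldEnergy_iff {u v : FockSpace} : (u, v) ∈ fieldEnergy.graph ↔
    ∀ n, ∀ᵐ k, component v n k = (energy k : ℂ) * component u n k := by
  rw [fieldEnergy_graph]
  rfl

theorem fieldResolvent_mem {s : ℝ} (hs : 0 < s) (u : FockSpace) :
    (fieldResolvent s u, u - (s : ℂ) • fieldResolvent s u) ∈ fieldEnergy.graph := by
  rw [mem_fieldEnergy_iff]
  intro n
  have e : component (u - (s : ℂ) • fieldResolvent s u) n
    = component u n - (s : ℂ) • component (fieldResolvent s u) n := rfl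
  rw [e]
  filter_upwards [(bdd_fieldResolvent hs).isFockMul u n,
    Lp.coeFn_sub (component u n) ((s : ℂ) • component (fieldResolvent s u) n),
    Lp.coeFn_smul (s : ℂ) (component (fieldResolvent s u) n)] with k h1 h2 h3
  rw [h2, Pi.sub_apply, h3, Pi.smul_apply, fieldResolvent, h1, smul_eq_mul]
  have hE := energy_nonneg k
  have h4 : (energy k : ℂ) + s ≠ 0 := by
    rw [← Complex.ofReal_add]
    exact_mod_cast (by positivity : energy k + s ≠ 0)
  push_cast
  field_simp
  ring

theorem fieldResolvent_of_mem {s : ℝ} (hs : 0 < s) {u v : FockSpace}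
    (h : (u, v) ∈ fieldEnergy.graph) : fieldResolvent s (v + (s : ℂ) • u) = u := by
  rw [mem_fieldEnergy_iff] at h
  refine component_ext fun n => Lp.ext ?_
  have e : component (v + (s : ℂ) • u) n = component v n + (s : ℂ) • component u n := rfl
  filter_upwards [(bdd_fieldResolvent hs).isFockMul (v + (s : ℂ) • u) n, h n,
    Lp.coeFn_add (component v n) ((s : ℂ) • component u n),
    Lp.coeFn_smul (s : ℂ) (component u n)] with k h1 h2 h3 h4
  rw [e, h3, Pi.add_apply, h4, Pi.smul_apply, h2, smul_eq_mul] at h1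
  rw [fieldResolvent, h1]
  have hE := energy_nonneg k
  have h5 : (energy k : ℂ) + s ≠ 0 := by
    rw [← Complex.ofReal_add]
    exact_mod_cast (by positivity : energy k + s ≠ 0)
  push_cast
  field_simp

theorem fieldEnergy_symm : AdjointPair fieldEnergy fieldEnergy := by
  intro x y hxy u v huv
  rw [mem_fieldEnergy_iff] at hxy huv
  rw [fock_inner, fock_inner]
  refine tsum_congr fun n => ?_
  rw [L2.inner_def, L2.inner_def]
  refine integral_congr_ae ?_
  filter_upwards [hxy n, huv n] with k h1 h2
  rw [h1, h2]
  simp only [RCLike.inner_apply, map_mul, Complex.conj_ofReal]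
  ring

/-! ### Creation and annihilation operators -/

/-- Form factors supported in a ball of radius `L` with `∫ |f|² / |k| < ∞`. -/
structure Adm (f : R3 → ℂ) (L : ℝ) : Prop where
  meas : Measurable f
  zero : f 0 = 0
  supp : ∀ k, L < ‖k‖ → f k = 0
  integrable : Integrable fun k => ‖f k‖ ^ 2 / ‖k‖

/-- The norm of `f / √|k|` in `L²`. -/
def wnorm (f : R3 → ℂ) : ℝ := Real.sqrt (∫ k, ‖f k‖ ^ 2 / ‖k‖)

/-- All form factors, their differences and their derivatives in the position are controlled by a
single reference function through this comparison. -/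
theorem Adm.of_le {f h : R3 → ℂ} {L D : ℝ} (hh : Adm h L) (hf : Measurable f) (hD : 0 ≤ D)
    (hle : ∀ k, ‖f k‖ ≤ D * ‖h k‖) : Adm f L ∧ wnorm f ≤ D * wnorm h := by
  have hz : ∀ k, h k = 0 → f k = 0 := by
    intro k hk
    have := hle k
    rw [hk, norm_zero, mul_zero] at this
    exact norm_le_zero_iff.mp this
  have hle2 : ∀ k, ‖f k‖ ^ 2 / ‖k‖ ≤ D ^ 2 * (‖h k‖ ^ 2 / ‖k‖) := by
    intro k
    rw [← mul_div_assoc, ← mul_pow]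
    gcongr
    exact hle k
  have hi : Integrable fun k => ‖f k‖ ^ 2 / ‖k‖ := by
    refine (hh.integrable.const_mul (D ^ 2)).mono' ?_ (Filter.Eventually.of_forall fun k => ?_)
    · exact ((hf.norm.pow_const 2).div measurable_norm).aestronglyMeasurable
    · rw [Real.norm_of_nonneg (by positivity)]
      exact hle2 k
  refine ⟨⟨hf, hz _ hh.zero, fun k hk => hz _ (hh.supp k hk), hi⟩, ?_⟩
  rw [wnorm, wnorm, ← Real.sqrt_sq hD, ← Real.sqrt_mul (by positivity), ← integral_const_mul]
  exact Real.sqrt_le_sqrt (integral_mono hi (hh.integrable.const_mul _) hle2)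

/-- The kernel of `(H_f + s)^p a*(f) (H_f + s)^{-1/2-p}`. -/
def crKernel (s p : ℝ) (f : R3 → ℂ) (n : ℕ) (k : Fin (n + 1) → R3) (i : Fin (n + 1)) : ℂ :=
  f (k i) * (((energy k + s) ^ p * (energy k - ‖k i‖ + s) ^ (-(1 / 2) - p) : ℝ) : ℂ)

/-- The bounded operator `(H_f + s)^p a*(f) (H_f + s)^{-1/2-p}`. -/
def cr (s p : ℝ) (f : R3 → ℂ) : FockSpace →L[ℂ] FockSpace := crea (crKernel s p f)

theorem energy_sub {n : ℕ} (k : Fin (n + 1) → R3) (i : Fin (n + 1)) :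
    energy k - ‖k i‖ = energy (i.removeNth k) := by
  rw [energy_succ k i]
  ring

/-- Let E be the total energy and E' = E - |k_i|. The weights squared, times E, are at most
((E+s)/(E'+s))^(2p+1). On the support of f the ratio lies between 1 and 1 + L/s, and 2p + 1 ≤ 2. -/
theorem Adm.kernelBound {f : R3 → ℂ} {L s p : ℝ} (hf : Adm f L) (hs : 0 < s) (hL : 0 ≤ L)
    (_hp : -1 ≤ p) (hp' : p ≤ 1 / 2) :
    KernelBound (crKernel s p f) fun q => (1 + L / s) ^ 2 * (‖f q‖ ^ 2 / ‖q‖) where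
  meas n i := by
    have h1 : Measurable fun k : Fin (n + 1) → R3 => f (k i) := hf.meas.comp (measurable_pi_apply i)
    have h2 : Measurable (energy : (Fin (n + 1) → R3) → ℝ) := measurable_energy
    unfold crKernel
    refine h1.mul (Complex.measurable_ofReal.comp ?_)
    fun_prop
  equivariant n σ k i := by
    unfold crKernel
    rw [energy_comp]
    rfl
  zero n k i h := by
    unfold crKernel
    rw [h, hf.zero, zero_mul]
  nonneg q := by positivity
  integrable := hf.integrable.const_mul _
  bound n k i := by
    by_cases hk : f (k i) = 0
    · unfold crKernel
      simp [hk]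
    · have hkL : ‖k i‖ ≤ L := by
        by_contra! h
        exact hk (hf.supp _ h)
      have hk0 : ‖k i‖ ≠ 0 := by
        intro h
        rw [norm_eq_zero.mp h] at hk
        exact hk hf.zero
      have hE' : 0 ≤ energy k - ‖k i‖ := by
        rw [energy_sub]
        exact energy_nonneg _
      set E' := energy k - ‖k i‖ with hE'def
      have hE : energy k = E' + ‖k i‖ := by rw [hE'def]; ring
      have ha : 0 < energy k + s := by have := energy_nonneg k; positivity
      have hb : 0 < E' + s := by positivity
      have hr1 : 1 ≤ (energy k + s) / (E' + s) := by
        rw [one_le_div hb, hE]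
        linarith [norm_nonneg (k i)]
      have hr2 : (energy k + s) / (E' + s) ≤ 1 + L / s := by
        rw [div_le_iff₀ hb]
        have h1 : L ≤ L / s * (E' + s) := by
          rw [mul_add, div_mul_cancel₀ _ hs.ne']
          have : 0 ≤ L / s * E' := by positivity
          linarith
        have h2 : (1 + L / s) * (E' + s) = E' + s + L / s * (E' + s) := by ring
        rw [h2, hE]
        linarith
      have key : ((energy k + s) ^ p * (E' + s) ^ (-(1 / 2) - p)) ^ 2 * energy k
          ≤ (1 + L / s) ^ 2 := by
        calc ((energy k + s) ^ p * (E' + s) ^ (-(1 / 2) - p)) ^ 2 * energy k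
            ≤ ((energy k + s) ^ p * (E' + s) ^ (-(1 / 2) - p)) ^ 2 * (energy k + s) := by
              gcongr
              linarith
          _ = ((energy k + s) / (E' + s)) ^ (2 * p + 1) := by
              have e1 : ((energy k + s) ^ p) ^ 2 = (energy k + s) ^ (2 * p) := by
                rw [mul_comm, Real.rpow_mul ha.le, Real.rpow_two]
              have e2 : ((E' + s) ^ (-(1 / 2) - p)) ^ 2 = ((E' + s) ^ (2 * p + 1))⁻¹ := by
                rw [← Real.rpow_neg hb.le, ← Real.rpow_two, ← Real.rpow_mul hb.le]
                congr 1
                ring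
              rw [Real.div_rpow ha.le hb.le, mul_pow, e1, e2, Real.rpow_add ha, Real.rpow_one]
              ring
          _ ≤ ((energy k + s) / (E' + s)) ^ (2 : ℝ) :=
              Real.rpow_le_rpow_of_exponent_le hr1 (by linarith)
          _ ≤ (1 + L / s) ^ 2 := by
              rw [Real.rpow_two]
              gcongr
      unfold crKernel
      rw [norm_mul, mul_pow, Complex.norm_real, Real.norm_eq_abs, sq_abs, ← hE'def]
      calc ‖f (k i)‖ ^ 2 * ((energy k + s) ^ p * (E' + s) ^ (-(1 / 2) - p)) ^ 2 * energy k
          = ‖f (k i)‖ ^ 2 * (((energy k + s) ^ p * (E' + s) ^ (-(1 / 2) - p)) ^ 2 * energy k) := by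
            ring
        _ ≤ ‖f (k i)‖ ^ 2 * (1 + L / s) ^ 2 := by gcongr
        _ = ‖k i‖ * ((1 + L / s) ^ 2 * (‖f (k i)‖ ^ 2 / ‖k i‖)) := by field_simp

theorem Adm.isCrea {f : R3 → ℂ} {L s p : ℝ} (hf : Adm f L) (hs : 0 < s) (hL : 0 ≤ L)
    (hp : -1 ≤ p) (hp' : p ≤ 1 / 2) : IsCrea (crKernel s p f) (cr s p f) :=
  (hf.kernelBound hs hL hp hp').isCrea

/-- The factor 1 + L/s tends to one as s → ∞, so commuting powers of the field energy past a*(f)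
costs nothing in the limiting relative bound. -/
theorem Adm.norm_cr_le {f : R3 → ℂ} {L s p : ℝ} (hf : Adm f L) (hs : 0 < s) (hL : 0 ≤ L)
    (hp : -1 ≤ p) (hp' : p ≤ 1 / 2) : ‖cr s p f‖ ≤ (1 + L / s) * wnorm f := by
  refine (hf.kernelBound hs hL hp hp').norm_le.trans ?_
  rw [integral_const_mul, Real.sqrt_mul (by positivity), Real.sqrt_sq (by positivity), wnorm]

/-- Linearity in the form factor. The three-term combination covers continuity (c = 0) as well as
the first-order Taylor remainder. -/
theorem Adm.norm_cr_sub_le {f₁ f₂ f₃ h : R3 → ℂ} {L s p D : ℝ} {c : ℂ} (h₁ : Adm f₁ L)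
    (h₂ : Adm f₂ L) (h₃ : Adm f₃ L) (hh : Adm h L) (hs : 0 < s) (hL : 0 ≤ L)
    (hp : -1 ≤ p) (hp' : p ≤ 1 / 2) (hD : 0 ≤ D)
    (hle : ∀ k, ‖f₁ k - f₂ k - c * f₃ k‖ ≤ D * ‖h k‖) :
    ‖cr s p f₁ - cr s p f₂ - c • cr s p f₃‖ ≤ D * ((1 + L / s) * wnorm h) := by
  have hm : Measurable fun k => f₁ k - f₂ k - c * f₃ k :=
    (h₁.meas.sub h₂.meas).sub (h₃.meas.const_mul c)
  obtain ⟨ha, hw⟩ := hh.of_le hm hD hle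
  have e : cr s p f₁ - cr s p f₂ - c • cr s p f₃ = cr s p fun k => f₁ k - f₂ k - c * f₃ k := by
    refine IsCrea.unique ((((h₁.isCrea hs hL hp hp').sub (h₂.isCrea hs hL hp hp')).sub
      ((h₃.isCrea hs hL hp hp').smul c)).congr fun n k i => ?_) (ha.isCrea hs hL hp hp')
    unfold crKernel
    ring
  rw [e]
  refine (ha.norm_cr_le hs hL hp hp').trans ?_
  rw [mul_left_comm]
  have : 0 ≤ L / s := by positivity
  gcongr

theorem mem_creation_iff {f : R3 → ℂ} {u v : FockSpace} : (u, v) ∈ (creation f).graph ↔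
    component v 0 = 0 ∧ ∀ n : ℕ, ∀ᵐ k : Fin (n + 1) → R3, component v (n + 1) k =
      ((Real.sqrt (n + 1))⁻¹ : ℂ) * ∑ i, f (k i) * component u n (i.removeNth k) := by
  rw [creation_graph]
  rfl

theorem ae_removeNth {n : ℕ} {P : (Fin n → R3) → Prop} (h : ∀ᵐ k, P k) :
    ∀ᵐ k : Fin (n + 1) → R3, ∀ i : Fin (n + 1), P (i.removeNth k) :=
  ae_all_iff.mpr fun i => (quasiMeasurePreserving_removeNth i).ae h

/-! ### Creation operators expressed through bounded weighted operators. -/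

section

variable {f : R3 → ℂ} {L s : ℝ} (hf : Adm f L) (hs : 0 < s) (hL : 0 ≤ L)
include hf hs hL

/-- For p = 0 the weighted operator is a*(f)(H_f+s)^(-1/2), with no weight on the left. -/
theorem cr_mem_creation (u : FockSpace) :
    (fieldInvSqrt s u, cr s 0 f u) ∈ (creation f).graph := by
  have h := hf.isCrea (p := 0) hs hL (by norm_num) (by norm_num) u
  refine mem_creation_iff.mpr ⟨h.1, fun n => ?_⟩
  filter_upwards [h.2 n, ae_removeNth ((bdd_fieldInvSqrt hs).isFockMul u n)] with k h1 h2
  rw [h1]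
  congr 1
  refine Finset.sum_congr rfl fun i _ => ?_
  rw [fieldInvSqrt, h2, crKernel, energy_sub, Real.rpow_zero, one_mul, sub_zero, mul_assoc]

/-- For p = -1/2 the weight on the right is trivial. -/
theorem fieldInvSqrt_creation {v z : FockSpace} (h : (v, z) ∈ (creation f).graph) :
    fieldInvSqrt s z = cr s (-(1 / 2)) f v := by
  rw [mem_creation_iff] at h
  have hc := hf.isCrea (p := -(1 / 2)) hs hL (by norm_num) (by norm_num) v
  refine component_ext fun n => Lp.ext ?_
  cases n with
  | zero =>
    filter_upwards [(bdd_fieldInvSqrt hs).isFockMul z 0,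
      Lp.coeFn_zero ℂ 2 (volume : Measure (Fin 0 → R3))] with k h1 h2
    rw [fieldInvSqrt, h1, hc.1, h.1, h2, Pi.zero_apply, mul_zero]
  | succ n =>
    filter_upwards [(bdd_fieldInvSqrt hs).isFockMul z (n + 1), h.2 n, hc.2 n] with k h1 h2 h3
    rw [fieldInvSqrt, h1, h2, h3, mul_left_comm, Finset.mul_sum]
    congr 1
    refine Finset.sum_congr rfl fun i _ => ?_
    rw [crKernel, sub_self, Real.rpow_zero, mul_one]
    ring

/-- Moving a half power from the left to the right lowers p by 1/2. Two successive field operators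
are handled by this rule. -/
theorem fieldInvSqrt_comp_cr {p : ℝ} (hp : -(1 / 2) ≤ p) (hp' : p ≤ 1 / 2) :
    fieldInvSqrt s ∘L cr s p f = cr s (p - 1 / 2) f ∘L fieldInvSqrt s := by
  refine IsCrea.unique ((bdd_fieldInvSqrt hs).isFockMul.comp_crea
    (hf.isCrea hs hL (by linarith) hp')) (((hf.isCrea hs hL (by linarith)
    (by linarith)).comp_fockMul (bdd_fieldInvSqrt hs).isFockMul).congr fun n k i => ?_)
  have hE := energy_nonneg k
  have hE' := energy_nonneg (i.removeNth k)
  unfold crKernel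
  rw [energy_sub, show p - 1 / 2 = -(1 / 2) + p by ring, Real.rpow_add (by positivity),
    show -(1 / 2) - (-(1 / 2) + p) = -p by ring, show -(1 / 2) - p = -(1 / 2) + -p by ring,
    Real.rpow_add (by positivity)]
  push_cast
  ring

/-- A symmetric bounded operator has dense range as soon as it is injective, and the multiplier
(E+s)^(-1/2) never vanishes. -/
theorem dense_range_fieldInvSqrt : Dense (Set.range (fieldInvSqrt s)) := by
  have h1 : ((fieldInvSqrt s : FockSpace →ₗ[ℂ] FockSpace).range)ᗮ = ⊥ := by
    rw [Submodule.eq_bot_iff]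
    intro x hx
    rw [Submodule.mem_orthogonal] at hx
    have h2 : fieldInvSqrt s x = 0 := by
      have := hx (fieldInvSqrt s (fieldInvSqrt s x)) ⟨_, rfl⟩
      have h3 : ⟪fieldInvSqrt s (fieldInvSqrt s x), x⟫_ℂ
          = ⟪fieldInvSqrt s x, fieldInvSqrt s x⟫_ℂ := eMul_inner (bdd_fieldInvSqrt hs) _ _
      rw [h3] at this
      exact inner_self_eq_zero.mp this
    refine component_ext fun n => Lp.ext ?_
    filter_upwards [(bdd_fieldInvSqrt hs).isFockMul x n,
      Lp.coeFn_zero ℂ 2 (volume : Measure (Fin n → R3))] with k h3 h4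
    change component (fieldInvSqrt s x) n k = _ at h3
    rw [h2, component_zero, h4] at h3
    have hE := energy_nonneg k
    have h5 : (((energy k + s) ^ (-(1 / 2) : ℝ) : ℝ) : ℂ) ≠ 0 := by
      exact_mod_cast (by positivity : (energy k + s) ^ (-(1 / 2) : ℝ) ≠ 0)
    rw [component_zero, h4]
    exact (mul_eq_zero.mp h3.symm).resolve_left h5
  have h2 := (Submodule.topologicalClosure_eq_top_iff).mpr h1
  have h3 := (Submodule.dense_iff_topologicalClosure_eq_top).mpr h2
  exact h3

theorem dense_creation_domain : Dense ((creation f).domain : Set FockSpace) := by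
  refine (dense_range_fieldInvSqrt hf hs hL).mono ?_
  rintro _ ⟨u, rfl⟩
  exact LinearPMap.mem_domain_of_mem_graph (cr_mem_creation hf hs hL u)

end

/-- The adjoint graph is given by the pairing because the domain of the creation operator is dense.
-/
theorem mem_annihilation_iff {f : R3 → ℂ} {L : ℝ} (hf : Adm f L) {u w : FockSpace} :
    (u, w) ∈ (annihilation f).graph ↔
      ∀ v z, (v, z) ∈ (creation f).graph → ⟪z, u⟫_ℂ = ⟪v, w⟫_ℂ := by
  -- The density lemma wants a nonnegative radius; enlarging the radius is harmless, and s = 1 will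
  -- do.
  have hf' : Adm f |L| := ⟨hf.meas, hf.zero,
    fun k hk => hf.supp k ((le_abs_self L).trans_lt hk), hf.integrable⟩
  rw [annihilation, LinearPMap.adjoint_graph_eq_graph_adjoint
    (dense_creation_domain hf' one_pos (abs_nonneg L)), Submodule.mem_adjoint_iff]
  simp only [sub_eq_zero]

theorem annihilation_creation {f : R3 → ℂ} {L : ℝ} (hf : Adm f L) :
    AdjointPair (annihilation f) (creation f) :=
  AdjointPair.symm fun v z hvz _ _ huw => (mem_annihilation_iff hf).mp huw v z hvz

/-- The operator with p = -1/2 extends (H_f+s)^(-1/2) a*(f), so its adjoint is a(f)(H_f+s)^(-1/2).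
-/
theorem cr_mem_annihilation {f : R3 → ℂ} {L s : ℝ} (hf : Adm f L) (hs : 0 < s) (hL : 0 ≤ L)
    (u : FockSpace) :
    (fieldInvSqrt s u, ContinuousLinearMap.adjoint (cr s (-(1 / 2)) f) u)
      ∈ (annihilation f).graph := by
  rw [mem_annihilation_iff hf]
  intro v z hvz
  rw [ContinuousLinearMap.adjoint_inner_right, ← fieldInvSqrt_creation hf hs hL hvz]
  exact (eMul_inner (bdd_fieldInvSqrt hs) z u).symm

theorem adjoint_cr_fieldInvSqrt {f : R3 → ℂ} {L s : ℝ} (hf : Adm f L) (hs : 0 < s) (hL : 0 ≤ L)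
    (u : FockSpace) :
    ContinuousLinearMap.adjoint (cr s (-(1 / 2)) f) (fieldInvSqrt s u)
      = fieldInvSqrt s (ContinuousLinearMap.adjoint (cr s (-1) f) u) := by
  have h := fieldInvSqrt_comp_cr hf hs hL (p := -(1 / 2)) le_rfl (by norm_num)
  rw [show (-(1 / 2) - 1 / 2 : ℝ) = -1 by norm_num] at h
  have h2 := congrArg (fun B => ContinuousLinearMap.adjoint B u) h
  have e : ContinuousLinearMap.adjoint (fieldInvSqrt s) = fieldInvSqrt s :=
    adjoint_eMul (bdd_fieldInvSqrt hs)
  simpa only [ContinuousLinearMap.adjoint_comp, e, ContinuousLinearMap.comp_apply] using h2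

theorem cr_zero_fieldInvSqrt {f : R3 → ℂ} {L s : ℝ} (hf : Adm f L) (hs : 0 < s) (hL : 0 ≤ L)
    (u : FockSpace) :
    cr s 0 f (fieldInvSqrt s u) = fieldInvSqrt s (cr s (1 / 2) f u) := by
  have h := fieldInvSqrt_comp_cr hf hs hL (p := 1 / 2) (by norm_num) le_rfl
  rw [sub_self] at h
  exact (congrArg (fun B : FockSpace →L[ℂ] FockSpace => B u) h).symm

/-! ### Translations of the field -/

/-- The symbol of the field translation. -/
def transSymbol (y : R3) (n : ℕ) (k : Fin n → R3) : ℂ :=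
  Complex.exp (-(Complex.I * ((∑ i, ⟪k i, y⟫_ℝ : ℝ) : ℂ)))

/-- The unitary `exp(-i y·P_f)` translating the field by `y`. -/
def fieldTrans (y : R3) : FockSpace →L[ℂ] FockSpace := fockMul (transSymbol y)

theorem norm_exp_neg_I_mul (t : ℝ) : ‖Complex.exp (-(Complex.I * (t : ℂ)))‖ = 1 := by
  rw [show -(Complex.I * (t : ℂ)) = ((-t : ℝ) : ℂ) * Complex.I by push_cast; ring]
  exact Complex.norm_exp_ofReal_mul_I _

theorem symmMul_trans (y : R3) : SymmMul (transSymbol y) 1 where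
  meas n := by
    have h : Continuous (transSymbol y n) := by
      unfold transSymbol
      fun_prop
    exact h.measurable
  symm n σ k := by
    unfold transSymbol
    rw [← Equiv.sum_comp σ fun i => ⟪k i, y⟫_ℝ]
    rfl
  bound n k := (norm_exp_neg_I_mul _).le

theorem isFockMul_trans (y : R3) : IsFockMul (transSymbol y) (fieldTrans y) :=
  (symmMul_trans y).isFockMul

theorem conj_transSymbol (y : R3) (n : ℕ) (k : Fin n → R3) :
    (starRingEnd ℂ) (transSymbol y n k) = transSymbol (-y) n k := by
  unfold transSymbol
  rw [← Complex.exp_conj]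
  simp only [map_neg, map_mul, Complex.conj_I, Complex.conj_ofReal, inner_neg_right,
    Finset.sum_neg_distrib, Complex.ofReal_neg]
  congr 1
  ring

theorem transSymbol_mul_neg (y : R3) (n : ℕ) (k : Fin n → R3) :
    transSymbol (-y) n k * transSymbol y n k = 1 := by
  rw [← conj_transSymbol, ← Complex.normSq_eq_conj_mul_self, Complex.normSq_eq_norm_sq]
  unfold transSymbol
  rw [norm_exp_neg_I_mul]
  simp

theorem fieldTrans_inner (y : R3) (u v : FockSpace) :
    ⟪fieldTrans y u, v⟫_ℂ = ⟪u, fieldTrans (-y) v⟫_ℂ :=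
  (isFockMul_trans y).inner_eq ((isFockMul_trans (-y)).congr fun n k =>
    (conj_transSymbol y n k).symm) u v

theorem fieldTrans_neg_apply (y : R3) (u : FockSpace) : fieldTrans (-y) (fieldTrans y u) = u := by
  have := IsFockMul.unique (((isFockMul_trans (-y)).comp (isFockMul_trans y)).congr
    fun n k => transSymbol_mul_neg y n k) isFockMul_one
  exact congrArg (fun B : FockSpace →L[ℂ] FockSpace => B u) this

theorem fieldTrans_inner_map (y : R3) (u v : FockSpace) :
    ⟪fieldTrans y u, fieldTrans y v⟫_ℂ = ⟪u, v⟫_ℂ := by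
  rw [fieldTrans_inner, fieldTrans_neg_apply]

theorem fieldTrans_fieldEnergy (y : R3) {u v : FockSpace} (h : (u, v) ∈ fieldEnergy.graph) :
    (fieldTrans y u, fieldTrans y v) ∈ fieldEnergy.graph := by
  rw [mem_fieldEnergy_iff] at h ⊢
  intro n
  filter_upwards [h n, isFockMul_trans y u n, isFockMul_trans y v n] with k h1 h2 h3
  rw [h2, h3, h1]
  ring

/-- The phase of n + 1 bosons factors into that of the created boson, absorbed into the form factor,
and that of the n others. -/
theorem fieldTrans_creation (y : R3) {f f' : R3 → ℂ}
    (hff' : ∀ k, f' k = f k * Complex.exp (-(Complex.I * (⟪k, y⟫_ℝ : ℝ)))) {u v : FockSpace}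
    (h : (u, v) ∈ (creation f).graph) :
    (fieldTrans y u, fieldTrans y v) ∈ (creation f').graph := by
  rw [mem_creation_iff] at h ⊢
  constructor
  · refine Lp.ext ?_
    filter_upwards [isFockMul_trans y v 0, Lp.coeFn_zero ℂ 2 (volume : Measure (Fin 0 → R3))]
      with k h1 h2
    rw [h1, h.1, h2, Pi.zero_apply, mul_zero]
  · intro n
    filter_upwards [h.2 n, isFockMul_trans y v (n + 1), ae_removeNth (isFockMul_trans y u n)]
      with k h1 h2 h3
    rw [h2, h1, mul_left_comm, Finset.mul_sum]
    congr 1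
    refine Finset.sum_congr rfl fun i _ => ?_
    rw [h3, hff']
    have e : transSymbol y (n + 1) k
        = Complex.exp (-(Complex.I * (⟪k i, y⟫_ℝ : ℝ))) * transSymbol y n (i.removeNth k) := by
      unfold transSymbol
      rw [← Complex.exp_add, Fin.sum_univ_succAbove _ i]
      congr 1
      push_cast
      simp only [Fin.removeNth]
      ring
    rw [e]
    ring

/-- Follows by duality: test vectors are pulled back with the inverse translation. -/
theorem fieldTrans_annihilation (y : R3) {f f' : R3 → ℂ} {L : ℝ} (hf : Adm f L) (hf' : Adm f' L)
    (hff' : ∀ k, f' k = f k * Complex.exp (-(Complex.I * (⟪k, y⟫_ℝ : ℝ)))) {u v : FockSpace}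
    (h : (u, v) ∈ (annihilation f).graph) :
    (fieldTrans y u, fieldTrans y v) ∈ (annihilation f').graph := by
  rw [mem_annihilation_iff hf] at h
  rw [mem_annihilation_iff hf']
  intro a b hab
  have h1 : (fieldTrans (-y) a, fieldTrans (-y) b) ∈ (creation f).graph := by
    refine fieldTrans_creation (-y) (fun k => ?_) hab
    rw [hff', mul_assoc, ← Complex.exp_add, inner_neg_right]
    push_cast
    rw [mul_neg, neg_neg, neg_add_cancel, Complex.exp_zero, mul_one]
  have h2 := h _ _ h1
  have h3 := fieldTrans_inner (-y) b u
  have h4 := fieldTrans_inner (-y) a v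
  rw [neg_neg] at h3 h4
  rw [← h3, ← h4, h2]

end FockGraphs

/-! ### The coupling functions -/

section Coupling

open Filter Topology

/-- The coupling function with amplitude `r` at the position `x`. -/
def planeWave (r : R3 → ℝ) (x k : R3) : ℂ :=
  (r k : ℂ) * Complex.exp (-(Complex.I * (⟪k, x⟫_ℝ : ℝ)))

theorem norm_planeWave (r : R3 → ℝ) (x k : R3) : ‖planeWave r x k‖ = |r k| := by
  rw [planeWave, norm_mul, norm_exp_neg_I_mul, mul_one, Complex.norm_real, Real.norm_eq_abs]

theorem planeWave_add (r : R3 → ℝ) (x y k : R3) :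
    planeWave r (x + y) k = planeWave r x k * Complex.exp (-(Complex.I * (⟪k, y⟫_ℝ : ℝ))) := by
  rw [planeWave, planeWave, mul_assoc, ← Complex.exp_add, inner_add_right]
  congr 2
  push_cast
  ring

theorem measurable_planeWave {r : R3 → ℝ} (hr : Measurable r) (x : R3) :
    Measurable (planeWave r x) := by
  unfold planeWave
  exact (Complex.measurable_ofReal.comp hr).mul (by fun_prop : Continuous fun k : R3 =>
    Complex.exp (-(Complex.I * (⟪k, x⟫_ℝ : ℝ)))).measurable

theorem continuous_of_norm_sub_le {K : Type*} [NormedAddCommGroup K] [InnerProductSpace ℂ K]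
    {D : R3 → K →L[ℂ] K} {C : ℝ}
    (h : ∀ x y, ‖D x - D y‖ ≤ C * ‖x - y‖) : Continuous D := by
  refine continuous_iff_continuousAt.mpr fun y => tendsto_iff_norm_sub_tendsto_zero.mpr ?_
  refine squeeze_zero (fun _ => norm_nonneg _) (fun x => h x y) ?_
  have : Continuous fun x : R3 => C * ‖x - y‖ := by fun_prop
  simpa using this.tendsto y

theorem hasLineDerivAt_of_norm_le {K : Type*} [NormedAddCommGroup K] [InnerProductSpace ℂ K]
    {D : R3 → K →L[ℂ] K} {B : K →L[ℂ] K} {x v : R3} {C L : ℝ} (hL : 0 ≤ L) (hC0 : 0 ≤ C)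
    (key : ∀ t : ℝ, |t| * L ≤ 1 → ‖D (x + t • v) - D x - (-(Complex.I * t)) • B‖ ≤ t ^ 2 * C) :
    HasLineDerivAt ℝ D (-(Complex.I • B)) x v := by
  rw [hasLineDerivAt_iff_isLittleO_nhds_zero, Asymptotics.isLittleO_iff]
  intro ε hε
  -- The first bound puts t in the range of the quadratic estimate, the second makes the remainder
  -- at most ε|t|; the added ones keep the denominators positive.
  have hev : ∀ᶠ t : ℝ in 𝓝 0, |t| < min (1 / (L + 1)) (ε / (C + 1)) := by
    have : 0 < min (1 / (L + 1)) (ε / (C + 1)) := by positivity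
    filter_upwards [Metric.ball_mem_nhds (0 : ℝ) this] with t ht
    rwa [Metric.mem_ball, Real.dist_eq, sub_zero] at ht
  filter_upwards [hev] with t ht
  have ht0 := abs_nonneg t
  have ht1 : |t| * (L + 1) < 1 := (lt_div_iff₀ (by positivity)).mp (ht.trans_le (min_le_left _ _))
  have ht2 : |t| * (C + 1) < ε := (lt_div_iff₀ (by positivity)).mp (ht.trans_le (min_le_right _ _))
  have e : t • -(Complex.I • B) = (-(Complex.I * t)) • B := by
    rw [smul_neg, neg_smul, mul_comm, mul_smul, Complex.coe_smul]
  rw [e]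
  refine (key t (by linarith)).trans ?_
  rw [Real.norm_eq_abs]
  calc t ^ 2 * C = (|t| * C) * |t| := by rw [← sq_abs]; ring
    _ ≤ ε * |t| := by
      have h1 : |t| * C ≤ ε := by linarith
      gcongr

/-! ### Dependence of the weighted creation operators on the position. -/

section Amplitude

variable {r : R3 → ℝ} {h : R3 → ℂ} {L : ℝ} (hh : Adm h L) (hr : Measurable r)
  {M : ℝ} (hM : 0 ≤ M) (hle : ∀ k, |r k| ≤ M * ‖h k‖)
include hh hr hM hle

theorem adm_planeWave (x : R3) : Adm (planeWave r x) L :=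
  (hh.of_le (measurable_planeWave hr x) hM fun k => (norm_planeWave r x k).trans_le (hle k)).1

theorem wnorm_planeWave_le (x : R3) : wnorm (planeWave r x) ≤ M * wnorm h :=
  (hh.of_le (measurable_planeWave hr x) hM fun k => (norm_planeWave r x k).trans_le (hle k)).2

theorem norm_cr_planeWave_le {s p : ℝ} (hs : 0 < s) (hL : 0 ≤ L) (hp : -1 ≤ p) (hp' : p ≤ 1 / 2)
    (x : R3) : ‖cr s p (planeWave r x)‖ ≤ (1 + L / s) * (M * wnorm h) := by
  refine ((adm_planeWave hh hr hM hle x).norm_cr_le hs hL hp hp').trans ?_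
  have : 0 ≤ L / s := by positivity
  gcongr
  exact wnorm_planeWave_le hh hr hM hle x

/-- Differentiating the plane wave brings down k_j, which is at most L on the support. -/
theorem coord_amplitude_le (hL : 0 ≤ L) (j : Fin 3) (k : R3) :
    |k j * r k| ≤ (L * M) * ‖h k‖ := by
  by_cases hk : L < ‖k‖
  · have h1 := hle k
    rw [hh.supp k hk] at h1 ⊢
    rw [norm_zero, mul_zero] at h1 ⊢
    rw [abs_nonpos_iff.mp h1, mul_zero, abs_zero]
  · push Not at hk
    rw [abs_mul, mul_assoc]
    exact mul_le_mul ((abs_coord_le k j).trans hk) (hle k) (abs_nonneg _) hL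

theorem norm_cr_planeWave_sub_le {s p : ℝ} (hs : 0 < s) (hL : 0 ≤ L) (hp : -1 ≤ p)
    (hp' : p ≤ 1 / 2) (x y : R3) :
    ‖cr s p (planeWave r x) - cr s p (planeWave r y)‖
      ≤ (L * ‖x - y‖ * M) * ((1 + L / s) * wnorm h) := by
  have hx := adm_planeWave hh hr hM hle x
  have hy := adm_planeWave hh hr hM hle y
  have key := hx.norm_cr_sub_le hy hx hh (c := 0) (D := L * ‖x - y‖ * M) hs hL hp hp'
    (by positivity) fun k => ?_
  · rwa [zero_smul, sub_zero] at key
  · rw [zero_mul, sub_zero]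
    by_cases hk : L < ‖k‖
    · rw [hx.supp k hk, hy.supp k hk, sub_zero, norm_zero]
      positivity
    · push Not at hk
      have e : planeWave r x k = planeWave r y k
          * Complex.exp (Complex.I * ((-⟪k, x - y⟫_ℝ : ℝ) : ℂ)) := by
        have := planeWave_add r y (x - y) k
        rw [add_sub_cancel] at this
        rw [this]
        congr 2
        push_cast
        ring
      have h1 := Real.norm_exp_I_mul_ofReal_sub_one_le (x := -⟪k, x - y⟫_ℝ)
      rw [norm_neg] at h1
      have h2 : ‖⟪k, x - y⟫_ℝ‖ ≤ L * ‖x - y‖ := (norm_inner_le_norm _ _).trans (by gcongr)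
      rw [e, ← mul_sub_one, norm_mul, norm_planeWave, mul_comm]
      calc _ ≤ (L * ‖x - y‖) * (M * ‖h k‖) :=
            mul_le_mul (h1.trans h2) (hle k) (abs_nonneg _) (by positivity)
        _ = _ := by ring

theorem continuous_cr_planeWave {s p : ℝ} (hs : 0 < s) (hL : 0 ≤ L) (hp : -1 ≤ p)
    (hp' : p ≤ 1 / 2) : Continuous fun x => cr s p (planeWave r x) :=
  continuous_of_norm_sub_le (C := L * M * ((1 + L / s) * wnorm h)) fun x y =>
    (norm_cr_planeWave_sub_le hh hr hM hle hs hL hp hp' x y).trans_eq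
      (show _ = L * M * ((1 + L / s) * wnorm h) * ‖x - y‖ by ring)

/-- The remainder is |exp z - 1 - z| ≤ |z|² with z = -itk_j, applicable since |z| ≤ |t|L ≤ 1 on the
support. -/
theorem norm_planeWave_sub_sub_le (_hL : 0 ≤ L) (j : Fin 3) (x k : R3) {t : ℝ} (ht : |t| * L ≤ 1) :
    ‖planeWave r (x + t • basisVec j) k - planeWave r x k
      - (-(Complex.I * t)) * planeWave (fun k => k j * r k) x k‖ ≤ (t ^ 2 * L ^ 2 * M) * ‖h k‖ := by
  have e1 : ⟪k, t • basisVec j⟫_ℝ = t * k j := by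
    rw [inner_smul_right, basisVec]
    simp [EuclideanSpace.inner_single_right]
  have e : planeWave r (x + t • basisVec j) k - planeWave r x k
      - (-(Complex.I * t)) * planeWave (fun k => k j * r k) x k
      = planeWave r x k * (Complex.exp (-(Complex.I * (t * k j : ℝ))) - 1
        - (-(Complex.I * (t * k j : ℝ)))) := by
    rw [planeWave_add, e1]
    unfold planeWave
    push_cast
    ring
  have hz : ‖-(Complex.I * ((t * k j : ℝ) : ℂ))‖ = |t| * |k j| := by
    rw [norm_neg, norm_mul, Complex.norm_I, one_mul, Complex.norm_real, Real.norm_eq_abs,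
      abs_mul]
  rw [e, norm_mul, norm_planeWave, mul_comm]
  by_cases hk : L < ‖k‖
  · have h1 := hle k
    rw [hh.supp k hk] at h1 ⊢
    rw [norm_zero, mul_zero] at h1
    rw [abs_nonpos_iff.mp h1, abs_zero, mul_zero, norm_zero, mul_zero]
  · push Not at hk
    have hkj := (abs_coord_le k j).trans hk
    have hz1 : |t| * |k j| ≤ |t| * L := by gcongr
    have h1 := Complex.norm_exp_sub_one_sub_id_le (x := -(Complex.I * ((t * k j : ℝ) : ℂ)))
      (by rw [hz]; linarith)
    rw [hz] at h1
    have h2 : (|t| * |k j|) ^ 2 ≤ t ^ 2 * L ^ 2 := by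
      rw [← sq_abs t, ← mul_pow]
      gcongr
    calc _ ≤ (t ^ 2 * L ^ 2) * (M * ‖h k‖) :=
          mul_le_mul (h1.trans h2) (hle k) (abs_nonneg _) (by positivity)
      _ = _ := by ring

theorem norm_cr_planeWave_sub_sub_le {s p : ℝ} (hs : 0 < s) (hL : 0 ≤ L) (hp : -1 ≤ p)
    (hp' : p ≤ 1 / 2) (j : Fin 3) (x : R3) {t : ℝ} (ht : |t| * L ≤ 1) :
    ‖cr s p (planeWave r (x + t • basisVec j)) - cr s p (planeWave r x)
      - (-(Complex.I * t)) • cr s p (planeWave (fun k => k j * r k) x)‖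
      ≤ (t ^ 2 * L ^ 2 * M) * ((1 + L / s) * wnorm h) := by
  have hmj : Measurable fun k : R3 => k j * r k := by fun_prop
  exact (adm_planeWave hh hr hM hle _).norm_cr_sub_le (adm_planeWave hh hr hM hle x)
    (adm_planeWave hh hmj (by positivity) (coord_amplitude_le hh hr hM hle hL j) x) hh hs hL hp hp'
    (by positivity) fun k => norm_planeWave_sub_sub_le hh hr hM hle hL j x k ht

theorem hasLineDerivAt_cr_planeWave {s p : ℝ} (hs : 0 < s) (hL : 0 ≤ L) (hp : -1 ≤ p)
    (hp' : p ≤ 1 / 2) (j : Fin 3) (x : R3) :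
    HasLineDerivAt ℝ (fun x => cr s p (planeWave r x))
      (-(Complex.I • cr s p (planeWave (fun k => k j * r k) x))) x (basisVec j) := by
  have hW : 0 ≤ wnorm h := Real.sqrt_nonneg _
  refine hasLineDerivAt_of_norm_le (C := L ^ 2 * M * ((1 + L / s) * wnorm h)) hL (by positivity)
    fun t ht => ?_
  exact (norm_cr_planeWave_sub_sub_le hh hr hM hle hs hL hp hp' j x ht).trans_eq (by ring)

end Amplitude

/-! ### The form factor -/

/-- The amplitude of the `j`-th coupling function. -/
def amplitude (m κ Λ : ℝ) (j : Fin 3) (k : R3) : ℝ :=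
  formFactor κ Λ (m • k) / Real.sqrt (2 * ‖k‖) * k j * (‖k‖ + ‖k‖ ^ 2 / 2)⁻¹

/-- A common bound on the amplitudes. -/
def refAmplitude (m κ Λ : ℝ) (k : R3) : ℂ :=
  ((formFactor κ Λ (m • k) / Real.sqrt (2 * ‖k‖) * ‖k‖ * (‖k‖ + ‖k‖ ^ 2 / 2)⁻¹ : ℝ) : ℂ)

theorem measurable_formFactor (m κ Λ : ℝ) : Measurable fun k : R3 => formFactor κ Λ (m • k) := by
  unfold formFactor
  refine Measurable.ite (MeasurableSet.inter ?_ ?_) measurable_const measurable_const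
  · exact measurableSet_le measurable_const (by fun_prop : Measurable fun k : R3 => ‖m • k‖)
  · exact measurableSet_le (by fun_prop : Measurable fun k : R3 => ‖m • k‖) measurable_const

theorem measurable_amplitude (m κ Λ : ℝ) (j : Fin 3) : Measurable (amplitude m κ Λ j) := by
  have := measurable_formFactor m κ Λ
  unfold amplitude
  fun_prop

theorem abs_amplitude_le (m κ Λ : ℝ) (j : Fin 3) (k : R3) :
    |amplitude m κ Λ j k| ≤ 1 * ‖refAmplitude m κ Λ k‖ := by
  rw [one_mul, refAmplitude, Complex.norm_real, Real.norm_eq_abs, amplitude, abs_mul, abs_mul,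
    abs_mul, abs_mul, abs_norm]
  gcongr
  exact abs_coord_le k j

/-- The radial profile of `|refAmplitude|² / |k|`. -/
def radialProfile (m κ Λ r : ℝ) : ℝ :=
  (Set.Icc (κ / m) (Λ / m)).indicator
    (fun r => (2 * Real.pi) ^ (-3 : ℝ) / 2 * ((r + r ^ 2 / 2)⁻¹) ^ 2) r

theorem refAmplitude_sq_div {m κ Λ : ℝ} (hm : 0 < m) (hκ : 0 < κ) (k : R3) :
    ‖refAmplitude m κ Λ k‖ ^ 2 / ‖k‖ = radialProfile m κ Λ ‖k‖ := by
  have hiff : (κ ≤ ‖m • k‖ ∧ ‖m • k‖ ≤ Λ) ↔ ‖k‖ ∈ Set.Icc (κ / m) (Λ / m) := by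
    rw [norm_smul, Real.norm_eq_abs, abs_of_pos hm, Set.mem_Icc, div_le_iff₀ hm, le_div_iff₀ hm,
      mul_comm m]
  rw [refAmplitude, Complex.norm_real, Real.norm_eq_abs, sq_abs, radialProfile, Set.indicator,
    formFactor]
  simp only [hiff]
  split_ifs with h
  · have hk : 0 < ‖k‖ := lt_of_lt_of_le (by positivity) h.1
    have e1 : ((2 * Real.pi) ^ (-(3 / 2) : ℝ)) ^ 2 = (2 * Real.pi) ^ (-3 : ℝ) := by
      rw [← Real.rpow_two, ← Real.rpow_mul (by positivity)]
      norm_num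
    rw [mul_pow, mul_pow, div_pow, e1, Real.sq_sqrt (by positivity)]
    field_simp
  · simp

/-- Since r + r²/2 = r(1 + r/2), the weight r² cancels the singularity and leaves (c/2)(1 + r/2)⁻²,
with c = (2π)⁻³. This has the primitive -c(1 + r/2)⁻¹, whose total increase on (0, ∞) is c. The
bound is therefore independent of the mass and of both cutoffs. -/
theorem integrable_radialProfile {m κ Λ : ℝ} (hm : 0 < m) (hκ : 0 < κ) :
    IntegrableOn (fun r => r ^ 2 * radialProfile m κ Λ r) (Set.Ioi 0) ∧
    ∫ r in Set.Ioi (0 : ℝ), r ^ 2 * radialProfile m κ Λ r ≤ (2 * Real.pi) ^ (-3 : ℝ) := by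
  have ha : 0 < κ / m := by positivity
  set a := κ / m with ha'
  set b := Λ / m with hb'
  set c := (2 * Real.pi) ^ (-3 : ℝ) with hc
  have hc0 : 0 ≤ c := by positivity
  have e : ∀ r, r ^ 2 * radialProfile m κ Λ r
      = (Set.Icc a b).indicator (fun r => c / 2 * ((1 + r / 2)⁻¹) ^ 2) r := by
    intro r
    rw [radialProfile, Set.indicator, Set.indicator]
    split_ifs with h
    · have hr : 0 < r := ha.trans_le h.1
      rw [show r + r ^ 2 / 2 = r * (1 + r / 2) by ring, mul_inv, mul_pow, ← hc]
      field_simp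
    · rw [mul_zero]
  have hcont : ContinuousOn (fun r : ℝ => c / 2 * ((1 + r / 2)⁻¹) ^ 2) (Set.Icc a b) := by
    refine continuousOn_const.mul (ContinuousOn.pow (ContinuousOn.inv₀ (by fun_prop) ?_) 2)
    intro r hr
    have : 0 < r := ha.trans_le hr.1
    positivity
  have hint : IntegrableOn (fun r : ℝ => c / 2 * ((1 + r / 2)⁻¹) ^ 2) (Set.Icc a b) :=
    hcont.integrableOn_Icc
  have hsub : Set.Icc a b ⊆ Set.Ioi 0 := fun r hr => ha.trans_le hr.1
  simp only [e]
  refine ⟨((integrable_indicator_iff measurableSet_Icc).mpr hint).integrableOn, ?_⟩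
  rw [setIntegral_indicator measurableSet_Icc, Set.inter_eq_right.mpr hsub]
  rcases le_or_gt a b with hab | hab
  · rw [integral_Icc_eq_integral_Ioc, ← intervalIntegral.integral_of_le hab]
    have hd : ∀ r ∈ Set.uIcc a b, HasDerivAt (fun r : ℝ => -(c * (1 + r / 2)⁻¹))
        (c / 2 * ((1 + r / 2)⁻¹) ^ 2) r := by
      intro r hr
      rw [Set.uIcc_of_le hab] at hr
      have h0 : 1 + r / 2 ≠ 0 := by
        have : 0 < r := ha.trans_le hr.1
        positivity
      have h1 : HasDerivAt (fun r : ℝ => 1 + r / 2) (1 / 2) r :=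
        ((hasDerivAt_id r).div_const 2).const_add 1
      refine ((h1.inv h0).const_mul c).neg.congr_deriv ?_
      field_simp
    rw [intervalIntegral.integral_eq_sub_of_hasDerivAt hd
      ((Set.uIcc_of_le hab ▸ hcont).intervalIntegrable)]
    have hb0 : 0 < b := ha.trans_le hab
    have h1 : 0 ≤ c * (1 + b / 2)⁻¹ := by positivity
    have h2 : c * (1 + a / 2)⁻¹ ≤ c * 1 := by
      gcongr
      exact inv_le_one_of_one_le₀ (by linarith)
    linarith
  · rw [Set.Icc_eq_empty (not_le.mpr hab), Measure.restrict_empty, integral_zero_measure]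
    exact hc0

theorem volume_ball_real : (volume : Measure R3).real (Metric.ball 0 1) = 4 / 3 * Real.pi := by
  rw [Measure.real, EuclideanSpace.volume_ball_fin_three]
  have := Real.pi_pos
  simp only [one_pow, ENNReal.ofReal_one, one_mul]
  rw [ENNReal.toReal_ofReal (by positivity)]
  ring

theorem adm_refAmplitude {m κ Λ : ℝ} (hm : 0 < m) (hκ : 0 < κ) :
    Adm (refAmplitude m κ Λ) (Λ / m) where
  meas := by
    have := measurable_formFactor m κ Λ
    unfold refAmplitude
    fun_prop
  zero := by simp [refAmplitude]
  supp k hk := by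
    have h : ¬ (κ ≤ ‖m • k‖ ∧ ‖m • k‖ ≤ Λ) := by
      rw [norm_smul, Real.norm_eq_abs, abs_of_pos hm]
      rw [div_lt_iff₀ hm] at hk
      intro h
      linarith [h.2]
    rw [refAmplitude, formFactor, if_neg h]
    simp
  integrable := by
    simp only [refAmplitude_sq_div hm hκ]
    rw [integrable_fun_norm_addHaar]
    simpa using (integrable_radialProfile hm hκ).1

/-- In polar coordinates the square is at most 4π(2π)⁻³ = 1/(2π²). -/
theorem wnorm_refAmplitude_le {m κ Λ : ℝ} (hm : 0 < m) (hκ : 0 < κ) :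
    wnorm (refAmplitude m κ Λ) ≤ (Real.sqrt 2 * Real.pi)⁻¹ := by
  have h := (integrable_radialProfile (Λ := Λ) hm hκ).2
  have hpi := Real.pi_pos
  rw [wnorm]
  refine Real.sqrt_le_iff.mpr ⟨by positivity, ?_⟩
  simp only [refAmplitude_sq_div hm hκ]
  rw [integral_fun_norm_addHaar volume (radialProfile m κ Λ), volume_ball_real]
  simp only [finrank_euclideanSpace, Fintype.card_fin, smul_eq_mul, nsmul_eq_mul]
  norm_num only
  calc (3 : ℝ) * (4 / 3 * Real.pi * ∫ r in Set.Ioi (0 : ℝ), r ^ 2 * radialProfile m κ Λ r)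
      ≤ 3 * (4 / 3 * Real.pi * (2 * Real.pi) ^ (-3 : ℝ)) := by gcongr
    _ = ((Real.sqrt 2 * Real.pi)⁻¹) ^ 2 := by
      rw [inv_pow, mul_pow, Real.sq_sqrt (by norm_num), Real.rpow_neg (by positivity),
        show (3 : ℝ) = ((3 : ℕ) : ℝ) by norm_num, Real.rpow_natCast]
      push_cast
      field_simp
      norm_num

end Coupling

/-! ### The free Hamiltonian and bounded perturbations -/

section Perturbation

open FourierTransform

variable {K : Type*} [NormedAddCommGroup K] [InnerProductSpace ℂ K] [CompleteSpace K]

theorem mem_fiberOp_iff {T : R3 → K →ₗ.[ℂ] K} {ψ φ : ParticleSpace K} :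
    (ψ, φ) ∈ (fiberOp T).graph ↔ ∀ᵐ x, (ψ x, φ x) ∈ (T x).graph := by
  rw [fiberOp_graph]
  rfl

theorem mem_potential_iff {V : R3 → ℝ} {ψ φ : ParticleSpace K} :
    (ψ, φ) ∈ (potential V : ParticleSpace K →ₗ.[ℂ] ParticleSpace K).graph ↔
      ∀ᵐ x, φ x = (V x : ℂ) • ψ x := by
  rw [potential, mem_fiberOp_iff]
  refine Filter.eventually_congr (Filter.Eventually.of_forall fun x => ?_)
  rw [LinearPMap.mem_graph_iff]
  constructor
  · rintro ⟨y, hy, h⟩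
    exact h.symm.trans (congrArg (fun v : K => (V x : ℂ) • v) hy)
  · intro h
    exact ⟨⟨ψ x, trivial⟩, rfl, h.symm⟩

theorem AdjointPair.fiberOp {T S : R3 → K →ₗ.[ℂ] K} (h : ∀ x, AdjointPair (T x) (S x)) :
    AdjointPair (fiberOp T) (fiberOp S) := by
  intro x y hxy u v huv
  rw [mem_fiberOp_iff] at hxy huv
  rw [L2.inner_def, L2.inner_def]
  refine integral_congr_ae ?_
  filter_upwards [hxy, huv] with t h1 h2
  exact h t _ _ h1 _ _ h2

theorem potential_symm (V : R3 → ℝ) :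
    AdjointPair (potential V : ParticleSpace K →ₗ.[ℂ] ParticleSpace K) (potential V) := by
  intro x y hxy u v huv
  rw [mem_potential_iff] at hxy huv
  rw [L2.inner_def, L2.inner_def]
  refine integral_congr_ae ?_
  filter_upwards [hxy, huv] with t h1 h2
  rw [h1, h2, inner_smul_left, inner_smul_right, Complex.conj_ofReal]

theorem mem_fiberOp_of_forall {T : R3 → K →ₗ.[ℂ] K} {B C : R3 → K →L[ℂ] K} (hB : BddCont B)
    (hC : BddCont C) (h : ∀ x u, (B x u, C x u) ∈ (T x).graph) (ψ : ParticleSpace K) :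
    (fiberCLM B ψ, fiberCLM C ψ) ∈ (fiberOp T).graph := by
  rw [mem_fiberOp_iff]
  filter_upwards [fiberCLM_ae hB ψ, fiberCLM_ae hC ψ] with x h1 h2
  rw [h1, h2]
  exact h x _

/-- The Coulomb potential of strength `α` is bounded relative to the momentum. -/
theorem exists_potential_mem {ψ : ParticleSpace K} {P : Fin 3 → ParticleSpace K}
    (h : ∀ j, (ψ, P j) ∈ (momentum K j).graph) {V : R3 → ℝ} {α : ℝ}
    (hV : ∀ x, V x = -(α * ‖x‖⁻¹)) : ∃ w, (ψ, w) ∈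
      (potential V : ParticleSpace K →ₗ.[ℂ] ParticleSpace K).graph ∧
      ‖w‖ ^ 2 ≤ 4 * α ^ 2 * ∑ j, ‖P j‖ ^ 2 := by
  obtain ⟨h1, h2⟩ := hardy h
  have e : ∀ x, ‖(V x : ℂ) • ψ x‖ ^ 2 = α ^ 2 * ((‖x‖ ^ 2)⁻¹ * ‖ψ x‖ ^ 2) := by
    intro x
    rw [norm_smul, Complex.norm_real, Real.norm_eq_abs, mul_pow, sq_abs, hV, neg_sq, mul_pow,
      inv_pow, mul_assoc]
  have hmV : Measurable fun x : R3 => (V x : ℂ) := by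
    have : V = fun x => -(α * ‖x‖⁻¹) := funext hV
    rw [this]
    fun_prop
  have hm : AEStronglyMeasurable (fun x => (V x : ℂ) • ψ x) volume :=
    hmV.aestronglyMeasurable.smul (Lp.aestronglyMeasurable ψ)
  have hL : MemLp (fun x => (V x : ℂ) • ψ x) 2 volume := by
    rw [memLp_two_iff_integrable_sq_norm hm]
    simp only [e]
    exact h1.const_mul _
  refine ⟨hL.toLp, mem_potential_iff.mpr hL.coeFn_toLp, ?_⟩
  rw [norm_sq_eq_integral]
  have e2 : ∫ x, ‖(hL.toLp _ : ParticleSpace K) x‖ ^ 2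
      = ∫ x, α ^ 2 * ((‖x‖ ^ 2)⁻¹ * ‖ψ x‖ ^ 2) := by
    refine integral_congr_ae ?_
    filter_upwards [hL.coeFn_toLp] with x hx
    rw [hx, e]
  rw [e2, integral_const_mul]
  calc α ^ 2 * ∫ x, (‖x‖ ^ 2)⁻¹ * ‖ψ x‖ ^ 2 ≤ α ^ 2 * (4 * ∑ j, ‖P j‖ ^ 2) := by gcongr
    _ = _ := by ring

/-- `Q` is the family of the resolvents `(T + t)⁻¹`, `t > 0`. -/
structure IsResolventOf (T : K →ₗ.[ℂ] K) (Q : ℝ → K →L[ℂ] K) : Prop where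
  family : IsResolventFamily Q
  mem : ∀ s, 0 < s → ∀ u, (Q s u, u - (s : ℂ) • Q s u) ∈ T.graph
  of_mem : ∀ s, 0 < s → ∀ u v, (u, v) ∈ T.graph → Q s (v + (s : ℂ) • u) = u

/-- The resolvent of the free Hamiltonian. -/
def freeResolvent (Q : ℝ → K →L[ℂ] K) (s : ℝ) : ParticleSpace K →L[ℂ] ParticleSpace K :=
  fourierMulCLM fun ξ => Q (kineticSymbol ξ + s)

/-- The symbol of `(T + s)` times the free resolvent. -/
def fieldSymbol (Q : ℝ → K →L[ℂ] K) (s : ℝ) (ξ : R3) : K →L[ℂ] K :=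
  ContinuousLinearMap.id ℂ K - (kineticSymbol ξ : ℂ) • Q (kineticSymbol ξ + s)

theorem BddCont.sub {D D' : R3 → K →L[ℂ] K} (h : BddCont D) (h' : BddCont D') :
    BddCont fun x => D x - D' x := by
  obtain ⟨C, hC⟩ := h.2
  obtain ⟨C', hC'⟩ := h'.2
  exact ⟨h.1.sub h'.1, C + C', fun x => (norm_sub_le _ _).trans (add_le_add (hC x) (hC' x))⟩

theorem IsResolventFamily.bddCont_fieldSymbol {Q : ℝ → K →L[ℂ] K} (hQ : IsResolventFamily Q) {s : ℝ}
    (hs : 0 < s) : BddCont (fieldSymbol Q s) :=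
  (bddCont_const _).sub (hQ.bddCont_kinetic_symbol hs)

/-- With a the kinetic symbol, this is the resolvent identity Q(s) - Q(a+s) = a Q(s)Q(a+s). -/
theorem IsResolventFamily.comp_fieldSymbol {Q : ℝ → K →L[ℂ] K} (hQ : IsResolventFamily Q) {s : ℝ}
    (hs : 0 < s) (ξ : R3) : Q s ∘L fieldSymbol Q s ξ = Q (kineticSymbol ξ + s) := by
  have h := hQ.resolvent s (kineticSymbol ξ + s) hs (by linarith [kineticSymbol_nonneg ξ])
  rw [add_sub_cancel_right] at h
  rw [fieldSymbol, ContinuousLinearMap.comp_sub, ContinuousLinearMap.comp_id,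
    ContinuousLinearMap.comp_smul, ← h, sub_sub_cancel]

/-! ### The resolvent of p²/2 + T. -/

section Free

variable {T : K →ₗ.[ℂ] K} {Q : ℝ → K →L[ℂ] K} (hQ : IsResolventOf T Q) {s : ℝ} (hs : 0 < s)
include hQ hs

/-- Factoring out the constant operator (T + s)⁻¹ on the left shows that the range lies in the
domain of T fibrewise in position space, although the multiplier itself acts in Fourier space. -/
theorem freeResolvent_eq (y : ParticleSpace K) :
    freeResolvent Q s y = fiberCLM (fun _ => Q s) (fourierMul (fieldSymbol Q s) y) := by
  rw [freeResolvent, fourierMulCLM_apply,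
    fiberCLM_const_fourierMul _ (hQ.family.bddCont_fieldSymbol hs)]
  exact fourierMul_congr (fun ξ => (hQ.family.comp_fieldSymbol hs ξ).symm) y

theorem freeResolvent_mem_fiberOp (y : ParticleSpace K) :
    (freeResolvent Q s y, fourierMul (fieldSymbol Q s) y - (s : ℂ) • freeResolvent Q s y)
      ∈ (fiberOp fun _ => T).graph := by
  rw [freeResolvent_eq hQ hs, mem_fiberOp_iff]
  set v := fourierMul (fieldSymbol Q s) y
  filter_upwards [fiberCLM_ae (bddCont_const (Q s)) v, Lp.coeFn_sub v
    ((s : ℂ) • fiberCLM (fun _ => Q s) v), Lp.coeFn_smul (s : ℂ) (fiberCLM (fun _ => Q s) v)]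
    with x h1 h2 h3
  rw [h2, Pi.sub_apply, h3, Pi.smul_apply, h1]
  exact hQ.mem s hs _

theorem freeResolvent_mem_kinetic (y : ParticleSpace K) :
    (freeResolvent Q s y, y - fourierMul (fieldSymbol Q s) y) ∈ (kinetic K).graph := by
  have e : fourierMul (fieldSymbol Q s) y
      + fourierMul (fun ξ => (kineticSymbol ξ : ℂ) • Q (kineticSymbol ξ + s)) y = y := by
    apply fourier_injective
    rw [FourierTransform.fourier_add, fourier_fourierMul, fourier_fourierMul]
    refine Lp.ext ?_
    filter_upwards [fiberCLM_ae (hQ.family.bddCont_fieldSymbol hs) (𝓕 y),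
      fiberCLM_ae (hQ.family.bddCont_kinetic_symbol hs) (𝓕 y),
      Lp.coeFn_add (fiberCLM (fieldSymbol Q s) (𝓕 y))
        (fiberCLM (fun ξ => (kineticSymbol ξ : ℂ) • Q (kineticSymbol ξ + s)) (𝓕 y))] with ξ h1 h2 h3
    rw [h3, Pi.add_apply, h1, h2, fieldSymbol, _root_.sub_apply, ContinuousLinearMap.id_apply,
      sub_add_cancel]
  rw [sub_eq_of_eq_add' e.symm]
  exact hQ.family.kinetic_mem hs y

/-- Applying Q(s) replaces the unbounded T by bounded operators that commute with the Fourier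
transform. In Fourier space p²/2 is a number a, and the resolvent identity between a + s and s
finishes. -/
theorem freeResolvent_of_mem {x χ η : ParticleSpace K} (h1 : (x, χ) ∈ (kinetic K).graph)
    (h2 : (x, η) ∈ (fiberOp fun _ => T).graph) :
    freeResolvent Q s (χ + η + (s : ℂ) • x) = x := by
  rw [mem_fiberOp_iff] at h2
  have h3 : fiberCLM (fun _ => Q s) (η + (s : ℂ) • x) = x := by
    refine Lp.ext ?_
    filter_upwards [h2, fiberCLM_ae (bddCont_const (Q s)) (η + (s : ℂ) • x),
      Lp.coeFn_add η ((s : ℂ) • x), Lp.coeFn_smul (s : ℂ) x] with t e1 e2 e3 e4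
    rw [e2, e3, Pi.add_apply, e4, Pi.smul_apply]
    exact hQ.of_mem s hs _ _ e1
  have h4 : fiberCLM (fun _ => Q s) (𝓕 (η + (s : ℂ) • x)) = 𝓕 x := by
    rw [← fourier_fiberCLM_const, h3]
  apply fourier_injective
  rw [freeResolvent, fourierMulCLM_apply, fourier_fourierMul, add_assoc,
    FourierTransform.fourier_add]
  set w := 𝓕 (η + (s : ℂ) • x)
  refine Lp.ext ?_
  filter_upwards [fourier_kinetic h1, fiberCLM_ae (hQ.family.bddCont_symbol hs) (𝓕 χ + w),
    Lp.coeFn_add (𝓕 χ) w, (Lp.ext_iff.mp h4), fiberCLM_ae (bddCont_const (Q s)) w]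
    with ξ e1 e2 e3 e4 e5
  have h := hQ.family.resolvent (kineticSymbol ξ + s) s (by linarith [kineticSymbol_nonneg ξ]) hs
  have h5 := congrArg (fun B : K →L[ℂ] K => B (w ξ)) h
  simp only [_root_.sub_apply, _root_.smul_apply, ContinuousLinearMap.comp_apply] at h5
  rw [e2, e3, Pi.add_apply, e1, map_add, map_smul, ← e4, e5]
  have h6 : ((s - (kineticSymbol ξ + s) : ℝ) : ℂ) = -(kineticSymbol ξ : ℂ) := by
    push_cast
    ring
  rw [h6] at h5
  linear_combination (norm := module) h5

end Free

/-- `S = (T + s)^{-1/2}` for the operator `T ≥ 0` with the resolvents `Q`. -/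
structure IsInvSqrt (Q : ℝ → K →L[ℂ] K) (s : ℝ) (S : K →L[ℂ] K) : Prop where
  sq : S ∘L S = Q s
  norm_le : ∀ u, ‖S u‖ ≤ (Real.sqrt s)⁻¹ * ‖u‖
  norm_sub_le : ∀ a : ℝ, 0 ≤ a → ∀ u, ‖u - (a : ℂ) • Q (a + s) u‖ ≤ ‖u‖
  norm_comp_sub_le : ∀ a : ℝ, 0 ≤ a → ∀ u,
    2 * a * ‖S (u - (a : ℂ) • Q (a + s) u)‖ ^ 2 ≤ (1 / 2) * ‖u‖ ^ 2

/-- The symbol of `(T + s)^{1/2} p_j` times the free resolvent. -/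
def momentumFieldSymbol (Q : ℝ → K →L[ℂ] K) (S : K →L[ℂ] K) (s : ℝ) (j : Fin 3) (ξ : R3) :
    K →L[ℂ] K := ((2 * Real.pi * ξ j : ℝ) : ℂ) • (S ∘L fieldSymbol Q s ξ)

/-! ### Half powers of T + s distributed between the free resolvent and the field operators. -/

section HalfPower

variable {T : K →ₗ.[ℂ] K} {Q : ℝ → K →L[ℂ] K} (hQ : IsResolventOf T Q) {s : ℝ} (hs : 0 < s)
  {S : K →L[ℂ] K} (hS : IsInvSqrt Q s S)
include hQ hs hS

theorem norm_momentumFieldSymbol_le (ξ : R3) (u : K) :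
    ∑ j, ‖momentumFieldSymbol Q S s j ξ u‖ ^ 2 ≤ (1 / 2) * ‖u‖ ^ 2 := by
  have h := hS.norm_comp_sub_le (kineticSymbol ξ) (kineticSymbol_nonneg ξ) u
  have h2 : ∀ j : Fin 3, ‖momentumFieldSymbol Q S s j ξ u‖ ^ 2 = (2 * Real.pi * ξ j) ^ 2
      * ‖S (u - (kineticSymbol ξ : ℂ) • Q (kineticSymbol ξ + s) u)‖ ^ 2 := by
    intro j
    rw [momentumFieldSymbol, _root_.smul_apply, norm_smul, mul_pow, Complex.norm_real,
      Real.norm_eq_abs, sq_abs]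
    rfl
  simp only [h2, ← Finset.sum_mul, sum_momentumSymbol_sq]
  exact h

theorem bddCont_momentumFieldSymbol (j : Fin 3) : BddCont (momentumFieldSymbol Q S s j) := by
  refine ⟨?_, 1, fun ξ => ContinuousLinearMap.opNorm_le_bound _ zero_le_one fun u => ?_⟩
  · have h1 := ((bddCont_const S).comp (hQ.family.bddCont_fieldSymbol hs)).1
    have h2 : Continuous fun ξ : R3 => ((2 * Real.pi * ξ j : ℝ) : ℂ) := by fun_prop
    exact h2.smul h1
  · have h1 := Finset.single_le_sum (f := fun j => ‖momentumFieldSymbol Q S s j ξ u‖ ^ 2)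
      (fun i _ => sq_nonneg _) (Finset.mem_univ j)
    have h2 := h1.trans (norm_momentumFieldSymbol_le hQ hs hS ξ u)
    rw [one_mul]
    refine (pow_le_pow_iff_left₀ (norm_nonneg _) (norm_nonneg _) two_ne_zero).mp ?_
    linarith [sq_nonneg ‖u‖]

theorem sum_norm_momentumField_sq_le (y : ParticleSpace K) :
    ∑ j, ‖fourierMul (momentumFieldSymbol Q S s j) y‖ ^ 2 ≤ (1 / 2) * ‖y‖ ^ 2 :=
  sum_norm_fourierMul_sq_le (bddCont_momentumFieldSymbol hQ hs hS)
    (norm_momentumFieldSymbol_le hQ hs hS) y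

/-- Cauchy-Schwarz over the three components turns the bound 1/2 on the sum of squares into √(3/2).
-/
theorem sum_norm_momentumField_le (y : ParticleSpace K) :
    ∑ j, ‖fourierMul (momentumFieldSymbol Q S s j) y‖ ≤ Real.sqrt (3 / 2) * ‖y‖ := by
  have h := sum_norm_momentumField_sq_le hQ hs hS y
  have h2 := sq_sum_le_card_mul_sum_sq (s := Finset.univ)
    (f := fun j => ‖fourierMul (momentumFieldSymbol Q S s j) y‖)
  simp only [Finset.card_univ, Fintype.card_fin] at h2
  refine abs_le_of_sq_le_sq' ?_ (by positivity) |>.2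
  rw [mul_pow, Real.sq_sqrt (by norm_num)]
  refine h2.trans ?_
  push_cast
  linarith

theorem norm_fieldSymbol_le (y : ParticleSpace K) : ‖fourierMul (fieldSymbol Q s) y‖ ≤ ‖y‖ := by
  have := norm_fourierMul_le (hQ.family.bddCont_fieldSymbol hs) (C := 1) (fun ξ =>
    ContinuousLinearMap.opNorm_le_bound _ zero_le_one fun u => by
      rw [one_mul]
      exact hS.norm_sub_le _ (kineticSymbol_nonneg ξ) u) y
  rwa [one_mul] at this

/-- The terms quadratic in the field need one factor (T + s)^(-1/2) for each field operator. -/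
theorem freeResolvent_eq_invSqrt (y : ParticleSpace K) : freeResolvent Q s y
    = fiberCLM (fun _ => S) (fiberCLM (fun _ => S) (fourierMul (fieldSymbol Q s) y)) := by
  rw [freeResolvent_eq hQ hs, fiberCLM_comp (bddCont_const S) (bddCont_const S), hS.sq]

theorem momentum_invSqrt_mem (j : Fin 3) (y : ParticleSpace K) :
    (fiberCLM (fun _ => S) (fourierMul (fieldSymbol Q s) y),
      fourierMul (momentumFieldSymbol Q S s j) y) ∈ (momentum K j).graph := by
  have h0 := hQ.family.bddCont_fieldSymbol hs
  rw [fiberCLM_const_fourierMul S h0]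
  exact mem_momentum_fourierMul ((bddCont_const S).comp h0)
    (bddCont_momentumFieldSymbol hQ hs hS j) (fun _ => rfl) y

theorem momentum_freeResolvent_mem (j : Fin 3) (y : ParticleSpace K) :
    (freeResolvent Q s y, fiberCLM (fun _ => S) (fourierMul (momentumFieldSymbol Q S s j) y))
      ∈ (momentum K j).graph := by
  have e : fiberCLM (fun _ => S) (fourierMul (momentumFieldSymbol Q S s j) y) = fourierMul
      (fun ξ => ((2 * Real.pi * ξ j : ℝ) : ℂ) • Q (kineticSymbol ξ + s)) y := by
    rw [fiberCLM_const_fourierMul S (bddCont_momentumFieldSymbol hQ hs hS j)]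
    refine fourierMul_congr (fun ξ => ?_) y
    rw [momentumFieldSymbol, ContinuousLinearMap.comp_smul, ← ContinuousLinearMap.comp_assoc, hS.sq,
      hQ.family.comp_fieldSymbol hs]
  rw [e]
  exact hQ.family.momentum_mem hs j y

end HalfPower

/-! ### The interaction -/

/-- The interaction for general field operators. -/
def fieldInteraction (e : ℝ) (A A' : Fin 3 → R3 → K →ₗ.[ℂ] K) :
    ParticleSpace K →ₗ.[ℂ] ParticleSpace K :=
  (e : ℂ) • ∑ j, (opComp (momentum K j) (fiberOp (A j))
      + opComp (fiberOp (A' j)) (momentum K j))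
    + ((e : ℂ) ^ 2 / 2) • ∑ j, (opComp (fiberOp (A j)) (fiberOp (A j))
      + (2 : ℂ) • opComp (fiberOp (A' j)) (fiberOp (A j))
      + opComp (fiberOp (A' j)) (fiberOp (A' j)))

theorem fieldInteraction_symm (e : ℝ) {A A' : Fin 3 → R3 → K →ₗ.[ℂ] K}
    (h : ∀ j x, AdjointPair (A j x) (A' j x)) :
    AdjointPair (fieldInteraction e A A') (fieldInteraction e A A') := by
  have hA : ∀ j, AdjointPair (fiberOp (A j)) (fiberOp (A' j)) := fun j => AdjointPair.fiberOp (h j)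
  refine AdjointPair.add (AdjointPair.smul (AdjointPair.sum fun j => ?_) (Complex.conj_ofReal e))
    (AdjointPair.smul (AdjointPair.sum fun j => ?_) ?_)
  · exact ((hA j).comp (momentum_symm j)).swap_add
  · have h1 := ((hA j).comp (hA j)).swap_add
    have h2 : AdjointPair ((2 : ℂ) • opComp (fiberOp (A' j)) (fiberOp (A j)))
        ((2 : ℂ) • opComp (fiberOp (A' j)) (fiberOp (A j))) :=
      ((hA j).comp (hA j).symm).smul (Complex.conj_ofNat 2)
    -- A² and A*² are exchanged by taking adjoints, while A*A is symmetric by itself, so the middle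
    -- term is moved to the end.
    rw [add_right_comm]
    exact h1.add h2
  · rw [← Complex.ofReal_pow, ← Complex.ofReal_ofNat, ← Complex.ofReal_div, Complex.conj_ofReal]

/-- Bounded operators that express the field operators `A`, `A'` relative to `S`. -/
structure FieldBounds (S : K →L[ℂ] K) (A A' : Fin 3 → R3 → K →ₗ.[ℂ] K)
    (a₁ a₁' a₂ c₀ c₁ : Fin 3 → R3 → K →L[ℂ] K) (N N' : ℝ) : Prop where
  mem_A : ∀ j x u, (S u, a₁ j x u) ∈ (A j x).graph
  mem_A' : ∀ j x u, (S u, c₀ j x u) ∈ (A' j x).graph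
  comm_A : ∀ j x u, a₁ j x (S u) = S (a₂ j x u)
  comm_A' : ∀ j x u, c₀ j x (S u) = S (c₁ j x u)
  cont_a₁ : ∀ j, Continuous (a₁ j)
  cont_a₁' : ∀ j, Continuous (a₁' j)
  cont_a₂ : ∀ j, Continuous (a₂ j)
  cont_c₀ : ∀ j, Continuous (c₀ j)
  cont_c₁ : ∀ j, Continuous (c₁ j)
  deriv : ∀ j x, HasLineDerivAt ℝ (a₁ j) (a₁' j x) x (basisVec j)
  le_a₁ : ∀ j x, ‖a₁ j x‖ ≤ N
  le_a₁' : ∀ j x, ‖a₁' j x‖ ≤ N'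
  le_a₂ : ∀ j x, ‖a₂ j x‖ ≤ N
  le_c₀ : ∀ j x, ‖c₀ j x‖ ≤ N
  le_c₁ : ∀ j x, ‖c₁ j x‖ ≤ N

/-- Write the free resolvent of y as SSu. A field operator consumes one S; in quadratic terms the
intertwining relations first carry the remaining S past it, ready for the second field operator. In
the linear terms one half power goes to the field operator and the other is absorbed in (T+s)^(1/2)
p_j times the resolvent. -/
theorem exists_fieldInteraction_mem {T : K →ₗ.[ℂ] K} {Q : ℝ → K →L[ℂ] K} (hQ : IsResolventOf T Q)
    {s : ℝ} (hs : 0 < s) {S : K →L[ℂ] K} (hS : IsInvSqrt Q s S)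
    {A A' : Fin 3 → R3 → K →ₗ.[ℂ] K} {a₁ a₁' a₂ c₀ c₁ : Fin 3 → R3 → K →L[ℂ] K} {N N' : ℝ}
    (hF : FieldBounds S A A' a₁ a₁' a₂ c₀ c₁ N N') (e : ℝ) (y : ParticleSpace K) :
    ∃ w, (freeResolvent Q s y, w) ∈ (fieldInteraction e A A').graph ∧
      ‖w‖ ≤ (|e| * (2 * N * Real.sqrt (3 / 2) + 3 * (N' * (Real.sqrt s)⁻¹)) + 6 * e ^ 2 * N ^ 2)
        * ‖y‖ := by
  have b₁ : ∀ j, BddCont (a₁ j) := fun j => ⟨hF.cont_a₁ j, N, hF.le_a₁ j⟩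
  have b₁' : ∀ j, BddCont (a₁' j) := fun j => ⟨hF.cont_a₁' j, N', hF.le_a₁' j⟩
  have b₂ : ∀ j, BddCont (a₂ j) := fun j => ⟨hF.cont_a₂ j, N, hF.le_a₂ j⟩
  have d₀ : ∀ j, BddCont (c₀ j) := fun j => ⟨hF.cont_c₀ j, N, hF.le_c₀ j⟩
  have d₁ : ∀ j, BddCont (c₁ j) := fun j => ⟨hF.cont_c₁ j, N, hF.le_c₁ j⟩
  have hN : 0 ≤ N := (norm_nonneg _).trans (hF.le_a₁ 0 0)
  have hN' : 0 ≤ N' := (norm_nonneg _).trans (hF.le_a₁' 0 0)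
  have bS : BddCont fun _ : R3 => S := bddCont_const S
  set u := fourierMul (fieldSymbol Q s) y with hu
  set G : Fin 3 → ParticleSpace K := fun j => fourierMul (momentumFieldSymbol Q S s j) y with hG
  have hR : freeResolvent Q s y = fiberCLM (fun _ => S) (fiberCLM (fun _ => S) u) :=
    freeResolvent_eq_invSqrt hQ hs hS y
  have mA : ∀ j ψ, (fiberCLM (fun _ => S) ψ, fiberCLM (a₁ j) ψ) ∈ (fiberOp (A j)).graph :=
    fun j => mem_fiberOp_of_forall bS (b₁ j) (hF.mem_A j)
  have mA' : ∀ j ψ, (fiberCLM (fun _ => S) ψ, fiberCLM (c₀ j) ψ) ∈ (fiberOp (A' j)).graph :=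
    fun j => mem_fiberOp_of_forall bS (d₀ j) (hF.mem_A' j)
  have cA : ∀ j ψ, fiberCLM (a₁ j) (fiberCLM (fun _ => S) ψ)
      = fiberCLM (fun _ => S) (fiberCLM (a₂ j) ψ) := by
    intro j ψ
    rw [fiberCLM_comp (b₁ j) bS, fiberCLM_comp bS (b₂ j)]
    congr 2
    exact funext fun x => ContinuousLinearMap.ext fun v => hF.comm_A j x v
  have cA' : ∀ j ψ, fiberCLM (c₀ j) (fiberCLM (fun _ => S) ψ)
      = fiberCLM (fun _ => S) (fiberCLM (c₁ j) ψ) := by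
    intro j ψ
    rw [fiberCLM_comp (d₀ j) bS, fiberCLM_comp bS (d₁ j)]
    congr 2
    exact funext fun x => ContinuousLinearMap.ext fun v => hF.comm_A' j x v
  -- Here p_j acts after A_j, so the product rule also yields the derivative of the coupling
  -- function in x; this term carries an extra s^(-1/2) and vanishes as s → ∞.
  have m1 : ∀ j, (freeResolvent Q s y,
      fiberCLM (a₁ j) (G j) - Complex.I • fiberCLM (a₁' j) (fiberCLM (fun _ => S) u))
      ∈ (opComp (momentum K j) (fiberOp (A j))).graph := by
    intro j
    refine mem_graph_opComp_iff.mpr ⟨fiberCLM (a₁ j) (fiberCLM (fun _ => S) u), ?_, ?_⟩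
    · rw [hR]
      exact mA j _
    · exact momentum_leibniz (b₁ j) (b₁' j) (hF.deriv j) (momentum_invSqrt_mem hQ hs hS j y)
  have m2 : ∀ j, (freeResolvent Q s y, fiberCLM (c₀ j) (G j))
      ∈ (opComp (fiberOp (A' j)) (momentum K j)).graph := fun j =>
    mem_graph_opComp_iff.mpr ⟨_, momentum_freeResolvent_mem hQ hs hS j y, mA' j _⟩
  have m3 : ∀ j, (freeResolvent Q s y, fiberCLM (a₁ j) (fiberCLM (a₂ j) u))
      ∈ (opComp (fiberOp (A j)) (fiberOp (A j))).graph := by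
    intro j
    refine mem_graph_opComp_iff.mpr ⟨fiberCLM (a₁ j) (fiberCLM (fun _ => S) u), ?_, ?_⟩
    · rw [hR]
      exact mA j _
    · rw [cA]
      exact mA j _
  have m4 : ∀ j, (freeResolvent Q s y, fiberCLM (c₀ j) (fiberCLM (a₂ j) u))
      ∈ (opComp (fiberOp (A' j)) (fiberOp (A j))).graph := by
    intro j
    refine mem_graph_opComp_iff.mpr ⟨fiberCLM (a₁ j) (fiberCLM (fun _ => S) u), ?_, ?_⟩
    · rw [hR]
      exact mA j _
    · rw [cA]
      exact mA' j _
  have m5 : ∀ j, (freeResolvent Q s y, fiberCLM (c₀ j) (fiberCLM (c₁ j) u))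
      ∈ (opComp (fiberOp (A' j)) (fiberOp (A' j))).graph := by
    intro j
    refine mem_graph_opComp_iff.mpr ⟨fiberCLM (c₀ j) (fiberCLM (fun _ => S) u), ?_, ?_⟩
    · rw [hR]
      exact mA' j _
    · rw [cA']
      exact mA' j _
  refine ⟨(e : ℂ) • ∑ j, (fiberCLM (a₁ j) (G j)
      - Complex.I • fiberCLM (a₁' j) (fiberCLM (fun _ => S) u) + fiberCLM (c₀ j) (G j))
      + ((e : ℂ) ^ 2 / 2) • ∑ j, (fiberCLM (a₁ j) (fiberCLM (a₂ j) u)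
      + (2 : ℂ) • fiberCLM (c₀ j) (fiberCLM (a₂ j) u) + fiberCLM (c₀ j) (fiberCLM (c₁ j) u)),
    mem_graph_add_iff.mpr ⟨_, _, mem_graph_smul_iff.mpr ⟨_, mem_graph_sum_iff.mpr
    ⟨_, fun j => mem_graph_add_iff.mpr ⟨_, _, m1 j, m2 j, rfl⟩, rfl⟩, rfl⟩,
    mem_graph_smul_iff.mpr ⟨_, mem_graph_sum_iff.mpr ⟨_, fun j => mem_graph_add_iff.mpr ⟨_, _,
    mem_graph_add_iff.mpr ⟨_, _, m3 j, mem_graph_smul_iff.mpr ⟨_, m4 j, rfl⟩, rfl⟩, m5 j, rfl⟩,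
    rfl⟩, rfl⟩, rfl⟩, ?_⟩
  have hu1 : ‖u‖ ≤ ‖y‖ := norm_fieldSymbol_le hQ hs hS y
  have hSu : ‖fiberCLM (fun _ => S) u‖ ≤ (Real.sqrt s)⁻¹ * ‖y‖ := by
    refine (norm_fiberCLM_le bS (C := (Real.sqrt s)⁻¹) (fun _ =>
      ContinuousLinearMap.opNorm_le_bound _ (by positivity) hS.norm_le) u).trans ?_
    gcongr
  have n0 : ∀ j, ‖fiberCLM (a₂ j) u‖ ≤ N * ‖y‖ := fun j =>
    (norm_fiberCLM_le (b₂ j) (hF.le_a₂ j) u).trans (by gcongr)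
  have n0' : ∀ j, ‖fiberCLM (c₁ j) u‖ ≤ N * ‖y‖ := fun j =>
    (norm_fiberCLM_le (d₁ j) (hF.le_c₁ j) u).trans (by gcongr)
  have n3 : ∀ j, ‖fiberCLM (a₁ j) (fiberCLM (a₂ j) u)‖ ≤ N * (N * ‖y‖) := fun j =>
    (norm_fiberCLM_le (b₁ j) (hF.le_a₁ j) _).trans (by gcongr; exact n0 j)
  have n4 : ∀ j, ‖fiberCLM (c₀ j) (fiberCLM (a₂ j) u)‖ ≤ N * (N * ‖y‖) := fun j =>
    (norm_fiberCLM_le (d₀ j) (hF.le_c₀ j) _).trans (by gcongr; exact n0 j)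
  have n5 : ∀ j, ‖fiberCLM (c₀ j) (fiberCLM (c₁ j) u)‖ ≤ N * (N * ‖y‖) := fun j =>
    (norm_fiberCLM_le (d₀ j) (hF.le_c₀ j) _).trans (by gcongr; exact n0' j)
  have n1 : ∀ j, ‖fiberCLM (a₁' j) (fiberCLM (fun _ => S) u)‖
      ≤ N' * ((Real.sqrt s)⁻¹ * ‖y‖) := fun j =>
    (norm_fiberCLM_le (b₁' j) (hF.le_a₁' j) _).trans (by gcongr)
  have k1 : ‖∑ j, (fiberCLM (a₁ j) (G j) - Complex.I • fiberCLM (a₁' j) (fiberCLM (fun _ => S) u)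
      + fiberCLM (c₀ j) (G j))‖
      ≤ (2 * N * Real.sqrt (3 / 2) + 3 * (N' * (Real.sqrt s)⁻¹)) * ‖y‖ := by
    calc _ ≤ ∑ j, (2 * N * ‖G j‖ + N' * ((Real.sqrt s)⁻¹ * ‖y‖)) := by
          refine norm_sum_le_of_le _ fun j _ => ?_
          refine (norm_add_le _ _).trans ?_
          have e1 := norm_sub_le (fiberCLM (a₁ j) (G j))
            (Complex.I • fiberCLM (a₁' j) (fiberCLM (fun _ => S) u))
          rw [norm_smul, Complex.norm_I, one_mul] at e1
          have e2 := norm_fiberCLM_le (b₁ j) (hF.le_a₁ j) (G j)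
          have e3 := norm_fiberCLM_le (d₀ j) (hF.le_c₀ j) (G j)
          linarith [n1 j]
      _ = 2 * N * ∑ j, ‖G j‖ + 3 * (N' * ((Real.sqrt s)⁻¹ * ‖y‖)) := by
          simp only [Fin.sum_univ_three]
          ring
      _ ≤ 2 * N * (Real.sqrt (3 / 2) * ‖y‖) + 3 * (N' * ((Real.sqrt s)⁻¹ * ‖y‖)) := by
          gcongr
          exact sum_norm_momentumField_le hQ hs hS y
      _ = _ := by ring
  have k2 : ‖∑ j, (fiberCLM (a₁ j) (fiberCLM (a₂ j) u)
      + (2 : ℂ) • fiberCLM (c₀ j) (fiberCLM (a₂ j) u) + fiberCLM (c₀ j) (fiberCLM (c₁ j) u))‖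
      ≤ 12 * N ^ 2 * ‖y‖ := by
    -- The weights 1 + 2 + 1 of A², A*A and A*² over three components make 12; the prefactor e²/2
    -- turns this into 6e².
    calc _ ≤ ∑ _j : Fin 3, 4 * (N * (N * ‖y‖)) := by
          refine norm_sum_le_of_le _ fun j _ => ?_
          refine (norm_add₃_le).trans ?_
          rw [norm_smul, Complex.norm_ofNat]
          linarith [n3 j, n4 j, n5 j]
      _ = _ := by
          simp only [Fin.sum_univ_three]
          ring
  refine (norm_add_le _ _).trans ?_
  rw [norm_smul, norm_smul, Complex.norm_real, Real.norm_eq_abs, norm_div, norm_pow,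
    Complex.norm_real, Real.norm_eq_abs, sq_abs, Complex.norm_ofNat]
  have k3 := mul_le_mul_of_nonneg_left k1 (abs_nonneg e)
  have k4 := mul_le_mul_of_nonneg_left k2 (show 0 ≤ e ^ 2 / 2 by positivity)
  linarith

end Perturbation

/-! ### Regular values of the Hamiltonians -/

section RegularValues

open Filter Topology

/-! ### Relatively bounded perturbations of the free Hamiltonian, and adjoints of operator families.
-/

section Abstract

variable {K : Type*} [NormedAddCommGroup K] [InnerProductSpace ℂ K] [CompleteSpace K]

/-- Hardy's inequality combined with Σ‖p_j R y‖² ≤ ‖y‖²/(2s). The decay in s means that the Coulomb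
potential does not restrict the charge. -/
theorem exists_coulomb_freeResolvent_mem {T : K →ₗ.[ℂ] K} {Q : ℝ → K →L[ℂ] K}
    (hQ : IsResolventOf T Q) {s : ℝ} (hs : 0 < s) {V : R3 → ℝ} {α : ℝ}
    (hV : ∀ x, V x = -(α * ‖x‖⁻¹)) (y : ParticleSpace K) :
    ∃ w, (freeResolvent Q s y, w) ∈
      (potential V : ParticleSpace K →ₗ.[ℂ] ParticleSpace K).graph ∧
      ‖w‖ ≤ 2 * |α| * (Real.sqrt s)⁻¹ * ‖y‖ := by
  obtain ⟨w, h1, h2⟩ := exists_potential_mem (fun j => hQ.family.momentum_mem hs j y) hV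
  refine ⟨w, h1, ?_⟩
  refine (pow_le_pow_iff_left₀ (norm_nonneg _) (by positivity) two_ne_zero).mp ?_
  have h3 := hQ.family.sum_norm_momentum_sq_le hs y
  rw [mul_pow, mul_pow, mul_pow, inv_pow, Real.sq_sqrt hs.le, sq_abs]
  calc ‖w‖ ^ 2 ≤ 4 * α ^ 2 * ((2 * s)⁻¹ * ‖y‖ ^ 2) := h2.trans (by gcongr)
    _ = 2 * (α ^ 2 * s⁻¹ * ‖y‖ ^ 2) := by rw [mul_inv]; ring
    _ ≤ _ := by
      have : 0 ≤ α ^ 2 * s⁻¹ * ‖y‖ ^ 2 := by positivity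
      linarith

/-- Kato-Rellich: a perturbation `B` of the free Hamiltonian with relative bound less than one. -/
theorem isRegularValue_of_perturbation {T : K →ₗ.[ℂ] K} {Q : ℝ → K →L[ℂ] K}
    (hQ : IsResolventOf T Q) {s : ℝ} (hs : 0 < s) {q : ℝ} (hq : q < 1)
    {H B : ParticleSpace K →ₗ.[ℂ] ParticleSpace K}
    (hH : ∀ x z, (x, z) ∈ H.graph ↔ ∃ χ η w, (x, χ) ∈ (kinetic K).graph ∧
      (x, η) ∈ (fiberOp fun _ => T).graph ∧ (x, w) ∈ B.graph ∧ z = χ + η + w)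
    (hB : ∀ y, ∃ w, (freeResolvent Q s y, w) ∈ B.graph ∧ ‖w‖ ≤ q * ‖y‖) :
    IsRegularValue H ((-s : ℝ) : ℂ) := by
  refine isRegularValue_of_relBounded H (freeResolvent Q s) s q hq (fun y => ?_) fun x hx => ?_
  · obtain ⟨w, h1, h2⟩ := hB y
    exact ⟨w, (hH _ _).mpr ⟨_, _, w, freeResolvent_mem_kinetic hQ hs y,
      freeResolvent_mem_fiberOp hQ hs y, h1, by abel⟩, h2⟩
  · obtain ⟨χ, η, w, h1, h2, -, -⟩ := (hH _ _).mp (H.mem_graph ⟨x, hx⟩)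
    exact ⟨_, freeResolvent_of_mem hQ hs h1 h2⟩

theorem hasLineDerivAt_adjoint {D : R3 → K →L[ℂ] K} {D' : K →L[ℂ] K} {x v : R3}
    (h : HasLineDerivAt ℝ D D' x v) :
    HasLineDerivAt ℝ (fun y => ContinuousLinearMap.adjoint (D y))
      (ContinuousLinearMap.adjoint D') x v := by
  have h1 : HasDerivAt (fun t : ℝ => star (D (x + t • v))) (star D') 0 := HasDerivAt.star h
  exact h1

theorem continuous_adjoint {D : R3 → K →L[ℂ] K} (h : Continuous D) :
    Continuous fun y => ContinuousLinearMap.adjoint (D y) :=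
  ContinuousLinearMap.adjoint.continuous.comp h

theorem norm_adjoint_le {B : K →L[ℂ] K} {C : ℝ} (h : ‖B‖ ≤ C) :
    ‖ContinuousLinearMap.adjoint B‖ ≤ C :=
  (ContinuousLinearMap.adjoint.norm_map B).trans_le h

theorem continuous_neg_I_smul {D : R3 → K →L[ℂ] K} (h : Continuous D) :
    Continuous fun y => -(Complex.I • D y) := (h.const_smul Complex.I).neg

theorem norm_neg_I_smul_le {B : K →L[ℂ] K} {C : ℝ} (h : ‖B‖ ≤ C) : ‖-(Complex.I • B)‖ ≤ C := by
  rw [norm_neg, norm_smul, Complex.norm_I, one_mul]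
  exact h

end Abstract

/-! ### The field operators -/

theorem isResolventOf_field : IsResolventOf fieldEnergy fieldResolvent where
  family := isResolventFamily_field
  mem _ hs u := fieldResolvent_mem hs u
  of_mem _ hs _ _ h := fieldResolvent_of_mem hs h

theorem rpow_neg_half {s : ℝ} (hs : 0 ≤ s) : s ^ (-(1 / 2) : ℝ) = (Real.sqrt s)⁻¹ := by
  rw [Real.rpow_neg hs, Real.sqrt_eq_rpow]

theorem bdd_one_sub {a s : ℝ} (ha : 0 ≤ a) (hs : 0 < s) :
    BddEnergyFun (fun E => 1 - a * (E + (a + s))⁻¹) 1 := by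
  refine ⟨by fun_prop, fun E hE => ?_⟩
  have h1 : a * (E + (a + s))⁻¹ ≤ 1 := by
    rw [mul_inv_le_iff₀ (by positivity)]
    linarith
  have h2 : 0 ≤ a * (E + (a + s))⁻¹ := by positivity
  rw [abs_le]
  constructor <;> linarith

theorem eMul_one_sub {a s : ℝ} (ha : 0 ≤ a) (hs : 0 < s) (u : FockSpace) :
    u - (a : ℂ) • fieldResolvent (a + s) u = eMul (fun E => 1 - a * (E + (a + s))⁻¹) u := by
  have := IsFockMul.unique ((isFockMul_one.sub
    ((bdd_fieldResolvent (by positivity : 0 < a + s)).isFockMul.smul (a : ℂ))).congr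
    fun n k => by push_cast; ring) (bdd_one_sub ha hs).isFockMul
  exact congrArg (fun B : FockSpace →L[ℂ] FockSpace => B u) this

/-- The function equals √(E+s)/(E+s+a), at most 1/(2√a) by the inequality of arithmetic and
geometric means. -/
theorem bdd_half_mul {a s : ℝ} (ha : 0 < a) (hs : 0 < s) :
    BddEnergyFun (fun E => (E + s) ^ (-(1 / 2) : ℝ) * (1 - a * (E + (a + s))⁻¹))
      (2 * Real.sqrt a)⁻¹ := by
  refine ⟨by fun_prop, fun E hE => ?_⟩
  have hE' : 0 < E + s := by positivity
  have e1 : 1 - a * (E + (a + s))⁻¹ = (E + s) * (E + (a + s))⁻¹ := by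
    field_simp
    ring
  dsimp only
  rw [e1, rpow_neg_half hE'.le, abs_of_nonneg (by positivity), ← mul_assoc, ← div_eq_mul_inv,
    le_inv_comm₀ (by positivity) (by positivity)]
  have h1 := Real.sq_sqrt ha.le
  have h2 := Real.sq_sqrt hE'.le
  have h3 : 0 < Real.sqrt (E + s) := Real.sqrt_pos.mpr hE'
  have e2 : (√(E + s))⁻¹ * (E + s) = √(E + s) := by
    rw [inv_mul_eq_div, Real.div_sqrt]
  rw [e2, inv_div, le_div_iff₀ h3]
  nlinarith [sq_nonneg (√(E + s) - √a)]

theorem isInvSqrt_field {s : ℝ} (hs : 0 < s) :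
    IsInvSqrt fieldResolvent s (fieldInvSqrt s) where
  sq := fieldInvSqrt_sq hs
  norm_le u := by
    have := (bdd_fieldInvSqrt hs).norm_le
    rw [rpow_neg_half hs.le] at this
    exact (fieldInvSqrt s).le_of_opNorm_le this u
  norm_sub_le a ha u := by
    rw [eMul_one_sub ha hs]
    have := (eMul _).le_of_opNorm_le (bdd_one_sub ha hs).norm_le u
    rwa [one_mul] at this
  norm_comp_sub_le a ha u := by
    rcases ha.eq_or_lt with rfl | ha'
    · rw [mul_zero, zero_mul]
      positivity
    · have e := IsFockMul.unique (((bdd_fieldInvSqrt hs).isFockMul.comp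
        (bdd_one_sub ha hs).isFockMul).congr fun n k => (Complex.ofReal_mul _ _).symm)
        (bdd_half_mul ha' hs).isFockMul
      have e' := congrArg (fun B : FockSpace →L[ℂ] FockSpace => B u) e
      rw [eMul_one_sub ha hs]
      have h1 := (eMul _).le_of_opNorm_le (bdd_half_mul ha' hs).norm_le u
      have h2 : ‖fieldInvSqrt s (eMul (fun E => 1 - a * (E + (a + s))⁻¹) u)‖
          ≤ (2 * Real.sqrt a)⁻¹ * ‖u‖ := (congrArg norm e').trans_le h1
      calc _ ≤ 2 * a * ((2 * Real.sqrt a)⁻¹ * ‖u‖) ^ 2 := by gcongr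
        _ = (1 / 2) * ‖u‖ ^ 2 := by
          rw [mul_pow, inv_pow, mul_pow, Real.sq_sqrt ha]
          field_simp

/-- The constant `(√2 π)⁻¹`. -/
def couplingConst : ℝ := (Real.sqrt 2 * Real.pi)⁻¹

/-! ### The weighted operators for the coupling functions of the model. -/

section Concrete

variable {m κ Λ s : ℝ} (hm : 0 < m) (hκ : 0 < κ) (hΛ : 0 < Λ) (hs : 0 < s)
include hm hκ

theorem adm_coupling (j : Fin 3) (x : R3) : Adm (coupling m κ Λ j x) (Λ / m) :=
  adm_planeWave (adm_refAmplitude hm hκ) (measurable_amplitude m κ Λ j) zero_le_one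
    (abs_amplitude_le m κ Λ j) x

include hΛ hs

theorem norm_cr_coupling_le {p : ℝ} (hp : -1 ≤ p) (hp' : p ≤ 1 / 2) (j : Fin 3) (x : R3) :
    ‖cr s p (coupling m κ Λ j x)‖ ≤ (1 + Λ / m / s) * couplingConst := by
  have hL : 0 ≤ Λ / m := by positivity
  refine (norm_cr_planeWave_le (adm_refAmplitude hm hκ) (measurable_amplitude m κ Λ j) zero_le_one
    (abs_amplitude_le m κ Λ j) hs hL hp hp' x).trans ?_
  rw [one_mul]
  gcongr
  exact wnorm_refAmplitude_le hm hκ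

theorem continuous_cr_coupling {p : ℝ} (hp : -1 ≤ p) (hp' : p ≤ 1 / 2) (j : Fin 3) :
    Continuous fun x => cr s p (coupling m κ Λ j x) :=
  continuous_cr_planeWave (adm_refAmplitude hm hκ) (measurable_amplitude m κ Λ j) zero_le_one
    (abs_amplitude_le m κ Λ j) hs (by positivity) hp hp'

/-- The exponents p = -1/2 and -1, after taking adjoints, serve annihilation as first and as second
factor; p = 0 and 1/2 do the same for creation. The derivative costs a further Λ/m, the radius of
the support. -/
theorem fieldBounds_coupling : FieldBounds (fieldInvSqrt s)
    (fun j x => annihilation (coupling m κ Λ j x)) (fun j x => creation (coupling m κ Λ j x))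
    (fun j x => ContinuousLinearMap.adjoint (cr s (-(1 / 2)) (coupling m κ Λ j x)))
    (fun j x => ContinuousLinearMap.adjoint (-(Complex.I • cr s (-(1 / 2))
      (planeWave (fun k => k j * amplitude m κ Λ j k) x))))
    (fun j x => ContinuousLinearMap.adjoint (cr s (-1) (coupling m κ Λ j x)))
    (fun j x => cr s 0 (coupling m κ Λ j x)) (fun j x => cr s (1 / 2) (coupling m κ Λ j x))
    ((1 + Λ / m / s) * couplingConst) ((1 + Λ / m / s) * (Λ / m * couplingConst)) := by
  have hL : 0 ≤ Λ / m := by positivity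
  have hA := adm_refAmplitude (Λ := Λ) hm hκ
  have hmj : ∀ j, Measurable fun k : R3 => k j * amplitude m κ Λ j k := fun j => by
    have := measurable_amplitude m κ Λ j
    fun_prop
  have hle : ∀ j k, |k j * amplitude m κ Λ j k| ≤ (Λ / m * 1) * ‖refAmplitude m κ Λ k‖ := fun j =>
    coord_amplitude_le hA (measurable_amplitude m κ Λ j) zero_le_one
    (abs_amplitude_le m κ Λ j) hL j
  refine
    { mem_A := fun j x u => cr_mem_annihilation (adm_coupling hm hκ j x) hs hL u
      mem_A' := fun j x u => cr_mem_creation (adm_coupling hm hκ j x) hs hL u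
      comm_A := fun j x u => adjoint_cr_fieldInvSqrt (adm_coupling hm hκ j x) hs hL u
      comm_A' := fun j x u => cr_zero_fieldInvSqrt (adm_coupling hm hκ j x) hs hL u
      cont_a₁ := fun j => continuous_adjoint
        (continuous_cr_coupling hm hκ hΛ hs (by norm_num) (by norm_num) j)
      cont_a₁' := fun j => continuous_adjoint (continuous_neg_I_smul
        (continuous_cr_planeWave hA (hmj j) (by positivity) (hle j) hs hL (by norm_num)
          (by norm_num)))
      cont_a₂ := fun j => continuous_adjoint
        (continuous_cr_coupling hm hκ hΛ hs le_rfl (by norm_num) j)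
      cont_c₀ := fun j => continuous_cr_coupling hm hκ hΛ hs (by norm_num) (by norm_num) j
      cont_c₁ := fun j => continuous_cr_coupling hm hκ hΛ hs (by norm_num) le_rfl j
      deriv := fun j x => hasLineDerivAt_adjoint (hasLineDerivAt_cr_planeWave hA
        (measurable_amplitude m κ Λ j) zero_le_one (abs_amplitude_le m κ Λ j) hs hL (by norm_num)
          (by norm_num) j x)
      le_a₁ := fun j x => norm_adjoint_le
        (norm_cr_coupling_le hm hκ hΛ hs (by norm_num) (by norm_num) j x)
      le_a₁' := fun j x => norm_adjoint_le (norm_neg_I_smul_le ?_)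
      le_a₂ := fun j x => norm_adjoint_le
        (norm_cr_coupling_le hm hκ hΛ hs le_rfl (by norm_num) j x)
      le_c₀ := fun j x => norm_cr_coupling_le hm hκ hΛ hs (by norm_num) (by norm_num) j x
      le_c₁ := fun j x => norm_cr_coupling_le hm hκ hΛ hs (by norm_num) le_rfl j x }
  refine (norm_cr_planeWave_le hA (hmj j) (by positivity) (hle j) hs hL (by norm_num)
    (by norm_num) x).trans ?_
  rw [mul_one]
  gcongr
  exact wnorm_refAmplitude_le hm hκ

end Concrete

/-! ### Symmetry and regular values of the concrete Hamiltonians. -/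

theorem interaction_eq (m e κ Λ : ℝ) : interaction m e κ Λ = fieldInteraction e
    (fun j x => annihilation (coupling m κ Λ j x)) (fun j x => creation (coupling m κ Λ j x)) := rfl

theorem interaction_symm {m κ : ℝ} (hm : 0 < m) (hκ : 0 < κ) (e Λ : ℝ) :
    AdjointPair (interaction m e κ Λ) (interaction m e κ Λ) := by
  rw [interaction_eq]
  exact fieldInteraction_symm e fun j x => annihilation_creation (adm_coupling hm hκ j x)

theorem hamiltonianFree_symm {m κ : ℝ} (hm : 0 < m) (hκ : 0 < κ) (e Λ : ℝ) :
    AdjointPair (hamiltonianFree m e κ Λ) (hamiltonianFree m e κ Λ) :=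
  (kinetic_symm.add (AdjointPair.fiberOp fun _ => fieldEnergy_symm)).add
    (interaction_symm hm hκ e Λ)

theorem hamiltonian_symm {m κ : ℝ} (hm : 0 < m) (hκ : 0 < κ) (e Z Λ : ℝ) :
    AdjointPair (hamiltonian m e Z κ Λ) (hamiltonian m e Z κ Λ) :=
  ((kinetic_symm.add (potential_symm _)).add (AdjointPair.fiberOp fun _ => fieldEnergy_symm)).add
    (interaction_symm hm hκ e Λ)

/-- The relative bound of the interaction and a Coulomb potential of strength `α` at `-s`. -/
def relBound (L e α s : ℝ) : ℝ :=
  |e| * (2 * ((1 + L / s) * couplingConst) * Real.sqrt (3 / 2)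
      + 3 * ((1 + L / s) * (L * couplingConst) * (Real.sqrt s)⁻¹))
    + 6 * e ^ 2 * ((1 + L / s) * couplingConst) ^ 2 + 2 * |α| * (Real.sqrt s)⁻¹

/-- Termwise comparison with C_UV at its root t: the linear coefficient is at most 2/π (the square
root in C_UV is at least one), and the quadratic one is 12/(4π²) where C_UV has 14 + √6π in place of
12. -/
theorem relBound_limit_lt_one {Z e : ℝ} (heUV : |e| < chargeUV Z) :
    |e| * (2 * couplingConst * Real.sqrt (3 / 2)) + 6 * e ^ 2 * couplingConst ^ 2 < 1 := by
  obtain ⟨ht, ht1⟩ : 0 < chargeUV Z ∧ CUV Z (chargeUV Z) = 1 := (existsUnique_CUV Z).choose_spec.1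
  set t := chargeUV Z
  have hpi := Real.pi_pos
  have h0 := abs_nonneg e
  have e1 : 2 * couplingConst * Real.sqrt (3 / 2) ≤ 2 / Real.pi := by
    have h1 : Real.sqrt (3 / 2) ≤ Real.sqrt 2 := Real.sqrt_le_sqrt (by norm_num)
    have h2 : 0 < Real.sqrt 2 := by positivity
    calc 2 * couplingConst * Real.sqrt (3 / 2) ≤ 2 * couplingConst * Real.sqrt 2 := by
          unfold couplingConst
          gcongr
      _ = 2 / Real.pi := by
          unfold couplingConst
          field_simp
  have e2 : couplingConst ^ 2 = 1 / (2 * Real.pi ^ 2) := by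
    rw [couplingConst, inv_pow, mul_pow, Real.sq_sqrt (by norm_num), one_div]
  have e3 : (1 : ℝ) ≤ Real.sqrt (1 + 1 / 2 * (t ^ 2 * Z / (4 * Real.pi)) ^ 2) := by
    rw [Real.one_le_sqrt]
    have := sq_nonneg (t ^ 2 * Z / (4 * Real.pi))
    linarith
  have e4 : e ^ 2 < t ^ 2 := by
    rw [← sq_abs]
    gcongr
  have e5 : 2 * t / Real.pi * 1 ≤ 2 * t / Real.pi
      * Real.sqrt (1 + 1 / 2 * (t ^ 2 * Z / (4 * Real.pi)) ^ 2) := by gcongr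
  have e6 : |e| * (2 * couplingConst * Real.sqrt (3 / 2)) ≤ |e| * (2 / Real.pi) := by gcongr
  have e7 : |e| * (2 / Real.pi) < t * (2 / Real.pi) := by gcongr
  have e8 : 6 * e ^ 2 * couplingConst ^ 2
      ≤ 1 / (4 * Real.pi ^ 2) * (14 + Real.sqrt 6 * Real.pi) * t ^ 2 := by
    rw [e2]
    have h1 : 6 * e ^ 2 * (1 / (2 * Real.pi ^ 2)) = 1 / (4 * Real.pi ^ 2) * 12 * e ^ 2 := by
      field_simp
      ring
    rw [h1]
    have h2 : 0 ≤ Real.sqrt 6 * Real.pi := by positivity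
    gcongr
    linarith
  unfold CUV at ht1
  have e9 : 2 * t / Real.pi * 1 = t * (2 / Real.pi) := by ring
  linarith

theorem exists_relBound_lt_one {Z e : ℝ} (heUV : |e| < chargeUV Z) (L α : ℝ) :
    ∃ s₀, 0 ≤ s₀ ∧ ∀ s, s₀ < s → relBound L e α s < 1 := by
  have hs : Tendsto (fun s : ℝ => (Real.sqrt s)⁻¹) atTop (𝓝 0) :=
    tendsto_inv_atTop_zero.comp Real.tendsto_sqrt_atTop
  have hL : Tendsto (fun s : ℝ => 1 + L / s) atTop (𝓝 1) := by
    simpa using (tendsto_const_nhds.div_atTop tendsto_id).const_add (1 : ℝ)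
  have h1 : Tendsto (relBound L e α) atTop (𝓝 (|e| * (2 * (1 * couplingConst) * Real.sqrt (3 / 2)
      + 3 * (1 * (L * couplingConst) * 0)) + 6 * e ^ 2 * (1 * couplingConst) ^ 2
      + 2 * |α| * 0)) := by
    unfold relBound
    exact ((((((hL.mul_const _).const_mul 2).mul_const _).add
      (((hL.mul_const _).mul hs).const_mul 3)).const_mul _).add
      (((hL.mul_const _).pow 2).const_mul _)).add (hs.const_mul _)
  have h2 := relBound_limit_lt_one heUV
  have h3 := h1.eventually_lt_const (u := 1) (by
    simp only [one_mul, mul_zero, add_zero]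
    exact h2)
  obtain ⟨s₀, h4⟩ := eventually_atTop.mp h3
  exact ⟨max s₀ 0, le_max_right _ _, fun s hs => h4 s ((le_max_left _ _).trans hs.le)⟩

/-- The Coulomb strength. -/
def coulombStrength (e Z : ℝ) : ℝ := e ^ 2 * Z / (4 * Real.pi)

theorem coulomb_eq (e Z : ℝ) (x : R3) :
    -(e ^ 2 * Z / (4 * Real.pi * ‖x‖)) = -(coulombStrength e Z * ‖x‖⁻¹) := by
  rw [coulombStrength, ← div_eq_mul_inv, div_div]

theorem exists_interaction_mem {m κ Λ s : ℝ} (hm : 0 < m) (hκ : 0 < κ) (hΛ : 0 < Λ) (hs : 0 < s)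
    (e : ℝ) (y : StateSpace) :
    ∃ w, (freeResolvent fieldResolvent s y, w) ∈ (interaction m e κ Λ).graph ∧
      ‖w‖ ≤ relBound (Λ / m) e 0 s * ‖y‖ := by
  obtain ⟨w, h1, h2⟩ := exists_fieldInteraction_mem isResolventOf_field hs (isInvSqrt_field hs)
    (fieldBounds_coupling hm hκ hΛ hs) e y
  refine ⟨w, h1, h2.trans_eq ?_⟩
  rw [relBound, abs_zero, mul_zero, zero_mul, add_zero]

theorem isRegularValue_hamiltonianFree {m κ Λ e : ℝ} (hm : 0 < m) (hκ : 0 < κ) (hΛ : 0 < Λ)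
    {s : ℝ} (hs : 0 < s) (hq : relBound (Λ / m) e 0 s < 1) :
    IsRegularValue (hamiltonianFree m e κ Λ) ((-s : ℝ) : ℂ) := by
  refine isRegularValue_of_perturbation isResolventOf_field hs hq (B := interaction m e κ Λ)
    (fun x z => ?_) (exists_interaction_mem hm hκ hΛ hs e)
  simp only [hamiltonianFree, mem_graph_add_iff]
  constructor
  · rintro ⟨_, w, ⟨χ, η, h1, h2, rfl⟩, h3, h⟩
    exact ⟨χ, η, w, h1, h2, h3, h⟩
  · rintro ⟨χ, η, w, h1, h2, h3, h⟩
    exact ⟨_, w, ⟨χ, η, h1, h2, rfl⟩, h3, h⟩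

theorem isRegularValue_hamiltonian {m κ Λ e Z : ℝ} (hm : 0 < m) (hκ : 0 < κ) (hΛ : 0 < Λ)
    {s : ℝ} (hs : 0 < s) (hq : relBound (Λ / m) e (coulombStrength e Z) s < 1) :
    IsRegularValue (hamiltonian m e Z κ Λ) ((-s : ℝ) : ℂ) := by
  -- The Coulomb potential is grouped with the interaction, so that the unperturbed operator stays
  -- p²/2 + H_f.
  refine isRegularValue_of_perturbation isResolventOf_field hs hq
    (B := potential (fun x => -(e ^ 2 * Z / (4 * Real.pi * ‖x‖))) + interaction m e κ Λ)
    (fun x z => ?_) fun y => ?_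
  · simp only [hamiltonian, atomicHamiltonian, mem_graph_add_iff]
    constructor
    · rintro ⟨_, w, ⟨_, η, ⟨χ, v, h1, h4, rfl⟩, h2, rfl⟩, h3, h⟩
      exact ⟨χ, η, _, h1, h2, ⟨v, w, h4, h3, rfl⟩, by rw [h]; abel⟩
    · rintro ⟨χ, η, _, h1, h2, ⟨v, w, h4, h3, rfl⟩, h⟩
      exact ⟨_, w, ⟨_, η, ⟨χ, v, h1, h4, rfl⟩, h2, rfl⟩, h3, by rw [h]; abel⟩
  · obtain ⟨w, h1, h2⟩ := exists_interaction_mem hm hκ hΛ hs e y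
    obtain ⟨v, h3, h4⟩ := exists_coulomb_freeResolvent_mem isResolventOf_field hs (coulomb_eq e Z) y
    refine ⟨v + w, mem_graph_add_iff.mpr ⟨v, w, h3, h1, rfl⟩, (norm_add_le _ _).trans ?_⟩
    have e1 : relBound (Λ / m) e (coulombStrength e Z) s
        = relBound (Λ / m) e 0 s + 2 * |coulombStrength e Z| * (Real.sqrt s)⁻¹ := by
      rw [relBound, relBound, abs_zero, mul_zero, zero_mul, add_zero]
    rw [e1, add_mul]
    linarith

end RegularValues

/-! ### Regularized hydrogenic ground states -/

section Trial

open Filter Topology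

theorem integrable_radial_exp {α : ℝ} (hα : 0 < α) (n : ℕ) :
    IntegrableOn (fun r : ℝ => r ^ n * Real.exp (-(2 * α * r))) (Set.Ioi 0) ∧
    ∫ r in Set.Ioi (0 : ℝ), r ^ n * Real.exp (-(2 * α * r)) = (1 / (2 * α)) ^ (n + 1) * n.factorial := by
  have h := Real.integral_rpow_mul_exp_neg_mul_Ioi (a := (n : ℝ) + 1) (r := 2 * α)
    (by positivity) (by positivity)
  rw [add_sub_cancel_right, Real.Gamma_nat_eq_factorial, ← Nat.cast_succ] at h
  simp only [Real.rpow_natCast] at h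
  -- A function that is not integrable has integral zero by convention, so the positive value also
  -- proves integrability.
  refine ⟨.of_integral_ne_zero (μ := volume.restrict (Set.Ioi 0)) ?_, h⟩
  rw [h]
  positivity

theorem integrable_exp_norm {α : ℝ} (hα : 0 < α) :
    Integrable fun x : R3 => Real.exp (-(2 * α * ‖x‖)) := by
  rw [integrable_fun_norm_addHaar volume (f := fun r => Real.exp (-(2 * α * r)))]
  simpa using (integrable_radial_exp hα 2).1

theorem sq_mul_inv_mul (r c : ℝ) : r ^ 2 * (r⁻¹ * c) = r ^ 1 * c := by
  rcases eq_or_ne r 0 with rfl | h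
  · simp
  · field_simp

theorem integrable_inv_mul_exp_norm {α : ℝ} (hα : 0 < α) :
    Integrable fun x : R3 => ‖x‖⁻¹ * Real.exp (-(2 * α * ‖x‖)) := by
  rw [integrable_fun_norm_addHaar volume (f := fun r => r⁻¹ * Real.exp (-(2 * α * r)))]
  simpa [sq_mul_inv_mul] using (integrable_radial_exp hα 1).1

/-- In polar coordinates both sides are factorials over powers of 2α. This is the virial identity of
the hydrogenic ground state and the source of the exact constant α²/2. -/
theorem integral_inv_mul_exp_norm {α : ℝ} (hα : 0 < α) :
    ∫ x : R3, ‖x‖⁻¹ * Real.exp (-(2 * α * ‖x‖)) = α * ∫ x : R3, Real.exp (-(2 * α * ‖x‖)) := by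
  rw [integral_fun_norm_addHaar volume (fun r => r⁻¹ * Real.exp (-(2 * α * r))),
    integral_fun_norm_addHaar volume (fun r => Real.exp (-(2 * α * r)))]
  simp only [finrank_euclideanSpace, Fintype.card_fin, smul_eq_mul, nsmul_eq_mul]
  norm_num only
  simp only [sq_mul_inv_mul]
  rw [(integrable_radial_exp hα 1).2, (integrable_radial_exp hα 2).2]
  simp only [Nat.factorial]
  push_cast
  field_simp

/-- The regularized distance to the origin. -/
def softNorm (δ : ℝ) (x : R3) : ℝ := Real.sqrt (‖x‖ ^ 2 + δ)

/-- The regularized hydrogenic ground state. -/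
def trial (α δ : ℝ) (x : R3) : ℝ := Real.exp (-(α * softNorm δ x))

/-- The `j`-th derivative of `trial`. -/
def trial' (α δ : ℝ) (j : Fin 3) (x : R3) : ℝ := -α * x j * (softNorm δ x)⁻¹ * trial α δ x

/-- The second `j`-th derivative of `trial`. -/
def trial'' (α δ : ℝ) (j : Fin 3) (x : R3) : ℝ :=
  (-α * ((softNorm δ x)⁻¹ - x j ^ 2 * ((softNorm δ x)⁻¹) ^ 3)
    + α ^ 2 * (x j ^ 2 * ((softNorm δ x)⁻¹) ^ 2)) * trial α δ x

section

variable {α δ : ℝ} (hα : 0 < α) (hδ : 0 < δ)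

include hδ in
theorem softNorm_pos (x : R3) : 0 < softNorm δ x := Real.sqrt_pos.mpr (by positivity)

include hδ in
theorem norm_le_softNorm (x : R3) : ‖x‖ ≤ softNorm δ x :=
  Real.le_sqrt_of_sq_le (by linarith)

include hδ in
theorem softNorm_le (x : R3) : softNorm δ x ≤ ‖x‖ + Real.sqrt δ := by
  refine Real.sqrt_le_iff.mpr ⟨by positivity, ?_⟩
  have h1 := Real.sq_sqrt hδ.le
  have h2 : 0 ≤ ‖x‖ * Real.sqrt δ := by positivity
  nlinarith

include hδ in
theorem sqrt_le_softNorm (x : R3) : Real.sqrt δ ≤ softNorm δ x :=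
  Real.sqrt_le_sqrt (by linarith [sq_nonneg ‖x‖])

theorem continuous_softNorm : Continuous (softNorm δ) := by
  unfold softNorm
  fun_prop

theorem continuous_trial : Continuous (trial α δ) := by
  have := continuous_softNorm (δ := δ)
  unfold trial
  fun_prop

theorem trial_pos (x : R3) : 0 < trial α δ x := Real.exp_pos _

include hδ in
theorem continuous_inv_softNorm : Continuous fun x => (softNorm δ x)⁻¹ :=
  continuous_softNorm.inv₀ fun x => (softNorm_pos hδ x).ne'

include hδ in
theorem continuous_trial' (j : Fin 3) : Continuous (trial' α δ j) := by
  have h1 := continuous_inv_softNorm hδ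
  have h2 := continuous_trial (α := α) (δ := δ)
  unfold trial'
  fun_prop

include hδ in
theorem continuous_trial'' (j : Fin 3) : Continuous (trial'' α δ j) := by
  have h1 := continuous_inv_softNorm hδ
  have h2 := continuous_trial (α := α) (δ := δ)
  unfold trial''
  fun_prop

include hδ in
theorem hasDerivAt_softNorm_line (x : R3) (j : Fin 3) :
    HasDerivAt (fun t : ℝ => softNorm δ (x + t • basisVec j)) (x j * (softNorm δ x)⁻¹) 0 := by
  have h0 : (‖x + (0 : ℝ) • basisVec j‖ ^ 2 + δ) ≠ 0 := by positivity
  refine (((hasDerivAt_norm_sq_line x j).add_const δ).sqrt h0).congr_deriv ?_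
  rw [zero_smul, add_zero, ← softNorm]
  have := (softNorm_pos hδ x).ne'
  field_simp

include hδ in
theorem hasLineDerivAt_trial (x : R3) (j : Fin 3) :
    HasLineDerivAt ℝ (trial α δ) (trial' α δ j x) x (basisVec j) := by
  have h := ((hasDerivAt_softNorm_line hδ x j).const_mul α).neg.exp
  refine h.congr_deriv ?_
  simp only [Pi.neg_apply, zero_smul, add_zero, trial', trial]
  ring

include hδ in
theorem hasLineDerivAt_trial' (x : R3) (j : Fin 3) :
    HasLineDerivAt ℝ (trial' α δ j) (trial'' α δ j x) x (basisVec j) := by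
  have h1 := (hasDerivAt_softNorm_line hδ x j).inv
    (by rw [zero_smul, add_zero]; exact (softNorm_pos hδ x).ne')
  have h2 := ((hasDerivAt_coord_line x j).const_mul (-α)).mul h1
  have h3 := h2.mul (hasLineDerivAt_trial (α := α) hδ x j)
  refine h3.congr_deriv ?_
  simp only [zero_smul, add_zero, trial', trial'', Pi.inv_apply, Pi.mul_apply]
  have := (softNorm_pos hδ x).ne'
  field_simp
  ring

include hδ in
theorem coord_div_sq_le (x : R3) (j : Fin 3) : x j ^ 2 * ((softNorm δ x)⁻¹) ^ 2 ≤ 1 := by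
  have h0 := softNorm_pos hδ x
  rw [← mul_pow, ← div_eq_mul_inv, ← sq_abs, abs_div, abs_of_pos h0]
  refine pow_le_one₀ (by positivity) ?_
  rw [div_le_one h0]
  exact (abs_coord_le x j).trans (norm_le_softNorm hδ x)

include hα hδ in
theorem abs_trial'_le (j : Fin 3) (x : R3) : |trial' α δ j x| ≤ α * trial α δ x := by
  have h1 := coord_div_sq_le hδ x j
  rw [← mul_pow, sq_le_one_iff_abs_le_one] at h1
  have e : trial' α δ j x = -(α * (x j * (softNorm δ x)⁻¹) * trial α δ x) := by
    rw [trial']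
    ring
  rw [e, abs_neg, abs_mul, abs_mul, abs_of_pos hα, abs_of_pos (trial_pos x)]
  have := trial_pos (α := α) (δ := δ) x
  gcongr
  exact mul_le_of_le_one_right hα.le h1

include hα hδ in
theorem abs_trial''_le (j : Fin 3) (x : R3) :
    |trial'' α δ j x| ≤ (α * (Real.sqrt δ)⁻¹ + α ^ 2) * trial α δ x := by
  have h1 := coord_div_sq_le hδ x j
  have h0 : 0 ≤ x j ^ 2 * ((softNorm δ x)⁻¹) ^ 2 := by positivity
  have h2 : (softNorm δ x)⁻¹ ≤ (Real.sqrt δ)⁻¹ :=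
    inv_anti₀ (Real.sqrt_pos.mpr hδ) (sqrt_le_softNorm hδ x)
  have h3 : 0 < (softNorm δ x)⁻¹ := inv_pos.mpr (softNorm_pos hδ x)
  rw [trial'', abs_mul, abs_of_pos (trial_pos x)]
  have := trial_pos (α := α) (δ := δ) x
  gcongr
  have e : -α * ((softNorm δ x)⁻¹ - x j ^ 2 * (softNorm δ x)⁻¹ ^ 3)
      = -(α * ((softNorm δ x)⁻¹ * (1 - x j ^ 2 * (softNorm δ x)⁻¹ ^ 2))) := by ring
  have h5 : (softNorm δ x)⁻¹ * (1 - x j ^ 2 * (softNorm δ x)⁻¹ ^ 2) ≤ (Real.sqrt δ)⁻¹ :=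
    (mul_le_of_le_one_right h3.le (by linarith)).trans h2
  have h6 : 0 ≤ (softNorm δ x)⁻¹ * (1 - x j ^ 2 * (softNorm δ x)⁻¹ ^ 2) :=
    mul_nonneg h3.le (by linarith)
  have h7 : α ^ 2 * (x j ^ 2 * (softNorm δ x)⁻¹ ^ 2) ≤ α ^ 2 :=
    mul_le_of_le_one_right (by positivity) h1
  have h8 : 0 ≤ α ^ 2 * (x j ^ 2 * (softNorm δ x)⁻¹ ^ 2) := by positivity
  have h9 := mul_le_mul_of_nonneg_left h5 hα.le
  have h10 : 0 ≤ α * (√δ)⁻¹ := by positivity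
  have h11 := mul_nonneg hα.le h6
  have h12 : 0 ≤ α ^ 2 := by positivity
  rw [e, abs_le]
  constructor <;> linarith

include hα in
theorem trial_le_one (x : R3) : trial α δ x ≤ 1 := by
  rw [trial, Real.exp_le_one_iff, neg_nonpos]
  exact mul_nonneg hα.le (Real.sqrt_nonneg _)

include hα in
theorem bddFun_trial : BddFun (trial α δ) :=
  ⟨continuous_trial, 1, fun x => by
    rw [abs_of_pos (trial_pos x)]
    exact trial_le_one hα x⟩

include hα hδ in
theorem bddFun_trial' (j : Fin 3) : BddFun (trial' α δ j) :=
  ⟨continuous_trial' hδ j, α, fun x => (abs_trial'_le hα hδ j x).trans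
    (mul_le_of_le_one_right hα.le (trial_le_one hα x))⟩

include hα hδ in
theorem bddFun_trial'' (j : Fin 3) : BddFun (trial'' α δ j) :=
  ⟨continuous_trial'' hδ j, _, fun x => (abs_trial''_le hα hδ j x).trans
    (mul_le_of_le_one_right (by positivity) (trial_le_one hα x))⟩

include hδ in
-- The regularized distance has gradient of length at most one.
theorem sum_trial'_sq_le (x : R3) : ∑ j, trial' α δ j x ^ 2 ≤ α ^ 2 * trial α δ x ^ 2 := by
  have e : ∑ j, trial' α δ j x ^ 2
      = (‖x‖ ^ 2 * ((softNorm δ x)⁻¹) ^ 2) * (α ^ 2 * trial α δ x ^ 2) := by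
    rw [← sum_coord_sq]
    simp only [Fin.sum_univ_three, trial']
    ring
  rw [e]
  refine mul_le_of_le_one_left (by positivity) ?_
  rw [← mul_pow, ← div_eq_mul_inv]
  exact pow_le_one₀ (by have := softNorm_pos hδ x; positivity)
    ((div_le_one (softNorm_pos hδ x)).mpr (norm_le_softNorm hδ x))

theorem trial_sq (x : R3) : trial α δ x ^ 2 = Real.exp (-(2 * α * softNorm δ x)) := by
  rw [trial, ← Real.exp_nat_mul]
  congr 1
  push_cast
  ring

include hα hδ in
theorem trial_sq_le (x : R3) : trial α δ x ^ 2 ≤ Real.exp (-(2 * α * ‖x‖)) := by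
  rw [trial_sq, Real.exp_le_exp, neg_le_neg_iff]
  have := norm_le_softNorm hδ x
  gcongr

include hα hδ in
theorem le_trial_sq (x : R3) :
    Real.exp (-(2 * α * Real.sqrt δ)) * Real.exp (-(2 * α * ‖x‖)) ≤ trial α δ x ^ 2 := by
  rw [trial_sq, ← Real.exp_add, Real.exp_le_exp]
  have := mul_le_mul_of_nonneg_left (softNorm_le hδ x) (show 0 ≤ 2 * α by positivity)
  linarith

include hα hδ in
theorem integrable_trial_sq : Integrable fun x => trial α δ x ^ 2 :=
  (integrable_exp_norm hα).mono' (continuous_trial.pow 2).aestronglyMeasurable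
    (Eventually.of_forall fun x => by
      rw [Real.norm_eq_abs, abs_of_nonneg (sq_nonneg _)]
      exact trial_sq_le hα hδ x)

include hα hδ in
theorem integrable_inv_mul_trial_sq : Integrable fun x : R3 => ‖x‖⁻¹ * trial α δ x ^ 2 := by
  refine (integrable_inv_mul_exp_norm hα).mono' ?_ (Eventually.of_forall fun x => ?_)
  · have h1 : Measurable fun x : R3 => ‖x‖⁻¹ := by fun_prop
    exact (h1.mul (continuous_trial.pow 2).measurable).aestronglyMeasurable
  · rw [Real.norm_eq_abs, abs_of_nonneg (by positivity)]
    gcongr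
    exact trial_sq_le hα hδ x

include hα hδ in
theorem integral_trial_sq_pos : 0 < ∫ x, trial α δ x ^ 2 := by
  refine (integral_pos_iff_support_of_nonneg (fun x => sq_nonneg _)
    (integrable_trial_sq hα hδ)).mpr ?_
  have : Function.support (fun x => trial α δ x ^ 2) = Set.univ := by
    ext x
    simp [(trial_pos (α := α) (δ := δ) x).ne']
  rw [this]
  exact Measure.measure_univ_pos.mpr (NeZero.ne _)

include hα hδ in
-- The squared trial function lies between exp(-2α√δ)exp(-2α|x|) and exp(-2α|x|); the exact identity
-- for δ = 0 links the two bounds.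
theorem exp_mul_integral_trial_sq_le : Real.exp (-(2 * α * Real.sqrt δ)) * α * ∫ x, trial α δ x ^ 2
    ≤ ∫ x, ‖x‖⁻¹ * trial α δ x ^ 2 := by
  have h1 : ∫ x, trial α δ x ^ 2 ≤ ∫ x : R3, Real.exp (-(2 * α * ‖x‖)) :=
    integral_mono (integrable_trial_sq hα hδ) (integrable_exp_norm hα) (trial_sq_le hα hδ)
  calc _ ≤ Real.exp (-(2 * α * Real.sqrt δ)) * α * ∫ x : R3, Real.exp (-(2 * α * ‖x‖)) := by gcongr
    _ = ∫ x : R3, Real.exp (-(2 * α * Real.sqrt δ)) * (‖x‖⁻¹ * Real.exp (-(2 * α * ‖x‖))) := by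
        rw [integral_const_mul, integral_inv_mul_exp_norm hα, mul_assoc]
    _ ≤ _ := by
        refine integral_mono ((integrable_inv_mul_exp_norm hα).const_mul _)
          (integrable_inv_mul_trial_sq hα hδ) fun x => ?_
        dsimp only
        rw [mul_left_comm]
        gcongr
        exact le_trial_sq hα hδ x

end

theorem exists_trial_delta {α d : ℝ} (hα : 0 < α) (hd : 0 < d) :
    ∃ δ, 0 < δ ∧ (α - d) * ∫ x, trial α δ x ^ 2 ≤ ∫ x, ‖x‖⁻¹ * trial α δ x ^ 2 := by
  have h : Tendsto (fun δ : ℝ => Real.exp (-(2 * α * Real.sqrt δ)) * α) (𝓝 0) (𝓝 α) := by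
    have : Continuous fun δ : ℝ => Real.exp (-(2 * α * Real.sqrt δ)) * α := by fun_prop
    simpa using this.tendsto 0
  have h0 := h.mono_left (nhdsWithin_le_nhds (s := Set.Ioi 0))
  have h1 := h0.eventually_const_lt
    (show α - d < α by linarith)
  obtain ⟨δ, h2, h3⟩ := (h1.and self_mem_nhdsWithin).exists
  have hδ : 0 < δ := h3
  refine ⟨δ, hδ, le_trans ?_ (exp_mul_integral_trial_sq_le hα hδ)⟩
  exact mul_le_mul_of_nonneg_right h2.le (integral_trial_sq_pos hα hδ).le

end Trial

/-! ### The atom -/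

section Atom

variable {K : Type*} [NormedAddCommGroup K] [InnerProductSpace ℂ K] [CompleteSpace K]

theorem nontrivial_particleSpace [Nontrivial K] : Nontrivial (ParticleSpace K) := by
  obtain ⟨u, hu⟩ := exists_ne (0 : K)
  refine ⟨⟨indicatorConstLp 2 measurableSet_ball (measure_ball_lt_top (x := 0) (r := 1)).ne u, 0,
    fun h => ?_⟩⟩
  have h1 := congrArg norm h
  rw [norm_indicatorConstLp (by norm_num) (by norm_num), norm_zero] at h1
  have h2 : (0 : ℝ) < (volume : Measure R3).real (Metric.ball 0 1) := by
    rw [volume_ball_real]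
    positivity
  have h3 := norm_pos_iff.mpr hu
  have : 0 < ‖u‖ * (volume : Measure R3).real (Metric.ball 0 1) ^ (1 / (2 : ℝ≥0∞).toReal) := by
    positivity
  linarith

theorem inner_potential {V : R3 → ℝ} {ψ w : ParticleSpace K}
    (h : (ψ, w) ∈ (potential V : ParticleSpace K →ₗ.[ℂ] ParticleSpace K).graph) :
    (⟪ψ, w⟫_ℂ).re = ∫ x, V x * ‖ψ x‖ ^ 2 := by
  have h1 : ⟪ψ, w⟫_ℂ = ((∫ x, V x * ‖ψ x‖ ^ 2 : ℝ) : ℂ) := by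
    rw [L2.inner_def, ← integral_complex_ofReal]
    refine integral_congr_ae ?_
    filter_upwards [mem_potential_iff.mp h] with x hx
    rw [hx, inner_smul_right, inner_self_eq_norm_sq_to_K]
    push_cast
    rfl
  rw [h1, Complex.ofReal_re]

/-- With internal space ℂ and internal operator 0, the perturbation theory built for the field also
covers the bare atom. -/
theorem isResolventOf_zero : IsResolventOf ((0 : ℂ →ₗ[ℂ] ℂ).toPMap ⊤)
    fun t => ((t⁻¹ : ℝ) : ℂ) • ContinuousLinearMap.id ℂ ℂ where
  family :=
    { norm_le := fun t ht => by
        refine ContinuousLinearMap.opNorm_le_bound _ (by positivity) fun u => ?_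
        rw [_root_.smul_apply, norm_smul, Complex.norm_real, Real.norm_eq_abs,
          abs_of_pos (inv_pos.mpr ht), ContinuousLinearMap.id_apply]
      resolvent := fun s t hs ht => by
        ext
        simp only [_root_.sub_apply, _root_.smul_apply, ContinuousLinearMap.comp_apply,
          ContinuousLinearMap.id_apply, smul_eq_mul, mul_one]
        rw [← Complex.ofReal_sub, ← Complex.ofReal_mul, ← Complex.ofReal_mul]
        congr 1
        field_simp }
  mem s hs u := by
    rw [LinearPMap.mem_graph_iff]
    refine ⟨⟨_, trivial⟩, rfl, ?_⟩
    have h : (s : ℂ) ≠ 0 := by exact_mod_cast hs.ne'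
    simp [h]
  of_mem s hs u v h := by
    rw [LinearPMap.mem_graph_iff] at h
    obtain ⟨y, h1, h2⟩ := h
    have h3 : v = 0 := h2.symm
    have h : (s : ℂ) ≠ 0 := by exact_mod_cast hs.ne'
    rw [h3]
    simp [h]

theorem mem_fiberOp_zero {x η : ParticleSpace ℂ} :
    (x, η) ∈ (fiberOp fun _ => (0 : ℂ →ₗ[ℂ] ℂ).toPMap ⊤).graph ↔ η = 0 := by
  rw [mem_fiberOp_iff, Lp.eq_zero_iff_ae_eq_zero]
  refine Filter.eventually_congr (Filter.Eventually.of_forall fun t => ?_)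
  rw [LinearPMap.mem_graph_iff]
  constructor
  · rintro ⟨y, h1, h2⟩
    exact h2.symm
  · intro h
    exact ⟨⟨x t, trivial⟩, rfl, h.symm⟩

theorem atomicHamiltonian_symm (e Z : ℝ) :
    AdjointPair (atomicHamiltonian K e Z) (atomicHamiltonian K e Z) :=
  kinetic_symm.add (potential_symm _)

theorem isRegularValue_atomicHamiltonian {e Z s : ℝ} (hs : 0 < s)
    (hq : 2 * |coulombStrength e Z| * (Real.sqrt s)⁻¹ < 1) :
    IsRegularValue (atomicHamiltonian ℂ e Z) ((-s : ℝ) : ℂ) := by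
  refine isRegularValue_of_perturbation isResolventOf_zero hs hq (fun x z => ?_)
    (exists_coulomb_freeResolvent_mem isResolventOf_zero hs (coulomb_eq e Z))
  simp only [atomicHamiltonian, mem_graph_add_iff, mem_fiberOp_zero]
  constructor
  · rintro ⟨χ, w, h1, h2, h⟩
    exact ⟨χ, 0, w, h1, rfl, h2, by rw [h, add_zero]⟩
  · rintro ⟨χ, η, w, h1, rfl, h2, h⟩
    exact ⟨χ, w, h1, h2, by rw [h, add_zero]⟩

theorem atomicHamiltonian_variational (e Z : ℝ) :
    HasFiniteInf (atomicHamiltonian ℂ e Z) ∧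
    (∀ x y, (x, y) ∈ (atomicHamiltonian ℂ e Z).graph →
      atomEnergy e Z * ‖x‖ ^ 2 ≤ (⟪x, y⟫_ℂ).re) ∧
    ∀ d > 0, ∃ x y, (x, y) ∈ (atomicHamiltonian ℂ e Z).graph ∧ x ≠ 0 ∧
      (⟪x, y⟫_ℂ).re ≤ (atomEnergy e Z + d) * ‖x‖ ^ 2 := by
  have : Nontrivial (ParticleSpace ℂ) := nontrivial_particleSpace
  set a := 2 * |coulombStrength e Z| with ha
  have ha0 : 0 ≤ a := by positivity
  refine groundEnergy_variational (s₀ := a ^ 2) (atomicHamiltonian_symm e Z) fun s hs => ?_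
  have hs0 : 0 < s := (sq_nonneg a).trans_lt hs
  refine isRegularValue_atomicHamiltonian hs0 ?_
  rw [← div_eq_mul_inv, div_lt_one (Real.sqrt_pos.mpr hs0)]
  exact Real.lt_sqrt_of_sq_lt hs

theorem coulombStrength_pos {e Z : ℝ} (he : 0 < |e|) (hZ : 0 < Z) : 0 < coulombStrength e Z := by
  have h1 : e ≠ 0 := abs_pos.mp he
  unfold coulombStrength
  positivity

theorem integral_coulomb (α : ℝ) (e Z : ℝ) (hα : α = coulombStrength e Z) (g : R3 → ℝ) :
    ∫ x : R3, -(e ^ 2 * Z / (4 * Real.pi * ‖x‖)) * g x = -(α * ∫ x, ‖x‖⁻¹ * g x) := by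
  have h : ∀ x : R3, -(e ^ 2 * Z / (4 * Real.pi * ‖x‖)) * g x = -(α * (‖x‖⁻¹ * g x)) := by
    intro x
    rw [coulomb_eq, ← hα]
    ring
  simp only [h]
  rw [integral_neg, integral_const_mul]

/-- The Coulomb inequality, applied to near-minimizers of the atomic Hamiltonian. -/
theorem le_atomEnergy {e Z : ℝ} (hα : 0 ≤ coulombStrength e Z) :
    -(coulombStrength e Z ^ 2 / 2) ≤ atomEnergy e Z := by
  refine le_of_forall_pos_le_add fun d hd => ?_
  obtain ⟨x, y, h1, h2, h3⟩ := (atomicHamiltonian_variational e Z).2.2 d hd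
  rw [atomicHamiltonian] at h1
  obtain ⟨χ, w, h4, h5, h6⟩ := mem_graph_add_iff.mp h1
  dsimp only at h4 h5 h6
  obtain ⟨P, -, hP, -, -⟩ := mem_kinetic_iff.mp h4
  have h7 := (coulomb hP hα).2
  have h8 := inner_potential h5
  rw [integral_coulomb _ e Z rfl] at h8
  rw [h6, inner_add_right, Complex.add_re, inner_kinetic h4 hP, h8] at h3
  have hx : 0 < ‖x‖ ^ 2 := by have := norm_pos_iff.mpr h2; positivity
  refine le_of_mul_le_mul_right ?_ hx
  linarith

section TrialState

variable {α δ : ℝ} (hα : 0 < α) (hδ : 0 < δ)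
include hα hδ

theorem memLp_of_abs_le_trial {g : R3 → ℝ} (hg : Continuous g) {C : ℝ}
    (h : ∀ x, |g x| ≤ C * trial α δ x) : MemLp (fun x => (g x : ℂ)) 2 volume := by
  have hm : AEStronglyMeasurable (fun x => (g x : ℂ)) (volume : Measure R3) :=
    (Complex.continuous_ofReal.comp hg).aestronglyMeasurable
  rw [memLp_two_iff_integrable_sq_norm hm]
  refine ((integrable_trial_sq hα hδ).const_mul (C ^ 2)).mono' (hm.norm.pow 2)
    (Filter.Eventually.of_forall fun x => ?_)
  rw [Real.norm_eq_abs, abs_of_nonneg (sq_nonneg _), Complex.norm_real, Real.norm_eq_abs,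
    ← mul_pow]
  gcongr
  exact h x

/-- The regularization δ > 0 makes the trial function twice differentiable with derivatives bounded
by multiples of itself, hence it belongs to the operator domain of p² and not merely to the form
domain. -/
theorem exists_trial_state : ∃ (ψ χ : ParticleSpace ℂ) (P : Fin 3 → ParticleSpace ℂ),
    (ψ, χ) ∈ (kinetic ℂ).graph ∧ (∀ j, (ψ, P j) ∈ (momentum ℂ j).graph) ∧
    (∀ᵐ x, ‖ψ x‖ ^ 2 = trial α δ x ^ 2) ∧ ∑ j, ‖P j‖ ^ 2 ≤ α ^ 2 * ‖ψ‖ ^ 2 := by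
  have hd : ∀ {g g' : R3 → ℝ} {x v : R3}, HasLineDerivAt ℝ g (g' x) x v →
      HasLineDerivAt ℝ (fun x => (g x : ℂ)) ((fun x => (g' x : ℂ)) x) x v :=
    fun h => HasDerivAt.ofReal_comp h
  have m0 := memLp_of_abs_le_trial hα hδ (g := trial α δ) continuous_trial (C := 1) fun x => by
    rw [one_mul, abs_of_pos (trial_pos x)]
  have m1 := fun j => memLp_of_abs_le_trial hα hδ (continuous_trial' hδ j) (abs_trial'_le hα hδ j)
  have m2 := fun j => memLp_of_abs_le_trial hα hδ (continuous_trial'' hδ j) (abs_trial''_le hα hδ j)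
  have h1 := fun j => mem_momentum_of_hasLineDerivAt m0 (m1 j)
    fun x => hd (hasLineDerivAt_trial hδ x j)
  have h2 := fun j => mem_momentum_of_hasLineDerivAt (m1 j) (m2 j)
    fun x => hd (hasLineDerivAt_trial' hδ x j)
  refine ⟨m0.toLp, _, fun j => (-Complex.I) • (m1 j).toLp, mem_kinetic_iff.mpr ⟨_, _, h1,
    fun j => (momentum ℂ j).graph.smul_mem (-Complex.I) (h2 j), rfl⟩, h1, ?_, ?_⟩
  · filter_upwards [m0.coeFn_toLp] with x hx
    rw [hx, Complex.norm_real, Real.norm_eq_abs, sq_abs]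
  · refine norm_sq_le_of_ae ?_
    have h3 := ae_all_iff.mpr fun j => (m1 j).coeFn_toLp
    have h4 := ae_all_iff.mpr fun j => Lp.coeFn_smul (-Complex.I) (m1 j).toLp
    filter_upwards [m0.coeFn_toLp, h3, h4] with x e0 e1 e2
    have e3 : ∀ j, ‖((-Complex.I) • (m1 j).toLp : ParticleSpace ℂ) x‖ ^ 2 = trial' α δ j x ^ 2 := by
      intro j
      rw [e2, Pi.smul_apply, e1, norm_smul, norm_neg, Complex.norm_I, one_mul, Complex.norm_real,
        Real.norm_eq_abs, sq_abs]
    simp only [e3]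
    rw [e0, Complex.norm_real, Real.norm_eq_abs, sq_abs]
    exact sum_trial'_sq_le hδ x

end TrialState

theorem atomEnergy_le {e Z : ℝ} (hα : 0 < coulombStrength e Z) :
    atomEnergy e Z ≤ -(coulombStrength e Z ^ 2 / 2) := by
  set α := coulombStrength e Z with hαdef
  refine le_of_forall_pos_le_add fun d hd => ?_
  -- The tolerance d/α becomes d once the Coulomb integral is multiplied by α.
  obtain ⟨δ, hδ, h1⟩ := exists_trial_delta hα (d := d / α) (by positivity)
  obtain ⟨ψ, χ, P, h2, h3, h4, h5⟩ := exists_trial_state hα hδ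
  have hN : ‖ψ‖ ^ 2 = ∫ x, trial α δ x ^ 2 := by
    rw [norm_sq_eq_integral]
    exact integral_congr_ae h4
  obtain ⟨w, h6, -⟩ := exists_potential_mem h3 (coulomb_eq e Z)
  have h7 := (atomicHamiltonian_variational e Z).2.1 ψ (χ + w)
    (mem_graph_add_iff.mpr ⟨χ, w, h2, h6, rfl⟩)
  have h8 := inner_potential h6
  have e1 : ∫ x, ‖x‖⁻¹ * ‖ψ x‖ ^ 2 = ∫ x, ‖x‖⁻¹ * trial α δ x ^ 2 := by
    refine integral_congr_ae ?_
    filter_upwards [h4] with x hx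
    rw [hx]
  rw [integral_coulomb α e Z hαdef, e1] at h8
  rw [inner_add_right, Complex.add_re, inner_kinetic h2 h3, h8] at h7
  rw [← hN] at h1
  have hpos : 0 < ‖ψ‖ ^ 2 := hN ▸ integral_trial_sq_pos hα hδ
  refine le_of_mul_le_mul_right ?_ hpos
  have h9 := mul_le_mul_of_nonneg_left h1 hα.le
  have e2 : α * ((α - d / α) * ‖ψ‖ ^ 2) = (α ^ 2 - d) * ‖ψ‖ ^ 2 := by
    field_simp
  rw [e2] at h9
  linarith

theorem atomEnergy_eq {e Z : ℝ} (hα : 0 < coulombStrength e Z) :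
    atomEnergy e Z = -(coulombStrength e Z ^ 2 / 2) :=
  (atomEnergy_le hα).antisymm (le_atomEnergy hα.le)

end Atom

/-! ### Localization and translations -/

section Localization

open FourierTransform

/-- The operator `T` commutes with the linear map `W`. -/
def Preserves {E : Type*} [AddCommGroup E] [Module ℂ E] (W : E →ₗ[ℂ] E) (T : E →ₗ.[ℂ] E) : Prop :=
  ∀ x y, (x, y) ∈ T.graph → (W x, W y) ∈ T.graph

section Preserves

variable {E : Type*} [AddCommGroup E] [Module ℂ E] {W : E →ₗ[ℂ] E} {S T : E →ₗ.[ℂ] E}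

theorem Preserves.add (hS : Preserves W S) (hT : Preserves W T) : Preserves W (S + T) := by
  intro x y h
  obtain ⟨a, b, ha, hb, e⟩ := mem_graph_add_iff.mp h
  exact mem_graph_add_iff.mpr ⟨_, _, hS _ _ ha, hT _ _ hb, by rw [← map_add, ← e]⟩

theorem Preserves.smul (hT : Preserves W T) (c : ℂ) : Preserves W (c • T) := by
  intro x y h
  obtain ⟨a, ha, e⟩ := mem_graph_smul_iff.mp h
  exact mem_graph_smul_iff.mpr ⟨_, hT _ _ ha, by rw [← map_smul, ← e]⟩

theorem Preserves.sum {T : Fin 3 → E →ₗ.[ℂ] E} (hT : ∀ j, Preserves W (T j)) :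
    Preserves W (∑ j, T j) := by
  simp only [Fin.sum_univ_three]
  exact ((hT 0).add (hT 1)).add (hT 2)

theorem Preserves.comp (hS : Preserves W S) (hT : Preserves W T) : Preserves W (opComp S T) := by
  intro x y h
  obtain ⟨z, h1, h2⟩ := mem_graph_opComp_iff.mp h
  exact mem_graph_opComp_iff.mpr ⟨_, hT _ _ h1, hS _ _ h2⟩

end Preserves

variable {K : Type*} [NormedAddCommGroup K] [InnerProductSpace ℂ K] [CompleteSpace K]

theorem preserves_mulCLM {g : R3 → ℝ} (hg : BddFun g) (T : R3 → K →ₗ.[ℂ] K) :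
    Preserves (mulCLM g : ParticleSpace K →L[ℂ] ParticleSpace K).toLinearMap (fiberOp T) := by
  intro x y h
  rw [mem_fiberOp_iff] at h ⊢
  filter_upwards [h, mulCLM_ae hg x, mulCLM_ae hg y] with t h1 h2 h3
  change ((mulCLM g x : ParticleSpace K) t, (mulCLM g y : ParticleSpace K) t) ∈ _
  rw [h2, h3]
  exact (T t).graph.smul_mem _ h1

/-! ### Contributions to the commutator with a localization function. -/

section LocalizationError

variable {f f' f'' : R3 → ℝ} (hf : BddFun f) (hf' : BddFun f') (hf'' : BddFun f'') {j : Fin 3}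
  (hd : ∀ x, HasLineDerivAt ℝ f (f' x) x (basisVec j))
  (hd' : ∀ x, HasLineDerivAt ℝ f' (f'' x) x (basisVec j))
include hf hf'

theorem inner_mulCLM_mulCLM (ψ φ : ParticleSpace K) :
    ⟪mulCLM f ψ, mulCLM f' φ⟫_ℂ = ⟪ψ, mulCLM (fun x => f x * f' x) φ⟫_ℂ := by
  rw [inner_mulCLM_comm hf, mulCLM_mul hf hf']

/-- The field operators do not contribute to the localization error. -/
theorem re_inner_field {T T' : R3 → K →ₗ.[ℂ] K} (h : ∀ x, AdjointPair (T x) (T' x))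
    {ψ b c : ParticleSpace K} (hb : (ψ, b) ∈ (fiberOp T).graph)
    (hc : (ψ, c) ∈ (fiberOp T').graph) (e : ℝ) :
    (⟪mulCLM f ψ, (Complex.I * e) • mulCLM f' (b + c)⟫_ℂ).re = 0 := by
  have hg := hf.mul hf'
  have h1 := AdjointPair.fiberOp h _ _ (preserves_mulCLM hg T _ _ hb) _ _ hc
  have h2 : ⟪mulCLM (fun x => f x * f' x) b, ψ⟫_ℂ = ⟪mulCLM (fun x => f x * f' x) ψ, c⟫_ℂ := h1
  rw [inner_smul_right, inner_mulCLM_mulCLM hf hf', ← inner_mulCLM_comm hg, inner_add_right, ← h2,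
    inner_mulCLM_comm hg ψ b, ← inner_conj_symm (mulCLM _ b) ψ, Complex.add_conj, mul_assoc,
    ← Complex.ofReal_mul, Complex.re_mul_ofReal, Complex.I_re, zero_mul]

include hf'' hd hd' in
/-- The localization error of the kinetic energy. -/
theorem re_inner_kinetic_localization {ψ P : ParticleSpace K}
    (h : (ψ, P) ∈ (momentum K j).graph) :
    (⟪mulCLM f ψ, (-Complex.I) • mulCLM f' P - (1 / 2 : ℂ) • mulCLM f'' ψ⟫_ℂ).re
      = (1 / 2) * ∫ x, f' x ^ 2 * ‖ψ x‖ ^ 2 := by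
  have hg := hf.mul hf'
  have hg' : BddFun fun x => f' x * f' x + f x * f'' x := (hf'.mul hf').add (hf.mul hf'')
  have hgd : ∀ x, HasLineDerivAt ℝ (fun x => f x * f' x) (f' x * f' x + f x * f'' x) x
      (basisVec j) := by
    intro x
    have h1 := HasDerivAt.mul (hd x) (hd' x)
    refine HasDerivAt.congr_deriv h1 ?_
    rw [zero_smul, add_zero]
  -- The imaginary part of this identity expresses Im⟨ff'ψ, p_jψ⟩ through ∫(ff')'|ψ|². Its ff'' part
  -- cancels the second-derivative term of the error and leaves half of ∫f'²|ψ|².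
  have h1 := momentum_symm j _ _ h _ _ (momentum_mul hg hg' hgd h)
  rw [← inner_mulCLM_comm hg, ← inner_conj_symm, inner_sub_right, inner_smul_right,
    ← inner_mulCLM_comm hg' ψ ψ, inner_mulCLM_self hg'] at h1
  have h2 := congrArg Complex.im h1
  rw [Complex.conj_im, Complex.sub_im, Complex.I_mul_im, Complex.ofReal_re] at h2
  have i1 : ∫ x, (f' x * f' x + f x * f'' x) * ‖ψ x‖ ^ 2
      = (∫ x, f' x ^ 2 * ‖ψ x‖ ^ 2) + ∫ x, f x * f'' x * ‖ψ x‖ ^ 2 := by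
    rw [← integral_add]
    · refine integral_congr_ae (Filter.Eventually.of_forall fun x => ?_)
      dsimp only
      ring
    · simpa only [pow_two] using integrable_mul_norm_sq (hf'.mul hf') ψ
    · exact integrable_mul_norm_sq (hf.mul hf'') ψ
  rw [i1] at h2
  rw [inner_sub_right, inner_smul_right, inner_smul_right, inner_mulCLM_mulCLM hf hf',
    inner_mulCLM_mulCLM hf hf'', ← inner_mulCLM_comm (hf.mul hf'') ψ ψ,
    inner_mulCLM_self (hf.mul hf''), Complex.sub_re, neg_mul, Complex.neg_re, Complex.I_mul_re,
    neg_neg, show (1 / 2 : ℂ) = ((1 / 2 : ℝ) : ℂ) by norm_num, ← Complex.ofReal_mul,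
    Complex.ofReal_re]
  linarith

end LocalizationError

/-- The localization formula for the Hamiltonian without potential. -/
theorem exists_localization {T : R3 → K →ₗ.[ℂ] K} {A A' : Fin 3 → R3 → K →ₗ.[ℂ] K}
    (hA : ∀ j x, AdjointPair (A j x) (A' j x)) (e : ℝ) {f : R3 → ℝ} {f' f'' : Fin 3 → R3 → ℝ}
    (hf : BddFun f) (hf' : ∀ j, BddFun (f' j)) (hf'' : ∀ j, BddFun (f'' j))
    (hd : ∀ j x, HasLineDerivAt ℝ f (f' j x) x (basisVec j))
    (hd' : ∀ j x, HasLineDerivAt ℝ (f' j) (f'' j x) x (basisVec j)) {ψ χ : ParticleSpace K}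
    (h : (ψ, χ) ∈ (kinetic K + fiberOp T + fieldInteraction e A A').graph) :
    ∃ χ', (mulCLM f ψ, χ') ∈ (kinetic K + fiberOp T + fieldInteraction e A A').graph ∧
      (∃ P : Fin 3 → ParticleSpace K, ∀ j, (mulCLM f ψ, P j) ∈ (momentum K j).graph) ∧
      (⟪mulCLM f ψ, χ'⟫_ℂ).re = (⟪mulCLM f ψ, mulCLM f χ⟫_ℂ).re
        + (1 / 2) * ∑ j, ∫ x, f' j x ^ 2 * ‖ψ x‖ ^ 2 := by
  obtain ⟨z, i, hz, hi, rfl⟩ := mem_graph_add_iff.mp h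
  obtain ⟨k, η, hk, hη, rfl⟩ := mem_graph_add_iff.mp hz
  obtain ⟨P, Q, hP, hQ, rfl⟩ := mem_kinetic_iff.mp hk
  obtain ⟨_, i₂, h1, h2, rfl⟩ := mem_graph_add_iff.mp hi
  obtain ⟨_, h1, rfl⟩ := mem_graph_smul_iff.mp h1
  obtain ⟨r, hr, rfl⟩ := mem_graph_sum_iff.mp h1
  have hr' := fun j => mem_graph_add_iff.mp (hr j)
  choose u v hu hv huv using hr'
  obtain rfl : r = fun j => u j + v j := funext huv
  have hu' := fun j => mem_graph_opComp_iff.mp (hu j)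
  choose b hb hbu using hu'
  have hv' : ∀ j, (P j, v j) ∈ (fiberOp (A' j)).graph := by
    intro j
    obtain ⟨P', h3, h4⟩ := mem_graph_opComp_iff.mp (hv j)
    rwa [graph_unique (hP j) h3]
  -- That ψ itself lies in the domain of A* is read off from the term A*² of the interaction; in
  -- A*·p the operator A* acts on p_jψ.
  have hc : ∀ j, ∃ c, (ψ, c) ∈ (fiberOp (A' j)).graph := by
    obtain ⟨_, h3, -⟩ := mem_graph_smul_iff.mp h2
    obtain ⟨_, h4, -⟩ := mem_graph_sum_iff.mp h3
    intro j
    obtain ⟨_, _, -, h5, -⟩ := mem_graph_add_iff.mp (h4 j)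
    obtain ⟨c, h6, -⟩ := mem_graph_opComp_iff.mp h5
    exact ⟨c, h6⟩
  choose c hc using hc
  have pA := fun j => preserves_mulCLM hf (A j)
  have pA' := fun j => preserves_mulCLM hf (A' j)
  have h2' := (Preserves.smul (Preserves.sum fun j =>
    (((pA j).comp (pA j)).add (((pA' j).comp (pA j)).smul 2)).add ((pA' j).comp (pA' j)))
    ((e : ℂ) ^ 2 / 2)) _ _ h2
  have q1 : ∀ j, (mulCLM f ψ, mulCLM f (P j) - Complex.I • mulCLM (f' j) ψ)
      ∈ (momentum K j).graph := fun j => momentum_mul hf (hf' j) (hd j) (hP j)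
  have q2 : ∀ j, (mulCLM f (P j) - Complex.I • mulCLM (f' j) ψ,
      (mulCLM f (Q j) - Complex.I • mulCLM (f' j) (P j))
        - Complex.I • (mulCLM (f' j) (P j) - Complex.I • mulCLM (f'' j) ψ))
      ∈ (momentum K j).graph := fun j =>
    (momentum K j).graph.sub_mem (momentum_mul hf (hf' j) (hd j) (hQ j))
      ((momentum K j).graph.smul_mem Complex.I (momentum_mul (hf' j) (hf'' j) (hd' j) (hP j)))
  have q3 : ∀ j, (mulCLM f ψ, mulCLM f (u j) - Complex.I • mulCLM (f' j) (b j))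
      ∈ (opComp (momentum K j) (fiberOp (A j))).graph := fun j =>
    mem_graph_opComp_iff.mpr ⟨_, pA j _ _ (hb j), momentum_mul hf (hf' j) (hd j) (hbu j)⟩
  have q4 : ∀ j, (mulCLM f ψ, mulCLM f (v j) - Complex.I • mulCLM (f' j) (c j))
      ∈ (opComp (fiberOp (A' j)) (momentum K j)).graph := fun j =>
    mem_graph_opComp_iff.mpr ⟨_, q1 j, (fiberOp (A' j)).graph.sub_mem (pA' j _ _ (hv' j))
      ((fiberOp (A' j)).graph.smul_mem Complex.I (preserves_mulCLM (hf' j) (A' j) _ _ (hc j)))⟩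
  refine ⟨(1 / 2 : ℂ) • ∑ j, ((mulCLM f (Q j) - Complex.I • mulCLM (f' j) (P j))
        - Complex.I • (mulCLM (f' j) (P j) - Complex.I • mulCLM (f'' j) ψ)) + mulCLM f η
      + ((e : ℂ) • ∑ j, (mulCLM f (u j) - Complex.I • mulCLM (f' j) (b j)
        + (mulCLM f (v j) - Complex.I • mulCLM (f' j) (c j))) + mulCLM f i₂),
    mem_graph_add_iff.mpr ⟨_, _, mem_graph_add_iff.mpr ⟨_, _, mem_kinetic_iff.mpr
    ⟨_, _, q1, q2, rfl⟩, preserves_mulCLM hf T _ _ hη, rfl⟩, mem_graph_add_iff.mpr ⟨_, _,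
    mem_graph_smul_iff.mpr ⟨_, mem_graph_sum_iff.mpr ⟨_, fun j => mem_graph_add_iff.mpr
    ⟨_, _, q3 j, q4 j, rfl⟩, rfl⟩, rfl⟩, h2', rfl⟩, rfl⟩, ⟨_, q1⟩, ?_⟩
  -- The left entry is the j-th part of H(fψ) - fHψ, namely (-if'p_j - f''/2)ψ - ief'(A_j + A_j*)ψ.
  -- Its field part has vanishing real expectation in fψ.
  have key : ∀ j, (⟪mulCLM f ψ, ((-Complex.I) • mulCLM (f' j) (P j)
      - (1 / 2 : ℂ) • mulCLM (f'' j) ψ) - (Complex.I * e) • mulCLM (f' j) (b j + c j)⟫_ℂ).re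
      = (1 / 2) * ∫ x, f' j x ^ 2 * ‖ψ x‖ ^ 2 := by
    intro j
    rw [inner_sub_right, Complex.sub_re, re_inner_field hf (hf' j) (hA j) (hb j) (hc j),
      re_inner_kinetic_localization hf (hf' j) (hf'' j) (hd j) (hd' j) (hP j), sub_zero]
  rw [Finset.mul_sum, ← Finset.sum_congr rfl fun j _ => key j, ← Complex.re_sum, ← inner_sum,
    ← Complex.add_re, ← inner_add_right]
  congr 2
  simp only [Fin.sum_univ_three, map_add, map_smul]
  have hI : Complex.I * Complex.I = -1 := Complex.I_mul_I
  have hII : ∀ w : ParticleSpace K, Complex.I • Complex.I • w = -w := fun w => by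
    rw [smul_smul, hI, neg_one_smul]
  simp only [smul_sub, hII, smul_add]
  module

/-- The translation by `y`, combined with the unitary `U` on the internal space. -/
def shift (U : K →L[ℂ] K) (y : R3) : ParticleSpace K →ₗ[ℂ] ParticleSpace K :=
  (fiberCLM fun _ => U).toLinearMap ∘ₗ
    Lp.compMeasurePreservingₗ ℂ (fun x : R3 => x - y) (measurePreserving_sub_right volume y)

theorem shift_apply (U : K →L[ℂ] K) (y : R3) (ψ : ParticleSpace K) :
    shift U y ψ = fiberCLM (fun _ => U) (translate y ψ) := rfl

theorem shift_ae (U : K →L[ℂ] K) (y : R3) (ψ : ParticleSpace K) :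
    ∀ᵐ x, shift U y ψ x = U (ψ (x - y)) := by
  filter_upwards [fiberCLM_ae (bddCont_const U) (translate y ψ), translate_ae y ψ] with x h1 h2
  rw [shift_apply, h1, h2]

theorem shift_momentum (U : K →L[ℂ] K) (y : R3) (j : Fin 3) :
    Preserves (shift U y) (momentum K j) := by
  intro ψ φ h
  have h1 := momentum_translate h y
  rw [shift_apply, shift_apply, mem_momentum_iff_fourier, fourier_fiberCLM_const,
    fourier_fiberCLM_const]
  filter_upwards [mem_momentum_iff_fourier.mp h1,
    fiberCLM_ae (bddCont_const U) (𝓕 (translate y ψ)),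
    fiberCLM_ae (bddCont_const U) (𝓕 (translate y φ))] with ξ e1 e2 e3
  rw [e2, e3, e1, map_smul]

theorem shift_kinetic (U : K →L[ℂ] K) (y : R3) : Preserves (shift U y) (kinetic K) :=
  (Preserves.sum fun j => (shift_momentum U y j).comp (shift_momentum U y j)).smul _

theorem shift_fiberOp {U : K →L[ℂ] K} {y : R3} {T : R3 → K →ₗ.[ℂ] K}
    (hT : ∀ x u v, (u, v) ∈ (T x).graph → (U u, U v) ∈ (T (x + y)).graph) :
    Preserves (shift U y) (fiberOp T) := by
  intro ψ φ h
  rw [mem_fiberOp_iff] at h ⊢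
  filter_upwards [ae_sub h y, shift_ae U y ψ, shift_ae U y φ] with x h1 h2 h3
  rw [h2, h3]
  have := hT _ _ _ h1
  rwa [sub_add_cancel] at this

theorem shift_fieldInteraction {U : K →L[ℂ] K} {y : R3} {A A' : Fin 3 → R3 → K →ₗ.[ℂ] K}
    (hA : ∀ j x u v, (u, v) ∈ (A j x).graph → (U u, U v) ∈ (A j (x + y)).graph)
    (hA' : ∀ j x u v, (u, v) ∈ (A' j x).graph → (U u, U v) ∈ (A' j (x + y)).graph) (e : ℝ) :
    Preserves (shift U y) (fieldInteraction e A A') := by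
  have p1 := fun j => shift_momentum U y j
  have p2 := fun j => shift_fiberOp (hA j)
  have p3 := fun j => shift_fiberOp (hA' j)
  exact ((Preserves.sum fun j => ((p1 j).comp (p2 j)).add ((p3 j).comp (p1 j))).smul _).add
    ((Preserves.sum fun j => (((p2 j).comp (p2 j)).add (((p3 j).comp (p2 j)).smul 2)).add
      ((p3 j).comp (p3 j))).smul _)

end Localization

/-! ### The binding energy -/

section Binding

open Convolution

/-- The inner integral is the convolution of g with the reflection of h. -/
theorem integral_average {g h : R3 → ℝ} (hg : Integrable g) (hh : Integrable h) :
    Integrable (fun y => ∫ x, g x * h (x - y)) ∧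
    ∫ y, ∫ x, g x * h (x - y) = (∫ x, g x) * ∫ x, h x := by
  have hh' : Integrable fun x => h (-x) := hh.comp_neg
  have e : (fun y => ∫ x, g x * h (x - y))
      = g ⋆[ContinuousLinearMap.mul ℝ ℝ, volume] fun x => h (-x) := by
    funext y
    simp only [convolution, ContinuousLinearMap.mul_apply', neg_sub]
  rw [e]
  refine ⟨hg.integrable_convolution _ hh', ?_⟩
  rw [integral_convolution _ hg hh', ContinuousLinearMap.mul_apply', integral_neg_eq_self h volume]

variable {K : Type*} [NormedAddCommGroup K] [InnerProductSpace ℂ K] [CompleteSpace K]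

theorem integrable_re_inner (ψ χ : ParticleSpace K) :
    Integrable fun x => (⟪ψ x, χ x⟫_ℂ).re := (L2.integrable_inner (𝕜 := ℂ) ψ χ).re

theorem re_inner_eq_integral (ψ χ : ParticleSpace K) :
    (⟪ψ, χ⟫_ℂ).re = ∫ x, (⟪ψ x, χ x⟫_ℂ).re := by
  rw [L2.inner_def]
  exact (integral_re (L2.integrable_inner (𝕜 := ℂ) ψ χ)).symm

theorem re_inner_mulCLM {f : R3 → ℝ} (hf : BddFun f) (ψ χ : ParticleSpace K) :
    (⟪mulCLM f ψ, mulCLM f χ⟫_ℂ).re = ∫ x, f x ^ 2 * (⟪ψ x, χ x⟫_ℂ).re := by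
  rw [re_inner_eq_integral]
  refine integral_congr_ae ?_
  filter_upwards [mulCLM_ae hf ψ, mulCLM_ae hf χ] with x h1 h2
  rw [h1, h2, inner_smul_left, inner_smul_right, Complex.conj_ofReal, ← mul_assoc,
    ← Complex.ofReal_mul, Complex.re_ofReal_mul, pow_two]

/-! ### Comparison of the energies with and without potential. -/

section Comparison

variable {T : K →ₗ.[ℂ] K} {A A' : Fin 3 → R3 → K →ₗ.[ℂ] K} {e Z E : ℝ}
  (hA : ∀ j x, AdjointPair (A j x) (A' j x)) (hα : 0 < coulombStrength e Z)
  (hE : ∀ x y, (x, y) ∈ (atomicHamiltonian K e Z + fiberOp (fun _ => T)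
    + fieldInteraction e A A').graph → E * ‖x‖ ^ 2 ≤ (⟪x, y⟫_ℂ).re)
include hA hα hE

/-- The lower bound E for the full Hamiltonian is tested on fψ: the localization error is at most
(α²/2)∫f²|ψ|², and the potential contributes the last term. -/
theorem localized_energy_le {δ : ℝ} (hδ : 0 < δ) {ψ χ : ParticleSpace K}
    (h : (ψ, χ) ∈ (kinetic K + fiberOp (fun _ => T) + fieldInteraction e A A').graph) :
    (E - coulombStrength e Z ^ 2 / 2) * ∫ x, trial (coulombStrength e Z) δ x ^ 2 * ‖ψ x‖ ^ 2
      ≤ (∫ x, trial (coulombStrength e Z) δ x ^ 2 * (⟪ψ x, χ x⟫_ℂ).re)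
      - coulombStrength e Z * ∫ x, (‖x‖⁻¹ * trial (coulombStrength e Z) δ x ^ 2) * ‖ψ x‖ ^ 2 := by
  set α := coulombStrength e Z with hαdef
  have hf := bddFun_trial (δ := δ) hα
  obtain ⟨χ', h1, ⟨P, h2⟩, h3⟩ := exists_localization hA e hf (bddFun_trial' hα hδ)
    (bddFun_trial'' hα hδ) (fun j x => hasLineDerivAt_trial hδ x j)
    (fun j x => hasLineDerivAt_trial' hδ x j) h
  obtain ⟨w, h4, -⟩ := exists_potential_mem h2 (coulomb_eq e Z)
  have h5 : (mulCLM (trial α δ) ψ, χ' + w) ∈ (atomicHamiltonian K e Z + fiberOp (fun _ => T)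
      + fieldInteraction e A A').graph := by
    obtain ⟨_, i, hz, hi, rfl⟩ := mem_graph_add_iff.mp h1
    obtain ⟨k, η, hk, hη, rfl⟩ := mem_graph_add_iff.mp hz
    exact mem_graph_add_iff.mpr ⟨k + w + η, i, mem_graph_add_iff.mpr ⟨k + w, η, mem_graph_add_iff.mpr
      ⟨k, w, hk, h4, rfl⟩, hη, rfl⟩, hi, by dsimp only; abel⟩
  have h6 := hE _ _ h5
  have h7 := inner_potential h4
  have e1 : ∫ x, ‖x‖⁻¹ * ‖mulCLM (trial α δ) ψ x‖ ^ 2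
      = ∫ x, (‖x‖⁻¹ * trial α δ x ^ 2) * ‖ψ x‖ ^ 2 := by
    refine integral_congr_ae ?_
    filter_upwards [mulCLM_ae hf ψ] with x hx
    rw [hx, norm_smul, Complex.norm_real, Real.norm_eq_abs, mul_pow, sq_abs, mul_assoc]
  rw [integral_coulomb α e Z hαdef, e1] at h7
  rw [inner_add_right, Complex.add_re, h3, h7, norm_mulCLM_sq hf, re_inner_mulCLM hf] at h6
  have i1 : ∀ j, Integrable fun x => trial' α δ j x ^ 2 * ‖ψ x‖ ^ 2 := fun j => by
    simpa only [← pow_two] using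
      integrable_mul_norm_sq ((bddFun_trial' hα hδ j).mul (bddFun_trial' hα hδ j)) ψ
  have i0 : Integrable fun x => trial α δ x ^ 2 * ‖ψ x‖ ^ 2 := by
    simpa only [← pow_two] using integrable_mul_norm_sq (hf.mul hf) ψ
  have e2 : ∑ j, ∫ x, trial' α δ j x ^ 2 * ‖ψ x‖ ^ 2
      ≤ α ^ 2 * ∫ x, trial α δ x ^ 2 * ‖ψ x‖ ^ 2 := by
    rw [← integral_finsetSum _ fun j _ => i1 j, ← integral_const_mul]
    refine integral_mono (integrable_finsetSum _ fun j _ => i1 j) (i0.const_mul _) fun x => ?_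
    dsimp only
    rw [← Finset.sum_mul, ← mul_assoc]
    exact mul_le_mul_of_nonneg_right (sum_trial'_sq_le hδ x) (by positivity)
  linarith

/-- The localized inequality holds for every translate of ψ. Integrated over the translations, each
integral splits into an integral of f times one of ψ, and α∫|x|⁻¹f² ≈ α²∫f² turns -α²/2 on the left
into +α²/2. -/
theorem energy_add_le {U : R3 → K →L[ℂ] K}
    (hU : ∀ y u v, ⟪U y u, U y v⟫_ℂ = ⟪u, v⟫_ℂ)
    (hT : ∀ y u v, (u, v) ∈ T.graph → (U y u, U y v) ∈ T.graph)
    (hUA : ∀ y j x u v, (u, v) ∈ (A j x).graph → (U y u, U y v) ∈ (A j (x + y)).graph)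
    (hUA' : ∀ y j x u v, (u, v) ∈ (A' j x).graph → (U y u, U y v) ∈ (A' j (x + y)).graph)
    {ψ χ : ParticleSpace K}
    (h : (ψ, χ) ∈ (kinetic K + fiberOp (fun _ => T) + fieldInteraction e A A').graph) :
    (E + coulombStrength e Z ^ 2 / 2) * ‖ψ‖ ^ 2 ≤ (⟪ψ, χ⟫_ℂ).re := by
  set α := coulombStrength e Z with hαdef
  have hUn : ∀ y u, ‖U y u‖ ^ 2 = ‖u‖ ^ 2 := by
    intro y u
    have := hU y u u
    rw [inner_self_eq_norm_sq_to_K, inner_self_eq_norm_sq_to_K] at this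
    exact_mod_cast this
  refine le_of_forall_pos_le_add fun d hd => ?_
  -- This tolerance becomes at most d after multiplication by α‖ψ‖²; the added one covers ψ = 0.
  have hd' : 0 < d / (α * (‖ψ‖ ^ 2 + 1)) := by positivity
  obtain ⟨δ, hδ, h1⟩ := exists_trial_delta hα hd'
  set G₀ := ∫ x, trial α δ x ^ 2 with hG₀
  set G₁ := ∫ x, ‖x‖⁻¹ * trial α δ x ^ 2 with hG₁
  have hG₀pos : 0 < G₀ := integral_trial_sq_pos hα hδ
  have a0 := integral_average (integrable_trial_sq hα hδ) (integrable_norm_sq ψ)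
  have a1 := integral_average (integrable_inv_mul_trial_sq hα hδ) (integrable_norm_sq ψ)
  have a2 := integral_average (integrable_trial_sq hα hδ) (integrable_re_inner ψ χ)
  have key : ∀ y, (E - α ^ 2 / 2) * ∫ x, trial α δ x ^ 2 * ‖ψ (x - y)‖ ^ 2
      ≤ (∫ x, trial α δ x ^ 2 * (⟪ψ (x - y), χ (x - y)⟫_ℂ).re)
      - α * ∫ x, (‖x‖⁻¹ * trial α δ x ^ 2) * ‖ψ (x - y)‖ ^ 2 := by
    intro y
    have h2 : (shift (U y) y ψ, shift (U y) y χ) ∈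
        (kinetic K + fiberOp (fun _ => T) + fieldInteraction e A A').graph :=
      ((shift_kinetic (U y) y).add (shift_fiberOp fun _ => hT y)).add
        (shift_fieldInteraction (hUA y) (hUA' y) e) _ _ h
    have h3 := localized_energy_le hA hα hE hδ h2
    have n1 : ∀ g : R3 → ℝ, ∫ x, g x * ‖shift (U y) y ψ x‖ ^ 2 = ∫ x, g x * ‖ψ (x - y)‖ ^ 2 := by
      intro g
      refine integral_congr_ae ?_
      filter_upwards [shift_ae (U y) y ψ] with x hx
      rw [hx, hUn]
    have n2 : ∀ g : R3 → ℝ, ∫ x, g x * (⟪shift (U y) y ψ x, shift (U y) y χ x⟫_ℂ).re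
        = ∫ x, g x * (⟪ψ (x - y), χ (x - y)⟫_ℂ).re := by
      intro g
      refine integral_congr_ae ?_
      filter_upwards [shift_ae (U y) y ψ, shift_ae (U y) y χ] with x hx hx'
      rw [hx, hx', hU]
    rwa [n1 fun x => trial α δ x ^ 2, n1 fun x => ‖x‖⁻¹ * trial α δ x ^ 2,
      n2 fun x => trial α δ x ^ 2] at h3
  have h4 := integral_mono (a0.1.const_mul (E - α ^ 2 / 2)) (a2.1.sub (a1.1.const_mul α)) key
  simp only [Pi.sub_apply] at h4
  rw [integral_const_mul, integral_sub a2.1 (a1.1.const_mul α), integral_const_mul, a0.2, a1.2,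
    a2.2, ← norm_sq_eq_integral, ← re_inner_eq_integral] at h4
  have h5 : α * ((α - d / (α * (‖ψ‖ ^ 2 + 1))) * G₀) * ‖ψ‖ ^ 2 ≤ α * G₁ * ‖ψ‖ ^ 2 := by gcongr
  have h6 : α * ((α - d / (α * (‖ψ‖ ^ 2 + 1))) * G₀) * ‖ψ‖ ^ 2
      = (α ^ 2 * ‖ψ‖ ^ 2 - d * (‖ψ‖ ^ 2 / (‖ψ‖ ^ 2 + 1))) * G₀ := by
    have : ‖ψ‖ ^ 2 + 1 ≠ 0 := by positivity
    field_simp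
  rw [h6] at h5
  have h7 : d * (‖ψ‖ ^ 2 / (‖ψ‖ ^ 2 + 1)) ≤ d :=
    mul_le_of_le_one_right hd.le ((div_le_one (by positivity)).mpr (by linarith))
  have h8 : (d * (‖ψ‖ ^ 2 / (‖ψ‖ ^ 2 + 1))) * G₀ ≤ d * G₀ := by gcongr
  refine le_of_mul_le_mul_left ?_ hG₀pos
  linarith

end Comparison

/-! ### The cutoff Hamiltonians -/

/-- The vacuum: the space of zero momenta is a single point of measure one, and the permutation
condition is empty. -/
theorem nontrivial_bosonSector_zero : Nontrivial (bosonSector 0) := by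
  set u : Lp ℂ 2 (volume : Measure (Fin 0 → R3)) :=
    indicatorConstLp 2 MeasurableSet.univ (measure_ne_top volume Set.univ) (1 : ℂ) with hu
  have h0 : u ∈ bosonSector 0 := by
    rw [bosonSector, Submodule.mem_iInf]
    intro σ
    rw [LinearMap.mem_eqLocus]
    refine Lp.ext ?_
    have h1 := Lp.coeFn_compMeasurePreserving u (measurePreserving_perm σ)
    filter_upwards [h1] with k hk
    refine hk.trans ?_
    rw [Function.comp_apply, Subsingleton.elim (k ∘ σ) k]
    rfl
  refine ⟨⟨⟨u, h0⟩, 0, fun h => ?_⟩⟩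
  have h1 := congrArg (fun v : bosonSector 0 => ‖(v : Lp ℂ 2 (volume : Measure (Fin 0 → R3)))‖) h
  dsimp only at h1
  rw [Submodule.coe_zero, norm_zero, hu, norm_indicatorConstLp (by norm_num) (by norm_num),
    norm_one, one_mul] at h1
  have h2 : (volume : Measure (Fin 0 → R3)).real Set.univ = 1 := by
    rw [Measure.real, volume_pi, Measure.pi_of_empty]
    simp
  rw [h2, Real.one_rpow] at h1
  exact one_ne_zero h1

theorem nontrivial_fockSpace : Nontrivial FockSpace := by
  have := nontrivial_bosonSector_zero
  obtain ⟨u, hu⟩ := exists_ne (0 : bosonSector 0)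
  refine ⟨⟨lp.single 2 0 u, 0, fun h => hu ?_⟩⟩
  have h1 := congrArg (fun v : FockSpace => v 0) h
  simpa using h1

variable {m Z e κ Λ : ℝ} (hm : 0 < m) (heUV : |e| < chargeUV Z) (hκ : 0 < κ) (hκΛ : κ < Λ)
include hm heUV hκ hκΛ

theorem hamiltonianFree_variational :
    HasFiniteInf (hamiltonianFree m e κ Λ) ∧
    (∀ x y, (x, y) ∈ (hamiltonianFree m e κ Λ).graph →
      groundEnergy (hamiltonianFree m e κ Λ) * ‖x‖ ^ 2 ≤ (⟪x, y⟫_ℂ).re) ∧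
    ∀ d > 0, ∃ x y, (x, y) ∈ (hamiltonianFree m e κ Λ).graph ∧ x ≠ 0 ∧
      (⟪x, y⟫_ℂ).re ≤ (groundEnergy (hamiltonianFree m e κ Λ) + d) * ‖x‖ ^ 2 := by
  have : Nontrivial FockSpace := nontrivial_fockSpace
  have : Nontrivial StateSpace := nontrivial_particleSpace
  obtain ⟨s₀, h0, h1⟩ := exists_relBound_lt_one heUV (Λ / m) 0
  exact groundEnergy_variational (hamiltonianFree_symm hm hκ e Λ) fun s hs =>
    isRegularValue_hamiltonianFree hm hκ (hκ.trans hκΛ) (h0.trans_lt hs) (h1 s hs)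

theorem hamiltonian_variational :
    HasFiniteInf (hamiltonian m e Z κ Λ) ∧
    (∀ x y, (x, y) ∈ (hamiltonian m e Z κ Λ).graph →
      groundEnergy (hamiltonian m e Z κ Λ) * ‖x‖ ^ 2 ≤ (⟪x, y⟫_ℂ).re) ∧
    ∀ d > 0, ∃ x y, (x, y) ∈ (hamiltonian m e Z κ Λ).graph ∧ x ≠ 0 ∧
      (⟪x, y⟫_ℂ).re ≤ (groundEnergy (hamiltonian m e Z κ Λ) + d) * ‖x‖ ^ 2 := by
  have : Nontrivial FockSpace := nontrivial_fockSpace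
  have : Nontrivial StateSpace := nontrivial_particleSpace
  obtain ⟨s₀, h0, h1⟩ := exists_relBound_lt_one heUV (Λ / m) (coulombStrength e Z)
  exact groundEnergy_variational (hamiltonian_symm hm hκ e Z Λ) fun s hs =>
    isRegularValue_hamiltonian hm hκ (hκ.trans hκΛ) (h0.trans_lt hs) (h1 s hs)

theorem le_bindingEnergy (hα : 0 < coulombStrength e Z) :
    coulombStrength e Z ^ 2 / 2 ≤ bindingEnergy m e Z κ Λ := by
  have hE := (hamiltonian_variational hm heUV hκ hκΛ).2.1
  -- Moving the particle by y multiplies the coupling function by exp(-ik·y), exactly the phase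
  -- produced by the field translation.
  have hcov : ∀ (j : Fin 3) (x y k : R3), coupling m κ Λ j (x + y) k
      = coupling m κ Λ j x k * Complex.exp (-(Complex.I * (⟪k, y⟫_ℝ : ℝ))) := fun j x y k =>
    planeWave_add (amplitude m κ Λ j) x y k
  refine le_of_forall_pos_le_add fun d hd => ?_
  obtain ⟨ψ, χ, h1, h2, h3⟩ := (hamiltonianFree_variational hm heUV hκ hκΛ).2.2 d hd
  have h4 := energy_add_le (T := fieldEnergy)
    (A := fun j x => annihilation (coupling m κ Λ j x))
    (A' := fun j x => creation (coupling m κ Λ j x))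
    (fun j x => annihilation_creation (adm_coupling hm hκ j x)) hα hE (U := fieldTrans)
    fieldTrans_inner_map (fun y u v => fieldTrans_fieldEnergy y)
    (fun y j x u v => fieldTrans_annihilation y (adm_coupling hm hκ j x)
      (adm_coupling hm hκ j (x + y)) (hcov j x y))
    (fun y j x u v => fieldTrans_creation y (hcov j x y)) h1
  have h5 : 0 < ‖ψ‖ ^ 2 := by
    have := norm_pos_iff.mpr h2
    positivity
  have h6 := le_of_mul_le_mul_right (h4.trans h3) h5
  rw [bindingEnergy]
  linarith

end Binding

end NelsonAtom

end

theorem mainTheorem3 (m Z e κ Λ : ℝ) (hm : 0 < m) (hZ : 0 < Z)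
    (he : 0 < |e|) (heUV : |e| < chargeUV Z) (hκ : 0 < κ) (hκΛ : κ < Λ) :
    -- the three infima of spectra are finite
    HasFiniteInf (atomicHamiltonian ℂ e Z) ∧
    HasFiniteInf (hamiltonianFree m e κ Λ) ∧
    HasFiniteInf (hamiltonian m e Z κ Λ) ∧
    -- the hydrogenic ground state energy
    atomEnergy e Z = -(e ^ 2 * Z / (4 * Real.pi)) ^ 2 / 2 ∧
    -- the lower bound on the binding energy, and its strict positivity
    -atomEnergy e Z ≤ bindingEnergy m e Z κ Λ ∧
    0 < bindingEnergy m e Z κ Λ := by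
  have hα := coulombStrength_pos he hZ
  have h := le_bindingEnergy hm heUV hκ hκΛ hα
  have hE := atomEnergy_eq hα
  refine ⟨(atomicHamiltonian_variational e Z).1, (hamiltonianFree_variational hm heUV hκ hκΛ).1,
    (hamiltonian_variational hm heUV hκ hκΛ).1, ?_, ?_, ?_⟩
  · rw [hE, coulombStrength]
    ring
  · rw [hE, neg_neg]
    exact h
  · exact lt_of_lt_of_le (by positivity) h
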